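/- **Setting.** Let $N\ge 1$. For a weight $W$ on $[-1,1]$ let $\phi_j(\mu)=\mu^j-\sum_{k<j}\frac{\kappa_{j,k}}{\kappa_{k,k}}\phi_k(\mu)$, $\kappa_{j,k}=\int_{-1}^1\mu^j\phi_kW\,d\mu$, be its monic orthogonal polynomials. For $\alpha\in(-1,1)$ write $\phi^{[\alpha]}_j,\kappa_{j,k}(\alpha)$ for the weight $\omega^{[\alpha]}=(1+\alpha\mu)^{-4}$ and $\tilde\phi^{[\alpha]}_j,\tilde\kappa_{j,k}(\alpha)$ for the weight $\tilde\omega^{[\alpha]}=(1+\alpha\mu)^{-5}$. For $w=(f_0,\alpha,f_2,\dots,f_N)$, and $f_1=0$, put $I_w(\mu)=\sum_{k=0}^N f_k\phi_k^{[\alpha]}(\mu)\,\omega^{[\alpha]}(\mu)$, let $g_i(h)=\tilde\kappa_{i,i}^{-1}\int_{-1}^1 h\,\tilde\phi^{[\alpha]}_i\,d\mu$ for $0\le i\le N$, and let $\tilde D(w)$ be the $(N+1)\times(N+1)$ matrix with entries $g_i(\partial_{w_j}I_w)$. Let the internal energy $e(\rho,\theta)$, the Planck function $b(\theta)$ and the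 absorption coefficient $\sigma_a(\theta)$ be smooth for $\rho,\theta>0$, with $\partial_\theta e>0$, $b>0$, $b'>0$, $\sigma_a>0$, and let $\sigma_s(\theta)$ be the scattering coefficient. For $u=(\rho,\rho v,\rho E)$ let $\theta=\theta(u)>0$ be defined by $e(\rho,\theta)=E-v^2/2$. The state space is $G=\{U=(u,w):\rho>0,\ \theta>0,\ \alpha\in(-1,1)\}$. The source of the Euler–HMP$_N$ system $\partial_tU+\frac1\varepsilon A(U;\varepsilon)\partial_xU=\frac1{\varepsilon^2}Q(U;\varepsilon)$ (where $\varepsilon=1/c$) is $$Q(U;\varepsilon)=\Big(0,\ \rho(\varepsilon\sigma_a+\varepsilon^3\sigma_s)\kappa_{1,0}(\alpha)f_0,\ \rho\sigma_a(\kappa_{0,0}(\alpha)f_0-b),\ \tilde D^{-1}\hat S\Big),$$ $$\hat S_i=g_i\Big(\rho\big[\tfrac12\sigma_ab+\tfrac12\varepsilon^2\sigma_s\textstyle\int_{-1}^1I_w\,d\nu-(\sigma_a+\varepsilon^2\sigma_s)I_w\big]\Big).$$ In the variables $\tilde U=(\tilde u,\tilde w)$ with $\tilde u=(\rho,\ \rho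 v+\varepsilon\kappa_{1,0}f_0,\ \rho E+\kappa_{0,0}f_0)$ and $\tilde w=(\kappa_{0,0}f_0-b(\theta),\ \alpha,\ f_2,\dots,f_N)$ the source is $(D_U\tilde U)\,Q(U;\varepsilon)$; let $q(\tilde u,\tilde w;\varepsilon)\in\mathbb R^{N+1}$ denote its last $N+1$ components, and let $\tilde G$ be the image of $G$ under $U\mapsto\tilde U$ at $\varepsilon=0$. For $L$-periodic $f$ let $\|f\|_k^2=\sum_{j\le k}\int_0^L|\partial_x^jf|^2dx$. **Lemma.** Let $L>0$ and let $\bar u_0:\mathbb R\to\mathbb R^3$ be smooth and $L$-periodic with $(\bar u_0(x),0)\in\tilde G$ for all $x$. There is $\delta>0$ such that for every smooth $L$-periodic $\bar w_0:\mathbb R\to\mathbb R^{N+1}$ with $\sup_x\max_i|\bar w_{0,i}(x)|\le\delta$ the zeroth-order initial-layer problem $$\partial_\tau I_0^{II}=q(\bar u_0(x),I_0^{II};0),\qquad I_0^{II}(x,0)=\bar w_0(x)$$ has a global solution $I_0^{II}(x,\tau)$, $x\in\mathbb R$, $\tau\ge0$, with $(\bar u_0(x),I_0^{II}(x,\tau))\in\tilde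 G$, which is smooth on $\mathbb R\times[0,\infty)$ and $L$-periodic in $x$. It is unique: for each $x$, every solution that stays in $\tilde G$ for all $\tau\ge0$ coincides with it. For all integers $s,m\ge0$ there are $C,\gamma>0$ such that, with $I_0=(0,I_0^{II})$, $$\|I_0(\cdot,\tau)\|_{s+m}\le Ce^{-\gamma\tau}\qquad\text{for all }\tau\ge0 .$$ -/

import Mathlib

open Set
open scoped ContDiff

namespace EulerHMP

noncomputable section

/-! ## Weighted orthogonal polynomials on `[-1, 1]` -/

/-- Monic Gram–Schmidt polynomials for the weight `W` on `[-1, 1]`: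
`φ_j = μ ^ j - ∑_{k < j} (κ_{j,k} / κ_{k,k}) φ_k` with `κ_{j,k} = ∫_{-1}^{1} μ ^ j φ_k W`. -/
def orthoPoly (W : ℝ → ℝ) (j : ℕ) : Polynomial ℝ :=
  Polynomial.X ^ j - ∑ k : Fin j,
    Polynomial.C ((∫ μ in (-1 : ℝ)..1, μ ^ j * (orthoPoly W k).eval μ * W μ) /
      (∫ μ in (-1 : ℝ)..1, μ ^ (k : ℕ) * (orthoPoly W k).eval μ * W μ)) * orthoPoly W k
termination_by j
decreasing_by all_goals exact k.2

/-- `κ_{j,k} = ∫_{-1}^{1} μ ^ j φ_k(μ) W(μ) dμ`. -/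
def kappa (W : ℝ → ℝ) (j k : ℕ) : ℝ :=
  ∫ μ in (-1 : ℝ)..1, μ ^ j * (orthoPoly W k).eval μ * W μ

/-- The weight `ω^{[α]}(μ) = (1 + α μ)⁻⁴` of the MP_N model. -/
def weight (α μ : ℝ) : ℝ := 1 / (1 + α * μ) ^ 4

/-- The weight `ω̃^{[α]}(μ) = (1 + α μ)⁻⁵` of the HMP_N model. -/
def weightT (α μ : ℝ) : ℝ := 1 / (1 + α * μ) ^ 5

/-! ## The moment ansatz

The radiation variables are `w = (f₀, α, f₂, …, f_N)`: the entry with index `1` is `α`, and the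
expansion coefficient `f₁` is zero. Throughout `1 ≤ N`. -/

/-- The expansion coefficient `f_k`. -/
def coeff {N : ℕ} (w : Fin (N + 1) → ℝ) (k : Fin (N + 1)) : ℝ := if k = 1 then 0 else w k

/-- The ansatz `PI(μ) = ∑_{k=0}^{N} f_k φ_k^{[α]}(μ) ω^{[α]}(μ)`. -/
def ansatz {N : ℕ} (w : Fin (N + 1) → ℝ) (μ : ℝ) : ℝ :=
  ∑ k : Fin (N + 1), coeff w k * (orthoPoly (weight (w 1)) k).eval μ * weight (w 1) μ

/-- The `i`-th coefficient `g_i = (∫_{-1}^{1} I φ̃_i dμ) / κ̃_{i,i}` of the orthogonal projection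
`P̃ I = ∑ g_i φ̃_i ω̃`. -/
def projCoeff (α : ℝ) (i : ℕ) (I : ℝ → ℝ) : ℝ :=
  (∫ μ in (-1 : ℝ)..1, I μ * (orthoPoly (weightT α) i).eval μ) / kappa (weightT α) i i

/-- The matrix `D̃(w)`: its `(i, j)` entry is the `i`-th coefficient of `P̃ (∂_{w_j} PI)`. -/
def matD {N : ℕ} (w : Fin (N + 1) → ℝ) : Matrix (Fin (N + 1)) (Fin (N + 1)) ℝ :=
  Matrix.of fun i j => projCoeff (w 1) i
    (fun μ => fderiv ℝ (fun z : Fin (N + 1) → ℝ => ansatz z μ) w (Pi.single j 1))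

/-! ## The medium and the Euler–HMP_N source -/

/-- Constitutive functions: specific internal energy `e(ρ, θ)`, Planck function `b(θ)`,
absorption coefficient `σ_a(θ)`, scattering coefficient `σ_s(θ)`. -/
structure Medium where
  e : ℝ → ℝ → ℝ
  b : ℝ → ℝ
  σa : ℝ → ℝ
  σs : ℝ → ℝ

/-- The standing assumptions on the constitutive functions, for `ρ > 0`, `θ > 0`.
(The scattering coefficient drops out at `ε = 0`; nothing is assumed on it.) -/
structure Medium.Admissible (M : Medium) : Prop where
  e_smooth : ContDiffOn ℝ ∞ (fun z : ℝ × ℝ => M.e z.1 z.2) (Ioi 0 ×ˢ Ioi 0)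
  e_deriv_pos : ∀ ρ > 0, ∀ θ > 0, 0 < deriv (M.e ρ) θ
  b_smooth : ContDiffOn ℝ ∞ M.b (Ioi 0)
  b_pos : ∀ θ > 0, 0 < M.b θ
  b_deriv_pos : ∀ θ > 0, 0 < deriv M.b θ
  σa_smooth : ContDiffOn ℝ ∞ M.σa (Ioi 0)
  σa_pos : ∀ θ > 0, 0 < M.σa θ

/-- The state space: pairs `(u, w)` of three fluid and `N + 1` radiation variables. -/
abbrev State (N : ℕ) : Type := (Fin 3 → ℝ) × (Fin (N + 1) → ℝ)

/-- Specific internal energy `E - v ^ 2 / 2` of the fluid state `u = (ρ, ρ v, ρ E)`. -/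
def internalEnergy (u : Fin 3 → ℝ) : ℝ := u 2 / u 0 - (u 1 / u 0) ^ 2 / 2

/-- The temperature `θ(u)`: the solution `θ > 0` of `e(ρ, θ) = E - v ^ 2 / 2`. -/
def Medium.temp (M : Medium) (u : Fin 3 → ℝ) : ℝ :=
  Function.invFunOn (M.e (u 0)) (Ioi 0) (internalEnergy u)

/-- The state space `G = {ρ > 0, θ > 0, α ∈ (-1, 1)}` in the variables
`u = (ρ, ρ v, ρ E)`, `w = (f₀, α, f₂, …, f_N)`. -/
def Medium.G (M : Medium) (N : ℕ) : Set (State N) :=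
  {U | 0 < U.1 0 ∧ (∃ θ > 0, M.e (U.1 0) θ = internalEnergy U.1) ∧ U.2 1 ∈ Ioo (-1 : ℝ) 1}

/-- `ε S(PI)`, the rescaled radiation source evaluated at the ansatz (`ε = 1 / c`). -/
def Medium.scaledSource (M : Medium) {N : ℕ} (ε : ℝ) (U : State N) (μ : ℝ) : ℝ :=
  U.1 0 * (M.σa (M.temp U.1) * M.b (M.temp U.1) / 2
    + ε ^ 2 * M.σs (M.temp U.1) / 2 * (∫ ν in (-1 : ℝ)..1, ansatz U.2 ν)
    - (M.σa (M.temp U.1) + ε ^ 2 * M.σs (M.temp U.1)) * ansatz U.2 μ)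

/-- The source `Q(U; ε) = (q⁽¹⁾, D̃⁻¹ Ŝ)` of the Euler–HMP_N system
`∂_t U + ε⁻¹ A(U; ε) ∂_x U = ε⁻² Q(U; ε)`. -/
def Medium.Q (M : Medium) {N : ℕ} (ε : ℝ) (U : State N) : State N :=
  (![0,
     U.1 0 * (ε * M.σa (M.temp U.1) + ε ^ 3 * M.σs (M.temp U.1))
       * (kappa (weight (U.2 1)) 1 0 * U.2 0),
     U.1 0 * M.σa (M.temp U.1)
       * (kappa (weight (U.2 1)) 0 0 * U.2 0 - M.b (M.temp U.1))],
   Matrix.mulVec (matD U.2)⁻¹ (fun i => projCoeff (U.2 1) i (M.scaledSource ε U)))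

/-! ## The transformed variables -/

/-- The change of variables `U ↦ Ũ = (ũ, w̃)`,
`ũ = (ρ, ρ v + ε κ_{1,0} f₀, ρ E + κ_{0,0} f₀)`,
`w̃ = (κ_{0,0} f₀ - b(θ), α, f₂, …, f_N)`. -/
def Medium.toTilde (M : Medium) {N : ℕ} (ε : ℝ) (U : State N) : State N :=
  (![U.1 0,
     U.1 1 + ε * (kappa (weight (U.2 1)) 1 0 * U.2 0),
     U.1 2 + kappa (weight (U.2 1)) 0 0 * U.2 0],
   Function.update U.2 0 (kappa (weight (U.2 1)) 0 0 * U.2 0 - M.b (M.temp U.1)))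

/-- The state space in the transformed variables. -/
def Medium.GTilde (M : Medium) (N : ℕ) (ε : ℝ) : Set (State N) := M.toTilde ε '' M.G N

/-- The inverse change of variables `Ũ ↦ U`. -/
def Medium.ofTilde (M : Medium) {N : ℕ} (ε : ℝ) (V : State N) : State N :=
  Function.invFunOn (M.toTilde ε) (M.G N) V

/-- The transformed source `Q̃(Ũ; ε) = (D_U Ũ) Q(U(Ũ); ε)`. -/
def Medium.QTilde (M : Medium) {N : ℕ} (ε : ℝ) (V : State N) : State N :=
  fderiv ℝ (M.toTilde ε) (M.ofTilde ε V) (M.Q ε (M.ofTilde ε V))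

/-- `q(u, w; ε)`: the last `N + 1` components of the transformed source. -/
def Medium.q (M : Medium) {N : ℕ} (u : Fin 3 → ℝ) (w : Fin (N + 1) → ℝ) (ε : ℝ) :
    Fin (N + 1) → ℝ :=
  (M.QTilde ε (u, w)).2

/-! ## The zeroth-order initial layer -/

/-- `I : x ↦ τ ↦ I(x, τ)` is a global (`τ ≥ 0`) solution, with states in the state space, of
`∂_τ I = q(ū₀(x), I; 0)`, `I(x, 0) = w̄₀(x)`. -/
def Medium.IsLayerSolution (M : Medium) {N : ℕ} (ubar : ℝ → Fin 3 → ℝ)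
    (wbar : ℝ → Fin (N + 1) → ℝ) (I : ℝ → ℝ → Fin (N + 1) → ℝ) : Prop :=
  ∀ x, I x 0 = wbar x ∧ ∀ τ ≥ 0, (ubar x, I x τ) ∈ M.GTilde N 0 ∧
    HasDerivWithinAt (I x) (M.q (ubar x) (I x τ) 0) (Ici 0) τ

/-- The norm of `H^k` over one period `[0, L]`, for smooth `L`-periodic vector functions:
`‖f‖_k ^ 2 = ∑_{j ≤ k} ∫_0^L |∂_x^j f| ^ 2 dx`. -/
def sobolevNorm {n : ℕ} (L : ℝ) (k : ℕ) (f : ℝ → Fin n → ℝ) : ℝ :=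
  Real.sqrt (∑ j ∈ Finset.range (k + 1),
    ∫ x in (0 : ℝ)..L, ∑ i, (iteratedDeriv j (fun y => f y i) x) ^ 2)

end

end EulerHMP

universe u

/-! At `ε = 0`, with `ũ` frozen, the source near `w̃ = 0` has the form `A(ũ, w̃) w̃`, and `A(ũ, 0)`
is diagonal with entries at most `-ρ σ_a(θ) < 0`. The equilibrium `w̃ = 0` is therefore linearly
stable, uniformly in `x` by periodicity, and small data decay exponentially.

The form of `A` rests on `1 = ω + α d` with `ω = (1 + α μ)⁻⁴` and `d = weightDefect`. For `j ≠ 1`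
column `j` of `D̃` is the coefficient vector of `φ_j ω`, and `f₁ = 0`, so `D̃⁻¹` returns the
coefficients of the ansatz exactly, while the isotropic emission `b / 2` becomes `b / 2 (e₀ + α D̃⁻¹
g(d))`. All that is not diagonal damping thus carries a factor `α` (`inv_matD_mulVec_source`,
`q_eq`). At an isotropic state both polynomial families are the monic Legendre polynomials, `D̃` is
diagonal and `D̃⁻¹ g(d) = -e₁ / f₀`; since `f₀ = b / 2` in equilibrium, this damps `α` at rate `ρ
σ_a` and leaves no other linear contribution of `α` (`alphaCoeff_equilibrium`). In entry `0` the
heating of the fluid only adds damping, because `b'` and `∂_θ e` are positive.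

Eliminating `f₀` from the transformed variables gives a scalar equation for `θ`, strictly increasing
in `θ`. Hence the change of variables has an explicit inverse, smooth by the implicit function
theorem (`contDiffAt_root`, `GTilde_eq`, `ofTilde_eq`).

For the dynamics, `A` is cut off outside a small ball. With `x` as a coordinate of zero velocity
this gives a bounded Lipschitz field with a smooth global flow (`IsFlow.contDiff`). A small ball is
invariant by dissipativity. Since the field is `A v`, its explicit `x`-derivative is `(∂_x A) v`, so
`∂_x v` solves a dissipative linear equation whose forcing decays like `v`; induction on the order
gives one rate for all derivatives (`decays_of_linear`, `exists_decaying_family`). Uniqueness needs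
only a local Lipschitz bound along the constructed solution (`eq_of_locally_lipschitz`). -/

namespace EulerHMP

/-! ### Superposition operators on spaces of continuous functions -/

section Nemytskii

open Topology

variable {K : Type*} [TopologicalSpace K] [CompactSpace K]

/-- Pointwise application of a continuous family of operators to a continuous family of vectors. -/
noncomputable def pointwiseApply (K : Type*) [TopologicalSpace K] [CompactSpace K]
    (E F : Type*) [NormedAddCommGroup E] [NormedSpace ℝ E] [NormedAddCommGroup F]
    [NormedSpace ℝ F] : C(K, E →L[ℝ] F) →L[ℝ] C(K, E) →L[ℝ] C(K, F) :=
  LinearMap.mkContinuous₂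
    (LinearMap.mk₂ ℝ (fun (A : C(K, E →L[ℝ] F)) (h : C(K, E)) =>
        (⟨fun x => A x (h x), by fun_prop⟩ : C(K, F)))
      (fun _ _ _ => by ext; simp) (fun _ _ _ => by ext; simp)
      (fun _ _ _ => by ext; simp) (fun _ _ _ => by ext; simp)) 1
    (fun A h => by
      rw [one_mul]
      refine (ContinuousMap.norm_le _ (by positivity)).2 fun x => ?_
      refine ((A x).le_opNorm (h x)).trans ?_
      gcongr
      · exact A.norm_coe_le_norm x
      · exact h.norm_coe_le_norm x)

@[simp] lemma pointwiseApply_apply {E F : Type*} [NormedAddCommGroup E] [NormedSpace ℝ E]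
    [NormedAddCommGroup F] [NormedSpace ℝ F] (A : C(K, E →L[ℝ] F)) (h : C(K, E)) (x : K) :
    pointwiseApply K E F A h x = A x (h x) := rfl

/-- The superposition operator of a continuously differentiable map is differentiable on `C(K, E)`. -/
lemma hasFDerivAt_postcomp {E F : Type*} [NormedAddCommGroup E] [NormedSpace ℝ E]
    [NormedAddCommGroup F] [NormedSpace ℝ F] (f : C(E, F)) (f' : C(E, E →L[ℝ] F))
    (hf : ∀ x, HasFDerivAt f (f' x) x) (g : C(K, E)) :
    HasFDerivAt (fun g : C(K, E) => f.comp g) (pointwiseApply K E F (f'.comp g)) g := by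
  rw [hasFDerivAt_iff_isLittleO_nhds_zero, Asymptotics.isLittleO_iff]
  intro c hc
  have hcont : Continuous fun g : C(K, E) => f'.comp g := ContinuousMap.continuous_postcomp f'
  obtain ⟨δ, hδ, h⟩ := Metric.continuousAt_iff (α := C(K, E))
    (β := C(K, E →L[ℝ] F)) |>.1 hcont.continuousAt c hc
  filter_upwards [Metric.ball_mem_nhds (0 : C(K, E)) hδ] with k hk
  refine (ContinuousMap.norm_le _ (by positivity)).2 fun x => ?_
  have hk' : ‖k‖ < δ := by simpa using hk
  -- Uniformity in `x` comes from the sup norm: each `g + t • k` is within `δ` of `g` in `C(K, E)`,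
  -- so continuity of `g ↦ f' ∘ g` bounds the variation of `f'` at all points of `K` at once.
  have key : ∀ z ∈ segment ℝ (g x) (g x + k x), ‖f' z - f' (g x)‖ ≤ c := by
    intro z hz
    rw [segment_eq_image'] at hz
    obtain ⟨t, ht, rfl⟩ := hz
    have hd : dist (g + t • k) g < δ := by
      rw [dist_eq_norm, add_sub_cancel_left, norm_smul, Real.norm_of_nonneg ht.1]
      exact (mul_le_of_le_one_left (norm_nonneg _) ht.2).trans_lt hk'
    have h2 := (ContinuousMap.dist_le hc.le).1 (h hd).le x
    simpa [dist_eq_norm] using h2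
  have h3 := (convex_segment (g x) (g x + k x)).norm_image_sub_le_of_norm_hasFDerivWithin_le'
    (f := f) (f' := f') (φ := f' (g x)) (C := c) (fun z _ => (hf z).hasFDerivWithinAt) key
    (left_mem_segment ℝ _ _) (right_mem_segment ℝ _ _)
  simp only [add_sub_cancel_left] at h3
  refine (h3.trans ?_)
  gcongr
  exact k.norm_coe_le_norm x

/-- The derivative is a fixed continuous linear map applied to the superposition operator of `f'`,
which has one order less. The target changes to `E →L[ℝ] F`, so `F` is quantified inside the
induction and lives in the universe of `E`. -/
lemma contDiff_postcomp_nat {E : Type u} [NormedAddCommGroup E] [NormedSpace ℝ E] (n : ℕ) :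
    ∀ {F : Type u} [NormedAddCommGroup F] [NormedSpace ℝ F] (f : C(E, F)),
      ContDiff ℝ n f → ContDiff ℝ n (fun g : C(K, E) => f.comp g) := by
  induction n with
  | zero =>
    intro F _ _ f _
    exact contDiff_zero.2 (ContinuousMap.continuous_postcomp f)
  | succ n ih =>
    intro F _ _ f hf
    push_cast at hf ⊢
    have hd : ContDiff ℝ n (fderiv ℝ f) := hf.fderiv_right le_rfl
    set f' : C(E, E →L[ℝ] F) := ⟨fderiv ℝ f, hd.continuous⟩
    refine contDiff_succ_iff_hasFDerivAt.2
      ⟨fun g => pointwiseApply K E F (f'.comp g), ?_, fun g => ?_⟩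
    · exact (pointwiseApply K E F).contDiff.comp (ih f' hd)
    · exact hasFDerivAt_postcomp f f'
        (fun x => (hf.differentiable (by simp) x).hasFDerivAt) g

/-- The superposition operator of a smooth map is smooth on `C(K, E)`. -/
lemma contDiff_postcomp {E F : Type u} [NormedAddCommGroup E] [NormedSpace ℝ E]
    [NormedAddCommGroup F] [NormedSpace ℝ F] (f : C(E, F)) (hf : ContDiff ℝ ∞ f) :
    ContDiff ℝ ∞ (fun g : C(K, E) => f.comp g) :=
  contDiff_infty.2 fun n => contDiff_postcomp_nat n f (hf.of_le (by exact_mod_cast le_top))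

end Nemytskii

/-! ### Global smooth flows of bounded Lipschitz vector fields -/

section Flow

open Topology unitInterval

variable {X : Type u} [NormedAddCommGroup X] [NormedSpace ℝ X]

lemma continuous_comp_projIcc {X : Type*} [TopologicalSpace X] (y : C(I, X)) :
    Continuous fun s : ℝ => y (projIcc 0 1 zero_le_one s) :=
  y.continuous.comp continuous_projIcc

/-- The operator `y ↦ ∫₀ᵗ y` on `C([0, 1], X)`. -/
noncomputable def primitive (X : Type*) [NormedAddCommGroup X] [NormedSpace ℝ X] :
    C(I, X) →L[ℝ] C(I, X) :=
  LinearMap.mkContinuous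
    { toFun := fun y => ⟨fun t => ∫ s in (0 : ℝ)..t, y (projIcc 0 1 zero_le_one s),
        (intervalIntegral.continuous_primitive
          (fun _ _ => (continuous_comp_projIcc y).intervalIntegrable _ _) 0).comp
          continuous_subtype_val⟩
      map_add' := fun y z => by
        ext t
        simpa using intervalIntegral.integral_add
          ((continuous_comp_projIcc y).intervalIntegrable 0 t)
          ((continuous_comp_projIcc z).intervalIntegrable 0 t)
      map_smul' := fun c y => by
        ext t
        simp } 1
    (fun y => by
      rw [one_mul]
      refine (ContinuousMap.norm_le _ (norm_nonneg _)).2 fun t => ?_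
      have := intervalIntegral.norm_integral_le_of_norm_le_const (a := 0) (b := (t : ℝ))
        (f := fun s => y (projIcc 0 1 zero_le_one s)) (C := ‖y‖)
        (fun s _ => y.norm_coe_le_norm _)
      refine this.trans ?_
      rw [sub_zero, abs_of_nonneg t.2.1]
      exact mul_le_of_le_one_right (norm_nonneg _) t.2.2)

lemma primitive_apply (y : C(I, X)) (t : I) :
    primitive X y t = ∫ s in (0 : ℝ)..t, y (projIcc 0 1 zero_le_one s) := rfl

/-- The global flow of a vector field. -/
structure IsFlow (V : X → X) (Φ : ℝ → X → X) : Prop where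
  zero : ∀ x, Φ 0 x = x
  deriv : ∀ x t, HasDerivAt (fun t => Φ t x) (V (Φ t x)) t

variable {V : X → X} {Φ : ℝ → X → X}

lemma IsFlow.continuous_time (h : IsFlow V Φ) (x : X) : Continuous fun t => Φ t x :=
  continuous_iff_continuousAt.2 fun t => (h.deriv x t).continuousAt

lemma IsFlow.eq_of_hasDerivAt (h : IsFlow V Φ) {K : NNReal} (hK : LipschitzWith K V) {x : X}
    {f : ℝ → X} (hf : ∀ t, HasDerivAt f (V (f t)) t) (h0 : f 0 = x) : f = fun t => Φ t x :=
  ODE_solution_unique_univ (v := fun _ => V) (s := fun _ => univ) (K := K) (t₀ := 0)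
    (fun _ => hK.lipschitzOnWith) (fun t => ⟨hf t, trivial⟩)
    (fun t => ⟨h.deriv x t, trivial⟩) (by rw [h0, h.zero])

lemma IsFlow.add (h : IsFlow V Φ) {K : NNReal} (hK : LipschitzWith K V) (s t : ℝ) (x : X) :
    Φ (t + s) x = Φ t (Φ s x) := by
  have := h.eq_of_hasDerivAt hK (x := Φ s x) (f := fun t => Φ (t + s) x)
    (fun t => (h.deriv x (t + s)).comp_add_const t s) (by simp)
  exact congrFun this t

lemma IsFlow.norm_sub_le (h : IsFlow V Φ) {B : ℝ} (hB : ∀ x, ‖V x‖ ≤ B) (t : ℝ) (x : X) :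
    ‖Φ t x - x‖ ≤ B * |t| := by
  have := convex_univ.norm_image_sub_le_of_norm_hasDerivWithin_le (f := fun t => Φ t x)
    (fun t _ => (h.deriv x t).hasDerivWithinAt) (fun t _ => hB (Φ t x)) (mem_univ 0) (mem_univ t)
  simpa [h.zero] using this

/-- The rescaled trajectory `s ↦ Φ (λ s) x` on `[0, 1]`. -/
noncomputable def IsFlow.traj (h : IsFlow V Φ) (p : ℝ × X) : C(I, X) :=
  ⟨fun s => Φ (p.1 * s) p.2,
    (h.continuous_time p.2).comp (continuous_const.mul continuous_subtype_val)⟩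

/-- The implicit function theorem describes solutions of the integral equation only near the base
point; this puts the actual trajectories there for small times. -/
lemma IsFlow.tendsto_traj (h : IsFlow V Φ) {B : ℝ} (hB : ∀ x, ‖V x‖ ≤ B) (x : X) :
    Filter.Tendsto h.traj (𝓝 (0, x)) (𝓝 (ContinuousMap.const I x)) := by
  rw [tendsto_iff_norm_sub_tendsto_zero]
  have hlim : Filter.Tendsto (fun p : ℝ × X => B * |p.1| + ‖p.2 - x‖) (𝓝 (0, x)) (𝓝 0) := by
    have : Continuous (fun p : ℝ × X => B * |p.1| + ‖p.2 - x‖) := by fun_prop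
    simpa using this.tendsto (0, x)
  have hB0 : 0 ≤ B := (norm_nonneg _).trans (hB x)
  refine squeeze_zero (fun _ => norm_nonneg _) (fun p => ?_) hlim
  refine (ContinuousMap.norm_le _ (by positivity)).2 fun s => ?_
  have h1 := h.norm_sub_le hB (p.1 * s) p.2
  have h2 : |p.1 * (s : ℝ)| ≤ |p.1| := by
    rw [abs_mul, abs_of_nonneg s.2.1]
    exact mul_le_of_le_one_right (abs_nonneg _) s.2.2
  calc ‖Φ (p.1 * s) p.2 - x‖ = ‖(Φ (p.1 * s) p.2 - p.2) + (p.2 - x)‖ := by congr 1; abel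
    _ ≤ ‖Φ (p.1 * s) p.2 - p.2‖ + ‖p.2 - x‖ := norm_add_le _ _
    _ ≤ _ := by gcongr; exact h1.trans (by gcongr)

/-- The integral equation of the rescaled trajectories. -/
noncomputable def integralEq (V : C(X, X)) (z : (ℝ × X) × C(I, X)) : C(I, X) :=
  z.2 - ContinuousMap.const I z.1.2 - z.1.1 • primitive X (V.comp z.2)

lemma contDiff_integralEq (V : C(X, X)) (hV : ContDiff ℝ ∞ V) : ContDiff ℝ ∞ (integralEq V) := by
  have h1 : ContDiff ℝ ∞ fun z : (ℝ × X) × C(I, X) => V.comp z.2 :=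
    (contDiff_postcomp V hV).comp contDiff_snd
  have h2 : ContDiff ℝ ∞ fun z : (ℝ × X) × C(I, X) => ContinuousMap.const I z.1.2 := by
    have : (fun z : (ℝ × X) × C(I, X) => ContinuousMap.const I z.1.2) =
        fun z => ContinuousLinearMap.const ℝ I z.1.2 := rfl
    rw [this]
    fun_prop
  unfold integralEq
  exact (contDiff_snd.sub h2).sub
    ((contDiff_fst.comp contDiff_fst).smul ((primitive X).contDiff.comp h1))

lemma IsFlow.integralEq_traj {V : C(X, X)} [CompleteSpace X] (h : IsFlow V Φ) (p : ℝ × X) :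
    integralEq V (p, h.traj p) = 0 := by
  ext t
  have h1 : ∫ s in (0 : ℝ)..t, p.1 • V (Φ (p.1 * s) p.2) = Φ (p.1 * t) p.2 - Φ (p.1 * 0) p.2 := by
    refine intervalIntegral.integral_eq_sub_of_hasDerivAt (f := fun s => Φ (p.1 * s) p.2)
      (fun s _ => ?_) ?_
    · have h1 : HasDerivAt (fun s : ℝ => p.1 * s) p.1 s := by
        simpa using (hasDerivAt_id s).const_mul p.1
      exact (h.deriv p.2 (p.1 * s)).scomp s h1
    · exact (Continuous.smul continuous_const (V.continuous.comp
        ((h.continuous_time p.2).comp (by fun_prop)))).intervalIntegrable _ _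
  have h2 : ∫ s in (0 : ℝ)..t, (V.comp (h.traj p)) (projIcc 0 1 zero_le_one s)
      = ∫ s in (0 : ℝ)..t, V (Φ (p.1 * s) p.2) := by
    refine intervalIntegral.integral_congr fun s hs => ?_
    rw [uIcc_of_le t.2.1] at hs
    have : s ∈ Icc (0 : ℝ) 1 := ⟨hs.1, hs.2.trans t.2.2⟩
    simp [IsFlow.traj, projIcc_of_mem zero_le_one this]
  rw [intervalIntegral.integral_smul] at h1
  simp only [integralEq, ContinuousMap.sub_apply, ContinuousMap.smul_apply, primitive_apply, h2,
    h1, ContinuousMap.const_apply, mul_zero, h.zero, ContinuousMap.zero_apply]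
  simp [IsFlow.traj]

/-- At time scale `0` the nonlinear term of `integralEq` disappears, so its derivative in the curve
is the identity. The implicit function theorem in `C([0, 1], X)` makes the curve a smooth function
of time scale and initial point, and evaluation at `1` recovers the flow. -/
lemma IsFlow.contDiffAt_zero [CompleteSpace X] (h : IsFlow V Φ) (hV : ContDiff ℝ ∞ V) {B : ℝ}
    (hB : ∀ x, ‖V x‖ ≤ B) (x : X) :
    ContDiffAt ℝ ∞ (fun p : ℝ × X => Φ p.1 p.2) (0, x) := by
  set W : C(X, X) := ⟨V, hV.continuous⟩
  have hW : IsFlow W Φ := h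
  set u : (ℝ × X) × C(I, X) := ((0, x), ContinuousMap.const I x)
  have hf : ContDiffAt ℝ ∞ (integralEq W) u := (contDiff_integralEq W hV).contDiffAt
  have h0 : integralEq W u = 0 := by simp [integralEq, u]
  have hinv : (fderiv ℝ (integralEq W) u ∘L .inr ℝ (ℝ × X) C(I, X)).IsInvertible := by
    have e : fderiv ℝ (integralEq W) u ∘L .inr ℝ (ℝ × X) C(I, X) = ContinuousLinearMap.id ℝ _ := by
      have h1 : HasFDerivAt (fun y : C(I, X) => integralEq W ((0, x), y))
          (fderiv ℝ (integralEq W) u ∘L .inr ℝ (ℝ × X) C(I, X)) (ContinuousMap.const I x) :=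
        HasFDerivAt.comp (ContinuousMap.const I x)
          (hf.differentiableAt (by simp)).hasFDerivAt (hasFDerivAt_prodMk_right (0, x) _)
      have h2 : HasFDerivAt (fun y : C(I, X) => integralEq W ((0, x), y))
          (ContinuousLinearMap.id ℝ _) (ContinuousMap.const I x) := by
        have : (fun y : C(I, X) => integralEq W ((0, x), y)) =
            fun y => y - ContinuousMap.const I x := by
          funext y; simp [integralEq]
        rw [this]
        exact (hasFDerivAt_id _).sub_const _
      exact h1.unique h2
    rw [e]
    exact ContinuousLinearMap.isInvertible_equiv (f := ContinuousLinearEquiv.refl ℝ _)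
  have hev := hf.eventually_apply_eq_iff_implicitFunction (by simp) hinv
  have htend : Filter.Tendsto (fun p => (p, hW.traj p)) (𝓝 ((0 : ℝ), x)) (𝓝 u) :=
    Filter.Tendsto.prodMk_nhds Filter.tendsto_id (hW.tendsto_traj hB x)
  have hψ := hf.contDiffAt_implicitFunction (by simp) hinv
  have heval : ContDiff ℝ ∞ fun y : C(I, X) => y 1 :=
    (ContinuousMap.evalCLM ℝ (1 : I) : C(I, X) →L[ℝ] X).contDiff
  have hev1 : ContDiffAt ℝ ∞ (fun p => (hf.implicitFunction (by simp) hinv p) 1) ((0 : ℝ), x) :=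
    ContDiffAt.comp (g := fun y : C(I, X) => y 1) ((0 : ℝ), x)
      heval.contDiffAt hψ
  refine hev1.congr_of_eventuallyEq ?_
  filter_upwards [htend.eventually hev] with p hp
  rw [hW.integralEq_traj, h0] at hp
  have := hp.1 rfl
  rw [this]
  simp [IsFlow.traj]

/-- The flow of a smooth, bounded, Lipschitz vector field is smooth. -/
lemma IsFlow.contDiff [CompleteSpace X] (h : IsFlow V Φ) (hV : ContDiff ℝ ∞ V) {B : ℝ}
    (hB : ∀ x, ‖V x‖ ≤ B) {K : NNReal} (hK : LipschitzWith K V) :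
    ContDiff ℝ ∞ (fun p : ℝ × X => Φ p.1 p.2) := by
  -- Differentiability of finite order `n` at a point is an open condition, as the clopen argument
  -- on `S` requires; order `∞` would not give this.
  refine contDiff_infty.2 fun n => contDiff_iff_contDiffAt.2 fun ⟨t₁, x⟩ => ?_
  set S : Set ℝ := {t | ContDiffAt ℝ n (fun p : ℝ × X => Φ p.1 p.2) (t, x)}
  have hloc : ∀ y, ContDiffAt ℝ n (fun p : ℝ × X => Φ p.1 p.2) (0, y) := fun y =>
    (h.contDiffAt_zero hV hB y).of_le (by exact_mod_cast le_top)
  have hopen : IsOpen S := by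
    rw [isOpen_iff_mem_nhds]
    intro t ht
    have ht' : ContDiffAt ℝ n (fun p : ℝ × X => Φ p.1 p.2) (t, x) := ht
    have h1 := ht'.eventually (by simp)
    have h2 : Filter.Tendsto (fun s : ℝ => (s, x)) (𝓝 t) (𝓝 (t, x)) :=
      Continuous.tendsto (by fun_prop) t
    exact h2.eventually h1
  have hclosed : IsClosed S := by
    rw [← closure_subset_iff_isClosed]
    intro t ht
    have h1 := ContDiffAt.eventually (hloc (Φ t x)) (by simp)
    have h2 : Filter.Tendsto (fun s : ℝ => (t - s, Φ s x)) (𝓝 t) (𝓝 (0, Φ t x)) := by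
      have : Continuous fun s : ℝ => (t - s, Φ s x) :=
        (continuous_const.sub continuous_id).prodMk (h.continuous_time x)
      simpa using this.tendsto t
    obtain ⟨s, hs, hsS⟩ := mem_closure_iff_nhds.1 ht _ (h2.eventually h1)
    have hsS' : ContDiffAt ℝ n (fun p : ℝ × X => Φ p.1 p.2) (s, x) := hsS
    -- Group law: the flow to a time near `t` is the flow to `s ∈ S` followed by a short flow, to
    -- which the smoothness near time `0` applies.
    have e : (fun p : ℝ × X => Φ p.1 p.2) =
        (fun p : ℝ × X => Φ p.1 p.2) ∘ fun p : ℝ × X => (p.1 - s, Φ s p.2) := by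
      funext p
      simp only [Function.comp]
      rw [← h.add hK, sub_add_cancel]
    change ContDiffAt ℝ n (fun p : ℝ × X => Φ p.1 p.2) (t, x)
    rw [e]
    refine ContDiffAt.comp (t, x) hs ?_
    refine (contDiffAt_fst.sub contDiffAt_const).prodMk ?_
    exact ContDiffAt.comp (t, x) (g := fun p : ℝ × X => Φ p.1 p.2) (f := fun p : ℝ × X => (s, p.2))
      hsS' (contDiffAt_const.prodMk contDiffAt_snd)
  have huniv : S = univ := IsClopen.eq_univ ⟨hclosed, hopen⟩ ⟨0, hloc x⟩
  have : t₁ ∈ S := huniv ▸ mem_univ t₁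
  exact this

/-- Speed at most `B` keeps the curve within distance `B * n` of `x` on `[-n, n]`, so
Picard–Lindelöf holds on the whole interval. -/
lemma exists_solution_Icc [CompleteSpace X] {B : ℝ} (hB : ∀ x, ‖V x‖ ≤ B)
    {K : NNReal} (hK : LipschitzWith K V) (x : X) (n : ℕ) :
    ∃ f : ℝ → X, f 0 = x ∧ ∀ t ∈ Ioo (-(n : ℝ)) n, HasDerivAt f (V (f t)) t := by
  have hB0 : 0 ≤ B := (norm_nonneg _).trans (hB x)
  lift B to NNReal using hB0
  have hn : (0 : ℝ) ∈ Icc (-(n : ℝ)) n := by simp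
  have hP : IsPicardLindelof (fun _ => V) (⟨0, hn⟩ : Icc (-(n : ℝ)) n) x (B * n) 0 B K :=
    IsPicardLindelof.of_time_independent (fun y _ => hB y) hK.lipschitzOnWith (by simp)
  obtain ⟨f, h0, hf⟩ := hP.exists_eq_forall_mem_Icc_hasDerivWithinAt₀
  exact ⟨f, h0, fun t ht =>
    (hf t (Ioo_subset_Icc_self ht)).hasDerivAt (Icc_mem_nhds ht.1 ht.2)⟩

/-- A bounded Lipschitz vector field has a global flow. -/
lemma exists_isFlow [CompleteSpace X] {B : ℝ} (hB : ∀ x, ‖V x‖ ≤ B)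
    {K : NNReal} (hK : LipschitzWith K V) : ∃ Φ, IsFlow V Φ := by
  choose f h0 hf using exists_solution_Icc hB hK
  have hcompat : ∀ x (m n : ℕ), m ≤ n → EqOn (f x m) (f x n) (Ioo (-(m : ℝ)) m) := by
    intro x m n hmn
    have hmn' : (m : ℝ) ≤ n := by exact_mod_cast hmn
    rcases Nat.eq_zero_or_pos m with rfl | hm
    · intro t ht
      simp at ht
    have hm' : (0 : ℝ) < m := by exact_mod_cast hm
    refine ODE_solution_unique_of_mem_Ioo (v := fun _ => V) (s := fun _ => univ) (K := K) (t₀ := 0)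
      (fun _ _ => hK.lipschitzOnWith) (by constructor <;> linarith)
      (fun t ht => ⟨hf x m t ht, trivial⟩)
      (fun t ht => ⟨hf x n t ⟨by linarith [ht.1], by linarith [ht.2]⟩, trivial⟩) (by rw [h0, h0])
  -- The value at `t` is read off a solution whose open interval contains `t`. Index `⌈|t|⌉₊ + 2`
  -- below serves a whole neighbourhood of `t`, where `⌈|s|⌉₊` may exceed `⌈|t|⌉₊` by one.
  refine ⟨fun t x => f x (⌈|t|⌉₊ + 1) t, fun x => h0 x _, fun x t => ?_⟩
  set n := ⌈|t|⌉₊ + 2 with hn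
  have htn : |t| + 1 < n := by
    have := Nat.le_ceil |t|
    rw [hn]; push_cast; linarith
  have hev : ∀ s, |s| < |t| + 1 → f x (⌈|s|⌉₊ + 1) s = f x n s := by
    intro s hs
    refine hcompat x _ n ?_ ?_
    · have : ⌈|s|⌉₊ ≤ ⌈|t|⌉₊ + 1 := by
        rw [Nat.ceil_le]
        push_cast
        have := Nat.le_ceil |t|
        linarith
      omega
    · have := Nat.le_ceil |s|
      push_cast
      constructor
      · linarith [neg_abs_le s]
      · linarith [le_abs_self s]
  have h1 : HasDerivAt (f x n) (V (f x n t)) t :=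
    hf x n t ⟨by linarith [neg_abs_le t], by linarith [le_abs_self t]⟩
  have h2 := hev t (by linarith)
  rw [h2]
  refine h1.congr_of_eventuallyEq ?_
  have : ∀ᶠ s in 𝓝 t, |s| < |t| + 1 :=
    continuous_abs.continuousAt.eventually_lt continuousAt_const (by linarith)
  filter_upwards [this] with s hs using hev s hs

end Flow

/-! ### Decay of the derivatives in `x` -/

section XDerivative

variable {G H : Type*} [NormedAddCommGroup G] [NormedSpace ℝ G] [NormedAddCommGroup H]
  [NormedSpace ℝ H]

/-- The derivative with respect to the first variable. -/
noncomputable def dx (h : ℝ × ℝ → G) : ℝ × ℝ → G := fun p => fderiv ℝ h p (1, 0)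

/-- The derivative with respect to the second variable. -/
noncomputable def dt (h : ℝ × ℝ → G) : ℝ × ℝ → G := fun p => fderiv ℝ h p (0, 1)

lemma contDiff_dx {h : ℝ × ℝ → G} (hh : ContDiff ℝ ∞ h) : ContDiff ℝ ∞ (dx h) :=
  (hh.fderiv_right le_rfl).clm_apply contDiff_const

lemma hasDerivAt_dx {h : ℝ × ℝ → G} (hh : ContDiff ℝ ∞ h) (x τ : ℝ) :
    HasDerivAt (fun y => h (y, τ)) (dx h (x, τ)) x :=
  ((hh.differentiable (by simp) (x, τ)).hasFDerivAt).comp_hasDerivAt x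
    ((hasDerivAt_id x).prodMk (hasDerivAt_const x τ))

lemma hasDerivAt_dt {h : ℝ × ℝ → G} (hh : ContDiff ℝ ∞ h) (x τ : ℝ) :
    HasDerivAt (fun t => h (x, t)) (dt h (x, τ)) τ :=
  ((hh.differentiable (by simp) (x, τ)).hasFDerivAt).comp_hasDerivAt τ
    ((hasDerivAt_const τ x).prodMk (hasDerivAt_id τ))

lemma dx_eq_of_hasDerivAt {h : ℝ × ℝ → G} (hh : ContDiff ℝ ∞ h) {x τ : ℝ} {h' : G}
    (hd : HasDerivAt (fun y => h (y, τ)) h' x) : dx h (x, τ) = h' :=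
  (hasDerivAt_dx hh x τ).unique hd

/-- Symmetry of the second derivative; it turns the `x`-derivative of an evolution equation into an
evolution equation for `dx h`. -/
lemma dt_dx {h : ℝ × ℝ → G} (hh : ContDiff ℝ ∞ h) : dt (dx h) = dx (dt h) := by
  funext p
  have hd : DifferentiableAt ℝ (fderiv ℝ h) p :=
    (hh.fderiv_right (m := ∞) le_rfl).differentiable (by simp) p
  have key : ∀ u v : ℝ × ℝ, fderiv ℝ (fun q => fderiv ℝ h q u) p v
      = fderiv ℝ (fderiv ℝ h) p v u := fun u v => by
    rw [fderiv_clm_apply hd (by fun_prop)]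
    simp
  have hs : IsSymmSndFDerivAt ℝ h p := (hh.contDiffAt).isSymmSndFDerivAt (by
    rw [minSmoothness_of_isRCLikeNormedField]
    exact WithTop.coe_le_coe.2 (le_top (a := (2 : ℕ∞))))
  change fderiv ℝ (fun q => fderiv ℝ h q (1, 0)) p (0, 1)
    = fderiv ℝ (fun q => fderiv ℝ h q (0, 1)) p (1, 0)
  rw [key, key]
  exact hs _ _

lemma contDiff_iterate_dx {h : ℝ × ℝ → G} (hh : ContDiff ℝ ∞ h) (j : ℕ) :
    ContDiff ℝ ∞ (dx^[j] h) := by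
  induction j with
  | zero => exact hh
  | succ j ih => rw [Function.iterate_succ_apply']; exact contDiff_dx ih

lemma dx_periodic {h : ℝ × ℝ → G} (hh : ContDiff ℝ ∞ h) {L : ℝ}
    (hp : ∀ x τ, h (x + L, τ) = h (x, τ)) (x τ : ℝ) : dx h (x + L, τ) = dx h (x, τ) := by
  have h1 := (hasDerivAt_dx hh (x + L) τ).comp_add_const x L
  simp only [hp] at h1
  exact h1.unique (hasDerivAt_dx hh x τ)

/-- All derivatives in `x` up to order `k` are `O(exp (-γ τ))`, uniformly in `x`. -/
def Decays (γ : ℝ) (k : ℕ) (h : ℝ × ℝ → G) : Prop :=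
  ∀ j ≤ k, ∃ C, ∀ x, ∀ τ ≥ 0, ‖(dx^[j] h) (x, τ)‖ ≤ C * Real.exp (-γ * τ)

lemma decays_zero {γ : ℝ} {h : ℝ × ℝ → G} :
    Decays γ 0 h ↔ ∃ C, ∀ x, ∀ τ ≥ 0, ‖h (x, τ)‖ ≤ C * Real.exp (-γ * τ) := by
  simp [Decays]

lemma decays_succ {γ : ℝ} {k : ℕ} {h : ℝ × ℝ → G} :
    Decays γ (k + 1) h ↔ Decays γ 0 h ∧ Decays γ k (dx h) := by
  constructor
  · intro H
    refine ⟨fun j hj => H j (by omega), fun j hj => ?_⟩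
    have := H (j + 1) (by omega)
    rwa [Function.iterate_succ_apply] at this
  · rintro ⟨h0, h1⟩ j hj
    rcases j with _ | j
    · exact h0 0 le_rfl
    · rw [Function.iterate_succ_apply]
      exact h1 j (by omega)

lemma Decays.of_le {γ : ℝ} {k l : ℕ} {h : ℝ × ℝ → G} (H : Decays γ k h) (hl : l ≤ k) :
    Decays γ l h := fun j hj => H j (hj.trans hl)

lemma Decays.bounded {γ : ℝ} (hγ : 0 ≤ γ) {k : ℕ} {h : ℝ × ℝ → G} (H : Decays γ k h) :
    Decays 0 k h := fun j hj => by
  obtain ⟨C, hC⟩ := H j hj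
  refine ⟨|C|, fun x τ hτ => (hC x τ hτ).trans ?_⟩
  have : Real.exp (-γ * τ) ≤ 1 := Real.exp_le_one_iff.2 (by nlinarith)
  calc C * Real.exp (-γ * τ) ≤ |C| * 1 := by
        gcongr
        exact le_abs_self C
    _ = |C| * Real.exp (-0 * τ) := by simp

lemma decays_zero_fun (γ : ℝ) : Decays γ 0 (0 : ℝ × ℝ → G) :=
  decays_zero.2 ⟨0, by simp⟩

lemma dx_add {h g : ℝ × ℝ → G} (hh : ContDiff ℝ ∞ h) (hg : ContDiff ℝ ∞ g) :
    dx (fun p => h p + g p) = fun p => dx h p + dx g p := by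
  funext ⟨x, τ⟩
  exact dx_eq_of_hasDerivAt (hh.add hg) ((hasDerivAt_dx hh x τ).add (hasDerivAt_dx hg x τ))

lemma dx_clm_apply {B : ℝ × ℝ → G →L[ℝ] H} {v : ℝ × ℝ → G} (hB : ContDiff ℝ ∞ B)
    (hv : ContDiff ℝ ∞ v) :
    dx (fun p => B p (v p)) = fun p => dx B p (v p) + B p (dx v p) := by
  funext ⟨x, τ⟩
  exact dx_eq_of_hasDerivAt (hB.clm_apply hv)
    ((hasDerivAt_dx hB x τ).clm_apply (hasDerivAt_dx hv x τ))

lemma Decays.add {γ : ℝ} {k : ℕ} {h g : ℝ × ℝ → G} (hh : ContDiff ℝ ∞ h) (hg : ContDiff ℝ ∞ g)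
    (Hh : Decays γ k h) (Hg : Decays γ k g) : Decays γ k (fun p => h p + g p) := by
  induction k generalizing h g with
  | zero =>
    obtain ⟨C, hC⟩ := decays_zero.1 Hh
    obtain ⟨D, hD⟩ := decays_zero.1 Hg
    refine decays_zero.2 ⟨C + D, fun x τ hτ => (norm_add_le _ _).trans ?_⟩
    rw [add_mul]
    exact add_le_add (hC x τ hτ) (hD x τ hτ)
  | succ k ih =>
    rw [decays_succ, dx_add hh hg]
    refine ⟨?_, ih (contDiff_dx hh) (contDiff_dx hg) (decays_succ.1 Hh).2 (decays_succ.1 Hg).2⟩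
    exact (ih hh hg (Hh.of_le (by omega)) (Hg.of_le (by omega))).of_le (by omega)

/-- Leibniz rule: exponent `0` expresses boundedness, and a bounded operator applied to a decaying
vector keeps the rate. -/
lemma Decays.clm_apply {γ : ℝ} {k : ℕ} {B : ℝ × ℝ → G →L[ℝ] H} {v : ℝ × ℝ → G}
    (hB : ContDiff ℝ ∞ B) (hv : ContDiff ℝ ∞ v) (HB : Decays 0 k B) (Hv : Decays γ k v) :
    Decays γ k (fun p => B p (v p)) := by
  induction k generalizing B v with
  | zero =>
    obtain ⟨C, hC⟩ := decays_zero.1 HB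
    obtain ⟨D, hD⟩ := decays_zero.1 Hv
    refine decays_zero.2 ⟨C * D, fun x τ hτ => ((B (x, τ)).le_opNorm _).trans ?_⟩
    have h1 := hC x τ hτ
    simp only [neg_zero, zero_mul, Real.exp_zero, mul_one] at h1
    rw [mul_assoc]
    exact mul_le_mul h1 (hD x τ hτ) (norm_nonneg _) ((norm_nonneg _).trans h1)
  | succ k ih =>
    rw [decays_succ, dx_clm_apply hB hv]
    have HB' := decays_succ.1 HB
    have Hv' := decays_succ.1 Hv
    refine ⟨(ih hB hv (HB.of_le (by omega)) (Hv.of_le (by omega))).of_le (by omega), ?_⟩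
    exact Decays.add ((contDiff_dx hB).clm_apply hv) (hB.clm_apply (contDiff_dx hv))
      (ih (contDiff_dx hB) hv HB'.2 (Hv.of_le (by omega)))
      (ih hB (contDiff_dx hv) (HB.of_le (by omega)) Hv'.2)

end XDerivative

/-! ### Uniform bounds from periodicity -/

section PeriodicBounds

variable {E G : Type*} [NormedAddCommGroup E] [NormedSpace ℝ E] [NormedAddCommGroup G]
  [NormedSpace ℝ G]

omit [NormedSpace ℝ G] in
-- One period times a closed ball is compact; the same compact set yields the uniform continuity in
-- `exists_radius_of_periodic`.
lemma exists_bound_of_periodic [FiniteDimensional ℝ E] {f : ℝ × E → G} (hf : Continuous f) {L : ℝ}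
    (hL : 0 < L) (hp : ∀ x y, f (x + L, y) = f (x, y)) (R : ℝ) :
    ∃ C, ∀ x y, ‖y‖ ≤ R → ‖f (x, y)‖ ≤ C := by
  have : ProperSpace E := FiniteDimensional.proper_real E
  obtain ⟨C, hC⟩ := ((isCompact_Icc (a := (0 : ℝ)) (b := L)).prod
    (isCompact_closedBall (0 : E) R)).exists_bound_of_continuousOn hf.continuousOn
  refine ⟨C, fun x y hy => ?_⟩
  obtain ⟨x', hx', he⟩ := Function.Periodic.exists_mem_Ico₀
    (f := fun x => f (x, y)) (fun x => hp x y) hL x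
  rw [he]
  exact hC (x', y) ⟨⟨hx'.1, hx'.2.le⟩, by simpa using hy⟩

lemma fderiv_periodic {f : ℝ × E → G} {L : ℝ} (hp : ∀ x y, f (x + L, y) = f (x, y)) (x : ℝ)
    (y : E) : fderiv ℝ f (x + L, y) = fderiv ℝ f (x, y) := by
  have h1 := fderiv_comp_add_right (𝕜 := ℝ) (f := f) (x := (x, y)) ((L, 0) : ℝ × E)
  have h2 : (fun q : ℝ × E => f (q + (L, 0))) = f := by
    funext ⟨a, b⟩
    simpa using hp a b
  rw [h2] at h1
  simpa using h1.symm

omit [NormedSpace ℝ G] in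
lemma exists_radius_of_periodic [FiniteDimensional ℝ E] {f : ℝ × E → G} (hf : Continuous f) {L : ℝ}
    (hL : 0 < L) (hp : ∀ x y, f (x + L, y) = f (x, y)) {ε : ℝ} (hε : 0 < ε) :
    ∃ ρ > 0, ∀ x y, ‖y‖ ≤ ρ → ‖f (x, y) - f (x, 0)‖ ≤ ε := by
  have : ProperSpace E := FiniteDimensional.proper_real E
  have huc := ((isCompact_Icc (a := (0 : ℝ)) (b := L)).prod
    (isCompact_closedBall (0 : E) 1)).uniformContinuousOn_of_continuous hf.continuousOn
  obtain ⟨δ, hδ, h⟩ := Metric.uniformContinuousOn_iff.1 huc ε hε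
  refine ⟨min 1 (δ / 2), by positivity, fun x y hy => ?_⟩
  have hpy : ∀ x y, f (x + L, y) - f (x + L, 0) = f (x, y) - f (x, 0) := fun x y => by rw [hp, hp]
  obtain ⟨x', hx', he⟩ := Function.Periodic.exists_mem_Ico₀
    (f := fun x => f (x, y) - f (x, 0)) (fun x => hpy x y) hL x
  rw [he, ← dist_eq_norm]
  refine (h (x', y) ⟨⟨hx'.1, hx'.2.le⟩, ?_⟩ (x', 0) ⟨⟨hx'.1, hx'.2.le⟩, by simp⟩ ?_).le
  · simpa using hy.trans (min_le_left _ _)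
  · rw [Prod.dist_eq]
    simp only [dist_self, dist_zero_right]
    exact max_lt hδ ((hy.trans (min_le_right _ _)).trans_lt (by linarith))

/-- The derivative in the second variable. -/
noncomputable def dy (f : ℝ × E → G) (p : ℝ × E) : E →L[ℝ] G :=
  fderiv ℝ f p ∘L ContinuousLinearMap.inr ℝ ℝ E

lemma contDiff_dy {f : ℝ × E → G} (hf : ContDiff ℝ ∞ f) : ContDiff ℝ ∞ (dy f) :=
  (hf.fderiv_right le_rfl).clm_comp contDiff_const

lemma dx_comp {f : ℝ × E → G} (hf : ContDiff ℝ ∞ f) {v : ℝ × ℝ → E} (hv : ContDiff ℝ ∞ v) :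
    dx (fun p => f (p.1, v p)) =
      fun p => fderiv ℝ f (p.1, v p) (1, 0) + dy f (p.1, v p) (dx v p) := by
  funext ⟨x, τ⟩
  have h1 : HasDerivAt (fun y => (y, v (y, τ))) ((1 : ℝ), dx v (x, τ)) x :=
    (hasDerivAt_id x).prodMk (hasDerivAt_dx hv x τ)
  have h2 : HasDerivAt (fun y => f (y, v (y, τ))) (fderiv ℝ f (x, v (x, τ)) (1, dx v (x, τ))) x :=
    ((hf.differentiable (by simp) (x, v (x, τ))).hasFDerivAt).comp_hasDerivAt x h1
  rw [dx_eq_of_hasDerivAt (h := fun p => f (p.1, v p)) (hf.comp (contDiff_fst.prodMk hv)) h2]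
  have : ((1 : ℝ), dx v (x, τ)) = (1, 0) + (0, dx v (x, τ)) := by simp
  rw [this, map_add]
  rfl

/-- By the chain rule `dx` of the composite involves `∂_x f` and `D_y f` along `v`, again smooth and
periodic; the induction therefore runs over all targets `G`. -/
lemma decays_comp {E G : Type u} [NormedAddCommGroup E] [NormedSpace ℝ E] [NormedAddCommGroup G]
    [NormedSpace ℝ G] [FiniteDimensional ℝ E] {f : ℝ × E → G} (hf : ContDiff ℝ ∞ f) {L : ℝ}
    (hL : 0 < L) (hp : ∀ x y, f (x + L, y) = f (x, y)) {v : ℝ × ℝ → E} (hv : ContDiff ℝ ∞ v)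
    {k : ℕ} (H : Decays 0 k v) : Decays 0 k (fun p => f (p.1, v p)) := by
  induction k generalizing G with
  | zero =>
    obtain ⟨R, hR⟩ := decays_zero.1 H
    obtain ⟨C, hC⟩ := exists_bound_of_periodic hf.continuous hL hp R
    refine decays_zero.2 ⟨C, fun x τ hτ => ?_⟩
    simpa using hC x (v (x, τ)) (by simpa using hR x τ hτ)
  | succ k ih =>
    rw [decays_succ, dx_comp hf hv]
    have hf' : ContDiff ℝ ∞ fun q => fderiv ℝ f q (1, 0) :=
      (hf.fderiv_right le_rfl).clm_apply contDiff_const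
    have hpv : ContDiff ℝ ∞ fun p : ℝ × ℝ => (p.1, v p) := contDiff_fst.prodMk hv
    have H' := decays_succ.1 H
    refine ⟨(ih hf hp (H.of_le (by omega))).of_le (by omega), ?_⟩
    refine Decays.add (hf'.comp hpv)
      (((contDiff_dy hf).comp hpv).clm_apply (contDiff_dx hv)) ?_ ?_
    · exact ih hf' (fun x y => by rw [fderiv_periodic hp]) (H.of_le (by omega))
    · exact Decays.clm_apply ((contDiff_dy hf).comp hpv) (contDiff_dx hv)
        (ih (contDiff_dy hf) (fun x y => by simp only [dy, fderiv_periodic hp])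
          (H.of_le (by omega))) H'.2

end PeriodicBounds

/-! ### Energy estimates for dissipative equations -/

lemma le_mul_exp_of_deriv_le {S S' : ℝ → ℝ} {a c D K : ℝ} (hS : ∀ τ, HasDerivAt S (S' τ) τ)
    (hle : ∀ τ ≥ 0, S' τ ≤ -c * S τ + D * Real.exp (-a * τ)) (h0 : S 0 ≤ K)
    (hD : D ≤ K * (c - a)) {τ : ℝ} (hτ : 0 ≤ τ) : S τ ≤ K * Real.exp (-a * τ) := by
  -- `K e^{-aτ}` is a supersolution because `D ≤ K (c - a)`; the difference, times the integrating
  -- factor `e^{cτ}`, is nonincreasing.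
  set H : ℝ → ℝ := fun τ => (S τ - K * Real.exp (-a * τ)) * Real.exp (c * τ)
  have hH : ∀ τ, HasDerivAt H ((S' τ + K * a * Real.exp (-a * τ)) * Real.exp (c * τ)
      + (S τ - K * Real.exp (-a * τ)) * (c * Real.exp (c * τ))) τ := by
    intro τ
    have e1 : HasDerivAt (fun τ => Real.exp (-a * τ)) (-a * Real.exp (-a * τ)) τ := by
      simpa [mul_comm] using ((hasDerivAt_id τ).const_mul (-a)).exp
    have e2 : HasDerivAt (fun τ => Real.exp (c * τ)) (c * Real.exp (c * τ)) τ := by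
      simpa [mul_comm] using ((hasDerivAt_id τ).const_mul c).exp
    refine (((hS τ).fun_sub (e1.const_mul K)).mul e2).congr_deriv ?_
    ring
  have hanti : AntitoneOn H (Ici 0) := by
    refine antitoneOn_of_deriv_nonpos (convex_Ici 0)
      (fun τ _ => (hH τ).continuousAt.continuousWithinAt)
      (fun τ _ => (hH τ).differentiableAt.differentiableWithinAt) fun τ hτ => ?_
    rw [interior_Ici] at hτ
    rw [(hH τ).deriv]
    have h1 := hle τ hτ.le
    have h2 : D * Real.exp (-a * τ) ≤ K * (c - a) * Real.exp (-a * τ) := by gcongr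
    have h3 : (S' τ + K * a * Real.exp (-a * τ)) + (S τ - K * Real.exp (-a * τ)) * c ≤ 0 := by
      linarith
    have h4 := mul_nonpos_of_nonpos_of_nonneg h3 (Real.exp_pos (c * τ)).le
    linarith
  have h1 : H τ ≤ H 0 := hanti self_mem_Ici hτ hτ
  have h2 : H 0 ≤ 0 := by simp [H, h0]
  have h3 : S τ - K * Real.exp (-a * τ) ≤ 0 := by
    by_contra hcon
    push Not at hcon
    have := mul_pos hcon (Real.exp_pos (c * τ))
    linarith
  linarith

section DotProduct

variable {n : ℕ}

/-- The norm on `Fin n → ℝ` is the sup norm, which is not differentiable; energies use `v ⬝ᵥ v`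
instead, and the comparison in the other direction costs a factor `n`. -/
lemma norm_sq_le_dotProduct (v : Fin n → ℝ) : ‖v‖ ^ 2 ≤ v ⬝ᵥ v := by
  have h0 : 0 ≤ v ⬝ᵥ v := Finset.sum_nonneg fun i _ => mul_self_nonneg _
  have : ‖v‖ ≤ Real.sqrt (v ⬝ᵥ v) := by
    refine (pi_norm_le_iff_of_nonneg (Real.sqrt_nonneg _)).2 fun i => ?_
    refine Real.le_sqrt_of_sq_le ?_
    rw [Real.norm_eq_abs, sq_abs, sq]
    exact Finset.single_le_sum (f := fun i => v i * v i) (fun i _ => mul_self_nonneg _)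
      (Finset.mem_univ i)
  calc ‖v‖ ^ 2 ≤ Real.sqrt (v ⬝ᵥ v) ^ 2 := by gcongr
    _ = v ⬝ᵥ v := Real.sq_sqrt h0

lemma dotProduct_le_norm_mul_norm (v w : Fin n → ℝ) : v ⬝ᵥ w ≤ n * (‖v‖ * ‖w‖) := by
  have : v ⬝ᵥ w ≤ ∑ _i : Fin n, ‖v‖ * ‖w‖ := by
    refine Finset.sum_le_sum fun i _ => (le_abs_self _).trans ?_
    rw [abs_mul]
    exact mul_le_mul (norm_le_pi_norm v i) (norm_le_pi_norm w i) (abs_nonneg _) (norm_nonneg _)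
  simpa using this

lemma hasDerivAt_dotProduct_self {v : ℝ → Fin n → ℝ} {v' : Fin n → ℝ} {t : ℝ}
    (h : HasDerivAt v v' t) : HasDerivAt (fun t => v t ⬝ᵥ v t) (2 * (v t ⬝ᵥ v')) t := by
  have h1 := HasDerivAt.fun_sum (u := Finset.univ) (A := fun i t => v t i * v t i)
    (fun i _ => (hasDerivAt_pi.1 h i).mul (hasDerivAt_pi.1 h i))
  convert! h1 using 1
  simp only [dotProduct, Finset.mul_sum]
  refine Finset.sum_congr rfl fun i _ => ?_
  ring

lemma two_mul_dotProduct_le {η : ℝ} (hη : 0 < η) (v w : Fin n → ℝ) :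
    2 * (v ⬝ᵥ w) ≤ η * (v ⬝ᵥ v) + (w ⬝ᵥ w) / η := by
  simp only [dotProduct, Finset.mul_sum, Finset.sum_div, ← Finset.sum_add_distrib]
  refine Finset.sum_le_sum fun i _ => ?_
  have h : 0 ≤ (η * v i - w i) ^ 2 / η := by positivity
  have e : (η * v i - w i) ^ 2 / η = η * (v i * v i) + w i * w i / η - 2 * (v i * w i) := by
    field_simp
    ring
  linarith

/-- Half of the damping absorbs the perturbation `f (x, y) - f (x, 0)`. A bound `ε` on its norm
costs `n * ε` in the dot product, whence the tolerance `lam / (2 * (n + 1))`. -/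
lemma exists_radius_dissipative {f : ℝ × (Fin n → ℝ) → (Fin n → ℝ) →L[ℝ] (Fin n → ℝ)}
    (hf : Continuous f) {L : ℝ} (hL : 0 < L) (hp : ∀ x y, f (x + L, y) = f (x, y)) {lam : ℝ}
    (hlam : 0 < lam) (hdiss : ∀ x v, v ⬝ᵥ f (x, 0) v ≤ -lam * (v ⬝ᵥ v)) :
    ∃ ρ > 0, ∀ x y, ‖y‖ ≤ ρ → ∀ v, v ⬝ᵥ f (x, y) v ≤ -(lam / 2) * (v ⬝ᵥ v) := by
  obtain ⟨ρ, hρ, h⟩ := exists_radius_of_periodic hf hL hp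
    (ε := lam / (2 * (n + 1))) (by positivity)
  refine ⟨ρ, hρ, fun x y hy v => ?_⟩
  have e : v ⬝ᵥ f (x, y) v = v ⬝ᵥ f (x, 0) v + v ⬝ᵥ (f (x, y) - f (x, 0)) v := by
    rw [← dotProduct_add]; simp
  have h1 := dotProduct_le_norm_mul_norm v ((f (x, y) - f (x, 0)) v)
  have h2 : ‖(f (x, y) - f (x, 0)) v‖ ≤ lam / (2 * (n + 1)) * ‖v‖ :=
    ((f (x, y) - f (x, 0)).le_opNorm v).trans (by gcongr; exact h x y hy)
  have h3 : n * (‖v‖ * ‖(f (x, y) - f (x, 0)) v‖) ≤ lam / 2 * ‖v‖ ^ 2 := by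
    calc (n : ℝ) * (‖v‖ * ‖(f (x, y) - f (x, 0)) v‖)
        ≤ n * (‖v‖ * (lam / (2 * (n + 1)) * ‖v‖)) := by gcongr
      _ = (n / (n + 1)) * (lam / 2 * ‖v‖ ^ 2) := by field_simp
      _ ≤ 1 * (lam / 2 * ‖v‖ ^ 2) := by
        gcongr
        rw [div_le_one (by positivity)]
        linarith
      _ = _ := one_mul _
  have h4 : lam / 2 * ‖v‖ ^ 2 ≤ lam / 2 * (v ⬝ᵥ v) := by
    gcongr
    exact norm_sq_le_dotProduct v
  have h5 := hdiss x v
  linarith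

end DotProduct

section Linear

variable {n : ℕ}

/-- Solutions of a dissipative linear equation with exponentially decaying forcing decay. -/
lemma decays_of_linear {L : ℝ} (hL : 0 < L) {γ lam : ℝ} (hγl : γ < lam) (k : ℕ)
    {v g : ℝ × ℝ → Fin n → ℝ} {B : ℝ × ℝ → (Fin n → ℝ) →L[ℝ] (Fin n → ℝ)}
    (hv : ContDiff ℝ ∞ v) (hg : ContDiff ℝ ∞ g) (hB : ContDiff ℝ ∞ B)
    (hp : ∀ x τ, v (x + L, τ) = v (x, τ)) (heq : ∀ p, dt v p = B p (v p) + g p)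
    (hdiss : ∀ x, ∀ τ ≥ 0, ∀ z, z ⬝ᵥ B (x, τ) z ≤ -lam * (z ⬝ᵥ z))
    (HB : Decays 0 k B) (Hg : Decays γ k g) : Decays γ k v := by
  induction k generalizing v g with
  | zero =>
    obtain ⟨C, hC⟩ := decays_zero.1 Hg
    obtain ⟨C₀, hC₀⟩ := exists_bound_of_periodic hv.continuous hL hp 0
    -- Young's inequality with weight `η` leaves the damping `2 lam - η = lam + γ`, which still
    -- exceeds the rate `2 γ` of the squared forcing by `η`: no exponent is lost.
    set η := lam - γ with hη
    have hη0 : 0 < η := by linarith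
    -- The first entry bounds the initial energy, since `C₀` bounds `v` at `τ = 0` (radius `0` in
    -- the second variable); the second makes the comparison function a supersolution.
    set K := max (n * C₀ ^ 2) (n * C ^ 2 / η ^ 2) with hK
    have hbound : ∀ x, ∀ τ ≥ 0, v (x, τ) ⬝ᵥ v (x, τ) ≤ K * Real.exp (-(2 * γ) * τ) := by
      intro x τ hτ
      refine le_mul_exp_of_deriv_le (S := fun τ => v (x, τ) ⬝ᵥ v (x, τ)) (c := lam + γ)
        (D := n * C ^ 2 / η) (fun τ => hasDerivAt_dotProduct_self (hasDerivAt_dt hv x τ))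
        (fun τ hτ => ?_) ?_ ?_ hτ
      · rw [heq, dotProduct_add]
        have h1 := hdiss x τ hτ (v (x, τ))
        have h2 := two_mul_dotProduct_le hη0 (v (x, τ)) (g (x, τ))
        have h3 : g (x, τ) ⬝ᵥ g (x, τ) ≤ n * C ^ 2 * Real.exp (-(2 * γ) * τ) := by
          refine (dotProduct_le_norm_mul_norm _ _).trans ?_
          rw [mul_assoc]
          refine mul_le_mul_of_nonneg_left ?_ (Nat.cast_nonneg n)
          have h4 := hC x τ hτ
          calc ‖g (x, τ)‖ * ‖g (x, τ)‖
              ≤ (C * Real.exp (-γ * τ)) * (C * Real.exp (-γ * τ)) :=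
                mul_self_le_mul_self (norm_nonneg _) h4
            _ = C ^ 2 * (Real.exp (-γ * τ) * Real.exp (-γ * τ)) := by ring
            _ = C ^ 2 * Real.exp (-(2 * γ) * τ) := by rw [← Real.exp_add]; ring_nf
        have h5 : g (x, τ) ⬝ᵥ g (x, τ) / η ≤ n * C ^ 2 / η * Real.exp (-(2 * γ) * τ) := by
          rw [div_mul_eq_mul_div]
          gcongr
        have h6 : (2 * lam - η) * (v (x, τ) ⬝ᵥ v (x, τ)) = (lam + γ) * (v (x, τ) ⬝ᵥ v (x, τ)) := by
          rw [hη]; ring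
        linarith
      · refine le_trans ?_ (le_max_left _ _)
        refine (dotProduct_le_norm_mul_norm _ _).trans ?_
        gcongr
        rw [sq]
        have := hC₀ x 0 (by simp)
        exact mul_self_le_mul_self (norm_nonneg _) this
      · have h1 : n * C ^ 2 / η ^ 2 ≤ K := le_max_right _ _
        have h2 : lam + γ - 2 * γ = η := by rw [hη]; ring
        rw [h2]
        calc n * C ^ 2 / η = n * C ^ 2 / η ^ 2 * η := by field_simp
          _ ≤ K * η := by gcongr
    have hK0 : 0 ≤ K := le_max_of_le_left (by positivity)
    refine decays_zero.2 ⟨Real.sqrt K, fun x τ hτ => ?_⟩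
    refine abs_le_of_sq_le_sq' ?_ (by positivity) |>.2
    rw [mul_pow, Real.sq_sqrt hK0, ← Real.exp_nat_mul]
    refine (norm_sq_le_dotProduct _).trans ((hbound x τ hτ).trans (le_of_eq ?_))
    congr 2
    push_cast
    ring
  | succ k ih =>
    -- The bound on `v` comes first: it makes `dx B v` an admissible forcing for `dx v`, which
    -- solves the equation with the same `B`.
    have Hv := ih hv hg hp heq (HB.of_le (by omega)) (Hg.of_le (by omega))
    refine decays_succ.2 ⟨Hv.of_le (by omega), ?_⟩
    have HB' := decays_succ.1 HB
    have Hg' := decays_succ.1 Hg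
    have hdxB := (contDiff_dx hB).clm_apply hv
    refine ih (contDiff_dx hv) (hdxB.add (contDiff_dx hg)) (dx_periodic hv hp) (fun p => ?_)
      (HB.of_le (by omega)) ?_
    · have e : dt v = fun p => B p (v p) + g p := funext heq
      rw [dt_dx hv, e, dx_add (hB.clm_apply hv) hg, dx_clm_apply hB hv]
      simp only
      abel
    · exact Decays.add hdxB (contDiff_dx hg)
        (Decays.clm_apply (contDiff_dx hB) hv HB'.2 Hv) Hg'.2

end Linear

/-! ### Small solutions of a parametrised dissipative equation -/

section Family

variable {n : ℕ}

/-- With `x` as a coordinate of zero velocity, smoothness in the parameter becomes smoothness in the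
initial point. Periodicity in `x` and vanishing for large `y` make the field bounded and Lipschitz.
-/
lemma exists_smooth_family {E : Type u} [NormedAddCommGroup E] [NormedSpace ℝ E]
    [FiniteDimensional ℝ E] {F : ℝ × E → E} (hF : ContDiff ℝ ∞ F) {L : ℝ} (hL : 0 < L)
    (hp : ∀ x y, F (x + L, y) = F (x, y)) {r : ℝ} (hr : ∀ x y, r ≤ ‖y‖ → F (x, y) = 0)
    {w : ℝ → E} (hw : ContDiff ℝ ∞ w) (hwp : Function.Periodic w L) :
    ∃ v : ℝ × ℝ → E, ContDiff ℝ ∞ v ∧ (∀ x, v (x, 0) = w x) ∧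
      (∀ x τ, HasDerivAt (fun t => v (x, t)) (F (x, v (x, τ))) τ) ∧
      ∀ x τ, v (x + L, τ) = v (x, τ) := by
  have : CompleteSpace E := FiniteDimensional.complete ℝ E
  set V : ℝ × E → ℝ × E := fun p => (0, F p)
  have hV : ContDiff ℝ ∞ V := contDiff_const.prodMk hF
  obtain ⟨C, hC⟩ := exists_bound_of_periodic hF.continuous hL hp r
  have hB : ∀ p, ‖V p‖ ≤ max C 0 := by
    rintro ⟨x, y⟩
    have : ‖V (x, y)‖ = ‖F (x, y)‖ := by simp [V]
    rw [this]
    rcases le_or_gt ‖y‖ r with h | h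
    · exact (hC x y h).trans (le_max_left _ _)
    · rw [hr x y h.le]; simp
  have hd : ContDiff ℝ ∞ (fderiv ℝ F) := hF.fderiv_right le_rfl
  obtain ⟨D, hD⟩ := exists_bound_of_periodic hd.continuous hL (fun x y => fderiv_periodic hp x y) r
  have hDF : ∀ p, ‖fderiv ℝ F p‖ ≤ max D 0 := by
    rintro ⟨x, y⟩
    rcases le_or_gt ‖y‖ r with h | h
    · exact (hD x y h).trans (le_max_left _ _)
    · have h0 : F =ᶠ[nhds (x, y)] fun _ => 0 := by
        have : ∀ᶠ p : ℝ × E in nhds (x, y), r < ‖p.2‖ :=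
          (continuous_norm.comp continuous_snd).continuousAt.eventually_const_lt h
        filter_upwards [this] with p hp' using hr p.1 p.2 hp'.le
      rw [h0.fderiv_eq]; simp
  have hlipF : LipschitzWith (max D 0).toNNReal F :=
    lipschitzWith_of_nnnorm_fderiv_le (hF.differentiable (by simp)) fun p => by
      rw [← NNReal.coe_le_coe, Real.coe_toNNReal _ (le_max_right _ _)]
      exact hDF p
  have hlip : LipschitzWith (max D 0).toNNReal V := by
    simpa using (LipschitzWith.const (0 : ℝ)).prodMk hlipF
  obtain ⟨Φ, hΦ⟩ := exists_isFlow hB hlip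
  have hsm := hΦ.contDiff hV hB hlip
  have hfst : ∀ p t, (Φ t p).1 = p.1 := by
    intro p t
    have h1 : ∀ t, HasDerivAt (fun t => (Φ t p).1) 0 t := fun t => (hΦ.deriv p t).fst
    have h2 := is_const_of_deriv_eq_zero (fun t => (h1 t).differentiableAt)
      (fun t => (h1 t).deriv) t 0
    rw [h2, hΦ.zero]
  refine ⟨fun p => (Φ p.2 (p.1, w p.1)).2, ?_, fun x => ?_, fun x τ => ?_, fun x τ => ?_⟩
  · exact contDiff_snd.comp (hsm.comp
      (contDiff_snd.prodMk (contDiff_fst.prodMk (hw.comp contDiff_fst))))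
  · simp [hΦ.zero]
  · have h1 := (hΦ.deriv (x, w x) τ).snd
    have h2 : Φ τ (x, w x) = (x, (Φ τ (x, w x)).2) := Prod.ext (hfst _ _) rfl
    simp only [V] at h1
    rw [h2] at h1
    exact h1
  -- The trajectory from `x + L`, relabelled to lie over `x`, solves the same equation with the same
  -- initial value.
  · have h3 := hΦ.eq_of_hasDerivAt hlip (x := (x, w x))
      (f := fun t => (x, (Φ t (x + L, w (x + L))).2)) (fun t => ?_) ?_
    · have := congrFun h3 τ
      simp only at this ⊢
      rw [← this]
    · have h1 := (hΦ.deriv (x + L, w (x + L)) t).snd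
      have h2 : Φ t (x + L, w (x + L)) = (x + L, (Φ t (x + L, w (x + L))).2) :=
        Prod.ext (hfst _ _) rfl
      have h4 : F (Φ t (x + L, w (x + L))) = F (x, (Φ t (x + L, w (x + L))).2) := by
        conv_lhs => rw [h2]
        exact hp _ _
      simp only [V] at h1 ⊢
      rw [h4] at h1
      exact (hasDerivAt_const t x).prodMk h1
    · simp [hΦ.zero, hwp x]

/-- Small solutions of a smooth periodic family of equations `v' = A(x, v) v` with `A(x, 0)`
dissipative are global, smooth in the parameter, and decay together with all derivatives. -/
theorem exists_decaying_family {A : ℝ × (Fin n → ℝ) → (Fin n → ℝ) →L[ℝ] (Fin n → ℝ)}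
    (hA : ContDiff ℝ ∞ A) {L : ℝ} (hL : 0 < L) (hp : ∀ x y, A (x + L, y) = A (x, y)) {r : ℝ}
    (hr : ∀ x y, r ≤ ‖y‖ → A (x, y) = 0) {lam : ℝ} (hlam : 0 < lam)
    (hdiss : ∀ x v, v ⬝ᵥ A (x, 0) v ≤ -lam * (v ⬝ᵥ v)) {ρ : ℝ} (hρ : 0 < ρ) :
    ∃ δ > 0, ∀ w : ℝ → Fin n → ℝ, ContDiff ℝ ∞ w → Function.Periodic w L → (∀ x, ‖w x‖ ≤ δ) →
      ∃ v : ℝ × ℝ → Fin n → ℝ, ContDiff ℝ ∞ v ∧ (∀ x, v (x, 0) = w x) ∧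
        (∀ x τ, HasDerivAt (fun t => v (x, t)) (A (x, v (x, τ)) (v (x, τ))) τ) ∧
        (∀ x τ, v (x + L, τ) = v (x, τ)) ∧ (∀ x, ∀ τ ≥ 0, ‖v (x, τ)‖ ≤ ρ) ∧
        ∃ γ > 0, ∀ k, Decays γ k v := by
  set F : ℝ × (Fin n → ℝ) → (Fin n → ℝ) := fun p => A p p.2 with hFdef
  have hF : ContDiff ℝ ∞ F := hA.clm_apply contDiff_snd
  have hFp : ∀ x y, F (x + L, y) = F (x, y) := fun x y => by simp only [hFdef, hp]
  have hfd : ∀ p q, fderiv ℝ F p q = fderiv ℝ A p q p.2 + A p q.2 := by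
    intro p q
    have := ((hA.differentiable (by simp) p).hasFDerivAt.clm_apply
      (hasFDerivAt_snd (p := p))).fderiv
    change fderiv ℝ F p = _ at this
    rw [this]
    simp [add_comm]
  have hdy0 : ∀ x v, dy F (x, 0) v = A (x, 0) v := by
    intro x v
    simp [dy, hfd]
  obtain ⟨ρ₁, hρ₁, h₁⟩ := exists_radius_dissipative hA.continuous hL hp hlam hdiss
  -- `v` is governed by `A`, its `x`-derivatives by `D_y F`. Both coincide at `y = 0` because `F = A
  -- y`, so both are dissipative on a small ball.
  obtain ⟨ρ₂, hρ₂, h₂⟩ := exists_radius_dissipative (contDiff_dy hF).continuous hL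
    (fun x y => by simp only [dy, fderiv_periodic hFp]) hlam
    (fun x v => by rw [hdy0]; exact hdiss x v)
  set R := min ρ (min ρ₁ ρ₂) with hR
  have hR0 : 0 < R := lt_min hρ (lt_min hρ₁ hρ₂)
  -- Sup norm at most `R / (n + 1)` forces `w ⬝ᵥ w ≤ R ^ 2`.
  refine ⟨R / (n + 1), by positivity, fun w hw hwp hwδ => ?_⟩
  obtain ⟨v, hv, hv0, hvd, hvp⟩ := exists_smooth_family hF hL hFp (r := r)
    (fun x y hy => by simp [hFdef, hr x y hy]) hw hwp
  have hsmall : ∀ x, ∀ τ ≥ 0, ‖v (x, τ)‖ ≤ R := by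
    intro x τ hτ
    have hS : ∀ t, HasDerivAt (fun t => v (x, t) ⬝ᵥ v (x, t))
        (2 * (v (x, t) ⬝ᵥ F (x, v (x, t)))) t := fun t => hasDerivAt_dotProduct_self (hvd x t)
    -- Where `v ⬝ᵥ v = R ^ 2` its derivative is at most `-lam * R ^ 2 < 0`, so this level is never
    -- crossed.
    have hle := image_le_of_deriv_right_lt_deriv_boundary (a := 0) (b := τ)
      (f := fun t => v (x, t) ⬝ᵥ v (x, t)) (f' := fun t => 2 * (v (x, t) ⬝ᵥ F (x, v (x, t))))
      (B := fun _ => R ^ 2) (B' := fun _ => 0)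
      (fun t _ => (hS t).continuousAt.continuousWithinAt) (fun t _ => (hS t).hasDerivWithinAt)
      (by
        simp only [hv0]
        refine (dotProduct_le_norm_mul_norm _ _).trans ?_
        have h1 : ‖w x‖ * ‖w x‖ ≤ R / (n + 1) * (R / (n + 1)) :=
          mul_self_le_mul_self (norm_nonneg _) (hwδ x)
        calc (n : ℝ) * (‖w x‖ * ‖w x‖) ≤ n * (R / (n + 1) * (R / (n + 1))) := by gcongr
          _ = (n / (n + 1) ^ 2) * R ^ 2 := by field_simp
          _ ≤ 1 * R ^ 2 := by
            gcongr
            rw [div_le_one (by positivity)]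
            nlinarith [(Nat.cast_nonneg n : (0 : ℝ) ≤ n)]
          _ = R ^ 2 := one_mul _)
      (fun t => hasDerivAt_const t _)
      (fun t _ ht => by
        have hn : ‖v (x, t)‖ ≤ R := by
          refine abs_le_of_sq_le_sq' ?_ hR0.le |>.2
          rw [← ht]
          exact norm_sq_le_dotProduct _
        have := h₁ x (v (x, t)) (hn.trans ((min_le_right _ _).trans (min_le_left _ _))) (v (x, t))
        rw [ht] at this
        have hpos : 0 < lam * R ^ 2 := by positivity
        change v (x, t) ⬝ᵥ F (x, v (x, t)) ≤ _ at this
        linarith)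
    refine abs_le_of_sq_le_sq' ?_ hR0.le |>.2
    exact (norm_sq_le_dotProduct _).trans (hle ⟨hτ, le_rfl⟩)
  have hpv : ContDiff ℝ ∞ fun p : ℝ × ℝ => (p.1, v p) := contDiff_fst.prodMk hv
  have hdt : dt v = fun p => F (p.1, v p) := by
    funext ⟨x, τ⟩
    exact (hasDerivAt_dt hv x τ).unique (hvd x τ)
  -- A rate strictly below the damping `lam / 2` is reproduced at each order, so one `γ` serves all
  -- `k`.
  have hγ : 0 < lam / 4 := by linarith
  have hγl : lam / 4 < lam / 2 := by linarith
  refine ⟨v, hv, hv0, hvd, hvp, fun x τ hτ => (hsmall x τ hτ).trans (min_le_left _ _),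
    lam / 4, hγ, fun k => ?_⟩
  have hAv : ContDiff ℝ ∞ fun p => A (p.1, v p) := hA.comp hpv
  have hAx : ContDiff ℝ ∞ fun q => fderiv ℝ A q (1, 0) :=
    (hA.fderiv_right le_rfl).clm_apply contDiff_const
  induction k with
  | zero =>
    have hb : Decays 0 0 v := decays_zero.2 ⟨R, fun x τ hτ => by simpa using hsmall x τ hτ⟩
    refine decays_of_linear hL hγl 0 hv (g := 0) contDiff_const hAv hvp (fun p => ?_)
      (fun x τ hτ z => h₁ x _ ((hsmall x τ hτ).trans
        ((min_le_right _ _).trans (min_le_left _ _))) z)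
      (decays_comp hA hL hp hv hb) (decays_zero_fun _)
    rw [hdt]
    simp [hFdef]
  | succ k ih =>
    refine decays_succ.2 ⟨ih.of_le (by omega), ?_⟩
    have hb := ih.bounded hγ.le
    -- The forcing `(∂_x A)(x, v) v` is linear in the undifferentiated `v`, hence decays to order
    -- `k` by the induction hypothesis.
    refine decays_of_linear hL hγl k (contDiff_dx hv)
      (g := fun p => fderiv ℝ A (p.1, v p) (1, 0) (v p))
      (B := fun p => dy F (p.1, v p))
      ((hAx.comp hpv).clm_apply hv) ((contDiff_dy hF).comp hpv) (dx_periodic hv hvp) (fun p => ?_)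
      (fun x τ hτ z => h₂ x _ ((hsmall x τ hτ).trans
        ((min_le_right _ _).trans (min_le_right _ _))) z)
      (decays_comp (contDiff_dy hF) hL (fun x y => by simp only [dy, fderiv_periodic hFp]) hv hb)
      (Decays.clm_apply (hAx.comp hpv) hv
        (decays_comp hAx hL (fun x y => by rw [fderiv_periodic hp]) hv hb) ih)
    rw [dt_dx hv, hdt, dx_comp hF hv]
    simp only [hfd, map_zero, add_zero]
    rw [add_comm]

end Family

/-! ### Positive roots of increasing scalar equations -/

section ImplicitRoot

variable {X : Type*} [NormedAddCommGroup X] [NormedSpace ℝ X]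

lemma root_unique {f : ℝ → ℝ} (hf : ∀ θ > 0, 0 < deriv f θ) {θ₁ θ₂ : ℝ}
    (h₁ : 0 < θ₁) (h₂ : 0 < θ₂) (he : f θ₁ = f θ₂) : θ₁ = θ₂ := by
  have hmono : StrictMonoOn f (Ioi 0) := by
    refine strictMonoOn_of_deriv_pos (convex_Ioi 0) (fun θ hθ => ?_) fun θ hθ => ?_
    -- `deriv` is `0` where a function is not differentiable, so a positive value already gives
    -- differentiability.
    · exact (differentiableAt_of_deriv_ne_zero (hf θ hθ).ne').continuousAt.continuousWithinAt
    · rw [interior_Ioi] at hθ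
      exact hf θ hθ
  exact hmono.injOn h₁ h₂ he

lemma exists_smooth_root [CompleteSpace X] {O : Set X} (hO : IsOpen O) {h : X × ℝ → ℝ}
    (hh : ContDiffOn ℝ ∞ h (O ×ˢ Ioi 0)) {x : X} (hx : x ∈ O) {θ : ℝ} (hθ : 0 < θ)
    (hpos : 0 < deriv (fun t => h (x, t)) θ) (hroot : h (x, θ) = 0) :
    ∃ ψ : X → ℝ, ContDiffAt ℝ ∞ ψ x ∧ ∀ᶠ y in nhds x, 0 < ψ y ∧ h (y, ψ y) = 0 := by
  have hat : ContDiffAt ℝ ∞ h (x, θ) :=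
    hh.contDiffAt ((hO.prod isOpen_Ioi).mem_nhds ⟨hx, hθ⟩)
  have hd : HasDerivAt (fun t => h (x, t)) (fderiv ℝ h (x, θ) (0, 1)) θ :=
    (hat.differentiableAt (by simp)).hasFDerivAt.comp_hasDerivAt θ
      ((hasDerivAt_const θ x).prodMk (hasDerivAt_id θ))
  rw [hd.deriv] at hpos
  have hinv : (fderiv ℝ h (x, θ) ∘L .inr ℝ X ℝ).IsInvertible := by
    refine ⟨ContinuousLinearEquiv.unitsEquivAut ℝ (Units.mk0 _ hpos.ne'), ?_⟩
    ext
    simp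
  have h0 : hat.implicitFunction (by simp) hinv x = θ :=
    hat.implicitFunction_apply_self (by simp) hinv
  refine ⟨hat.implicitFunction (by simp) hinv, hat.contDiffAt_implicitFunction (by simp) hinv, ?_⟩
  have hc := (hat.contDiffAt_implicitFunction (by simp) hinv).continuousAt
  have hev : ∀ᶠ y in nhds x, 0 < hat.implicitFunction (by simp) hinv y :=
    hc.eventually_const_lt (by rw [h0]; exact hθ)
  filter_upwards [hev, hat.eventually_apply_implicitFunction (by simp) hinv] with y h1 h2
  exact ⟨h1, h2.trans hroot⟩

/-- The parameters for which `h (x, ·)` has a positive root form an open set. -/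
lemma isOpen_root [CompleteSpace X] {O : Set X} (hO : IsOpen O) {h : X × ℝ → ℝ}
    (hh : ContDiffOn ℝ ∞ h (O ×ˢ Ioi 0))
    (hpos : ∀ x ∈ O, ∀ θ > 0, 0 < deriv (fun t => h (x, t)) θ) :
    IsOpen {x ∈ O | ∃ θ > 0, h (x, θ) = 0} := by
  rw [isOpen_iff_mem_nhds]
  rintro x ⟨hx, θ, hθ, hroot⟩
  obtain ⟨ψ, -, hψ⟩ := exists_smooth_root hO hh hx hθ (hpos x hx θ hθ) hroot
  filter_upwards [hψ, hO.mem_nhds hx] with y hy hyO using ⟨hyO, ψ y, hy.1, hy.2⟩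

/-- The positive root of `h (x, ·)` depends smoothly on `x`. -/
lemma contDiffAt_root [CompleteSpace X] {O : Set X} (hO : IsOpen O) {h : X × ℝ → ℝ}
    (hh : ContDiffOn ℝ ∞ h (O ×ˢ Ioi 0))
    (hpos : ∀ x ∈ O, ∀ θ > 0, 0 < deriv (fun t => h (x, t)) θ) {T : X → ℝ}
    (hT : ∀ x ∈ O, (∃ θ > 0, h (x, θ) = 0) → 0 < T x ∧ h (x, T x) = 0) {x : X} (hx : x ∈ O)
    (hroot : ∃ θ > 0, h (x, θ) = 0) : ContDiffAt ℝ ∞ T x := by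
  obtain ⟨θ, hθ, hr⟩ := hroot
  obtain ⟨ψ, hψ, hev⟩ := exists_smooth_root hO hh hx hθ (hpos x hx θ hθ) hr
  refine hψ.congr_of_eventuallyEq ?_
  filter_upwards [hev, hO.mem_nhds hx] with y hy hyO
  obtain ⟨h1, h2⟩ := hT y hyO ⟨ψ y, hy.1, hy.2⟩
  -- `T` is an arbitrary selection of roots; uniqueness identifies it with the implicit function.
  exact root_unique (f := fun t => h (y, t)) (hpos y hyO) h1 hy.1 (h2.trans hy.2.symm)

end ImplicitRoot

/-! ### Smoothness of integrals in a parameter -/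

section ParametricIntegral

/-- Near `α` the derivative is dominated by a constant: it is continuous on the compact product of a
small closed ball and `[-1, 1]`. -/
lemma hasDerivAt_integral_of_contDiffOn {K : ℝ × ℝ → ℝ} {U : Set (ℝ × ℝ)} (hU : IsOpen U)
    (hsub : Ioo (-1) 1 ×ˢ Icc (-1) 1 ⊆ U) (hK : ContDiffOn ℝ ∞ K U) {α : ℝ}
    (hα : α ∈ Ioo (-1 : ℝ) 1) :
    HasDerivAt (fun α => ∫ μ in (-1 : ℝ)..1, K (α, μ))
      (∫ μ in (-1 : ℝ)..1, fderiv ℝ K (α, μ) (1, 0)) α := by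
  have hK' : ContinuousOn (fun p => fderiv ℝ K p (1, 0)) U :=
    ((hK.fderiv_of_isOpen hU (m := ∞) le_rfl).continuousOn).clm_apply continuousOn_const
  have hslice : ∀ {f : ℝ × ℝ → ℝ}, ContinuousOn f U → ∀ a ∈ Ioo (-1 : ℝ) 1,
      ContinuousOn (fun μ => f (a, μ)) (Icc (-1) 1) := fun hf a ha =>
    hf.comp (Continuous.continuousOn (by fun_prop)) fun μ hμ => hsub ⟨ha, hμ⟩
  have hint : ∀ {f : ℝ × ℝ → ℝ}, ContinuousOn f U → ∀ a ∈ Ioo (-1 : ℝ) 1,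
      IntervalIntegrable (fun μ => f (a, μ)) MeasureTheory.volume (-1) 1 := fun hf a ha =>
    ((hslice hf a ha).mono (by rw [uIcc_of_le (by norm_num)])).intervalIntegrable
  obtain ⟨ε, hε, hball⟩ := Metric.isOpen_iff.1 isOpen_Ioo α hα
  have hs : Metric.closedBall α (ε / 2) ⊆ Ioo (-1 : ℝ) 1 :=
    (Metric.closedBall_subset_ball (by linarith)).trans hball
  obtain ⟨C, hC⟩ := ((isCompact_closedBall α (ε / 2)).prod
    (isCompact_Icc (a := (-1 : ℝ)) (b := 1))).exists_bound_of_continuousOn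
    (hK'.mono ((prod_mono hs Subset.rfl).trans hsub))
  refine (intervalIntegral.hasDerivAt_integral_of_dominated_loc_of_deriv_le
    (F := fun a μ => K (a, μ)) (F' := fun a μ => fderiv ℝ K (a, μ) (1, 0)) (bound := fun _ => C)
    (Metric.closedBall_mem_nhds α (half_pos hε)) ?_ (hint hK.continuousOn α hα) ?_ ?_
    (by simp) ?_).2
  · filter_upwards [isOpen_Ioo.mem_nhds hα] with a ha
    exact (hint hK.continuousOn a ha).def'.aestronglyMeasurable
  · exact (hint hK' α hα).def'.aestronglyMeasurable
  · refine Filter.Eventually.of_forall fun μ hμ a ha => ?_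
    rw [uIoc_of_le (by norm_num)] at hμ
    exact hC (a, μ) ⟨ha, Ioc_subset_Icc_self hμ⟩
  · refine Filter.Eventually.of_forall fun μ hμ a ha => ?_
    rw [uIoc_of_le (by norm_num)] at hμ
    have hmem : (a, μ) ∈ U := hsub ⟨hs ha, Ioc_subset_Icc_self hμ⟩
    exact ((hK.contDiffAt (hU.mem_nhds hmem)).differentiableAt
      (by simp)).hasFDerivAt.comp_hasDerivAt a ((hasDerivAt_id a).prodMk (hasDerivAt_const a μ))

/-- Integrals over `[-1, 1]` depend smoothly on parameters in `(-1, 1)`. -/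
lemma contDiffOn_integral {K : ℝ × ℝ → ℝ} {U : Set (ℝ × ℝ)} (hU : IsOpen U)
    (hsub : Ioo (-1) 1 ×ˢ Icc (-1) 1 ⊆ U) (hK : ContDiffOn ℝ ∞ K U) :
    ContDiffOn ℝ ∞ (fun α => ∫ μ in (-1 : ℝ)..1, K (α, μ)) (Ioo (-1) 1) := by
  refine contDiffOn_infty.2 fun n => ?_
  induction n generalizing K with
  | zero =>
    exact contDiffOn_zero.2 fun α hα =>
      (hasDerivAt_integral_of_contDiffOn hU hsub hK hα).continuousAt.continuousWithinAt
  | succ n ih =>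
    push_cast
    rw [contDiffOn_succ_iff_deriv_of_isOpen isOpen_Ioo]
    refine ⟨fun α hα => (hasDerivAt_integral_of_contDiffOn hU hsub hK
      hα).differentiableAt.differentiableWithinAt, by simp, ?_⟩
    refine (ih (K := fun p => fderiv ℝ K p (1, 0))
      ((hK.fderiv_of_isOpen hU (m := ∞) le_rfl).clm_apply contDiffOn_const)).congr fun α hα => ?_
    exact (hasDerivAt_integral_of_contDiffOn hU hsub hK hα).deriv

end ParametricIntegral

/-! ### Orthogonality of the Gram–Schmidt polynomials -/

section Orthogonality

/-- The weighted inner product of polynomials on `[-1, 1]`. -/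
noncomputable def ip (W : ℝ → ℝ) (p q : Polynomial ℝ) : ℝ :=
  ∫ μ in (-1 : ℝ)..1, p.eval μ * q.eval μ * W μ

variable {W : ℝ → ℝ}

lemma ip_integrable (hW : ContinuousOn W (Icc (-1) 1)) (p q : Polynomial ℝ) :
    IntervalIntegrable (fun μ => p.eval μ * q.eval μ * W μ) MeasureTheory.volume (-1) 1 := by
  refine ContinuousOn.intervalIntegrable ?_
  rw [uIcc_of_le (by norm_num)]
  exact ((p.continuous.mul q.continuous).continuousOn).mul hW

lemma ip_comm (p q : Polynomial ℝ) : ip W p q = ip W q p := by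
  simp only [ip, mul_comm (p.eval _)]

lemma ip_sub (hW : ContinuousOn W (Icc (-1) 1)) (p₁ p₂ q : Polynomial ℝ) :
    ip W (p₁ - p₂) q = ip W p₁ q - ip W p₂ q := by
  rw [ip, ip, ip, ← intervalIntegral.integral_sub (ip_integrable hW _ _) (ip_integrable hW _ _)]
  simp only [Polynomial.eval_sub, sub_mul]

lemma ip_sum (hW : ContinuousOn W (Icc (-1) 1)) {ι : Type*} (s : Finset ι) (c : ι → ℝ)
    (p : ι → Polynomial ℝ) (q : Polynomial ℝ) :
    ip W (∑ i ∈ s, Polynomial.C (c i) * p i) q = ∑ i ∈ s, c i * ip W (p i) q := by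
  simp only [ip, ← intervalIntegral.integral_const_mul]
  rw [← intervalIntegral.integral_finsetSum fun i _ => (ip_integrable hW _ _).const_mul _]
  refine intervalIntegral.integral_congr fun μ _ => ?_
  simp only [Polynomial.eval_finsetSum, Polynomial.eval_mul, Polynomial.eval_C, Finset.sum_mul]
  exact Finset.sum_congr rfl fun i _ => by ring

lemma kappa_eq_ip (j k : ℕ) : kappa W j k = ip W (Polynomial.X ^ j) (orthoPoly W k) := by
  simp [kappa, ip]

lemma orthoPoly_eq (W : ℝ → ℝ) (j : ℕ) : orthoPoly W j = Polynomial.X ^ j -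
    ∑ k : Fin j, Polynomial.C (kappa W j k / kappa W k k) * orthoPoly W k := by
  rw [orthoPoly]
  rfl

lemma orthoPoly_degree (W : ℝ → ℝ) (j : ℕ) : (orthoPoly W j).degree = j := by
  induction j using Nat.strong_induction_on with
  | _ j ih =>
    rw [orthoPoly_eq, Polynomial.degree_sub_eq_left_of_degree_lt, Polynomial.degree_X_pow]
    rw [Polynomial.degree_X_pow]
    refine (Polynomial.degree_sum_le _ _).trans_lt ?_
    rw [Finset.sup_lt_iff (by exact WithBot.bot_lt_coe j)]
    intro k _
    rw [← Polynomial.smul_eq_C_mul]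
    refine lt_of_le_of_lt (Polynomial.degree_smul_le _ _) ?_
    rw [ih k k.2]
    exact_mod_cast k.2

lemma orthoPoly_ne_zero (W : ℝ → ℝ) (j : ℕ) : orthoPoly W j ≠ 0 := by
  intro h
  have := orthoPoly_degree W j
  rw [h, Polynomial.degree_zero] at this
  exact (WithBot.bot_lt_coe j).ne this

lemma ip_self_pos (hW : ContinuousOn W (Icc (-1) 1)) (hpos : ∀ μ ∈ Icc (-1 : ℝ) 1, 0 < W μ)
    {p : Polynomial ℝ} (hp : p ≠ 0) : 0 < ip W p p := by
  refine intervalIntegral.integral_pos (by norm_num)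
    (((p.continuous.mul p.continuous).continuousOn).mul hW)
    (fun μ hμ => mul_nonneg (mul_self_nonneg _) (hpos μ (Ioc_subset_Icc_self hμ)).le) ?_
  by_contra hcon
  push Not at hcon
  refine hp (Polynomial.eq_zero_of_infinite_isRoot p
    ((Icc_infinite (by norm_num : (-1 : ℝ) < 1)).mono fun μ hμ => ?_))
  by_contra hne
  exact absurd (hcon μ hμ) (not_le.2 (mul_pos (mul_self_pos.2 hne) (hpos μ hμ)))

/-- `X ^ k - φ_k` is a combination of the lower `φ_l`. Only orthogonality below `k` is assumed, so
that `κ_{k,k} ≠ 0` is available inside the orthogonality induction. -/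
lemma kappa_self_of_orthogonal (hW : ContinuousOn W (Icc (-1) 1)) (k : ℕ)
    (h : ∀ l < k, ip W (orthoPoly W l) (orthoPoly W k) = 0) :
    kappa W k k = ip W (orthoPoly W k) (orthoPoly W k) := by
  nth_rw 1 [orthoPoly_eq]
  rw [ip_sub hW, ip_sum hW, kappa_eq_ip, Finset.sum_eq_zero, sub_zero]
  intro l _
  rw [h l l.2, mul_zero]

lemma ip_orthoPoly_of_lt (hW : ContinuousOn W (Icc (-1) 1)) (hpos : ∀ μ ∈ Icc (-1 : ℝ) 1, 0 < W μ)
    (j : ℕ) : ∀ k < j, ip W (orthoPoly W j) (orthoPoly W k) = 0 := by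
  induction j using Nat.strong_induction_on with
  | _ j ih =>
    have horth : ∀ l k : Fin j, l ≠ k → ip W (orthoPoly W l) (orthoPoly W k) = 0 := by
      intro l k hlk
      rcases lt_or_gt_of_ne hlk with h | h
      · rw [ip_comm]
        exact ih k k.2 l h
      · exact ih l l.2 k h
    intro k hk
    have hkk : kappa W k k = ip W (orthoPoly W k) (orthoPoly W k) := by
      refine kappa_self_of_orthogonal hW k fun l hl => ?_
      exact horth ⟨l, hl.trans hk⟩ ⟨k, hk⟩ (by simp [Fin.ext_iff, hl.ne])
    have hne : kappa W k k ≠ 0 := by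
      rw [hkk]; exact (ip_self_pos hW hpos (orthoPoly_ne_zero W k)).ne'
    rw [orthoPoly_eq W j, ip_sub hW, ip_sum hW, ← kappa_eq_ip,
      Finset.sum_eq_single (⟨k, hk⟩ : Fin j)]
    · simp only
      rw [← hkk]
      field_simp
      ring
    · intro l _ hl
      have := horth l ⟨k, hk⟩ hl
      simp only at this
      rw [this, mul_zero]
    · simp

lemma ip_orthoPoly (hW : ContinuousOn W (Icc (-1) 1)) (hpos : ∀ μ ∈ Icc (-1 : ℝ) 1, 0 < W μ)
    {j k : ℕ} (hjk : j ≠ k) : ip W (orthoPoly W j) (orthoPoly W k) = 0 := by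
  rcases lt_or_gt_of_ne hjk with h | h
  · rw [ip_comm]
    exact ip_orthoPoly_of_lt hW hpos k j h
  · exact ip_orthoPoly_of_lt hW hpos j k h

lemma kappa_self (hW : ContinuousOn W (Icc (-1) 1)) (hpos : ∀ μ ∈ Icc (-1 : ℝ) 1, 0 < W μ)
    (k : ℕ) : kappa W k k = ip W (orthoPoly W k) (orthoPoly W k) :=
  kappa_self_of_orthogonal hW k fun _ hl => ip_orthoPoly hW hpos hl.ne

lemma kappa_self_pos (hW : ContinuousOn W (Icc (-1) 1)) (hpos : ∀ μ ∈ Icc (-1 : ℝ) 1, 0 < W μ)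
    (k : ℕ) : 0 < kappa W k k := by
  rw [kappa_self hW hpos]
  exact ip_self_pos hW hpos (orthoPoly_ne_zero W k)

@[simp] lemma orthoPoly_zero (W : ℝ → ℝ) : orthoPoly W 0 = 1 := by
  rw [orthoPoly_eq]; simp

end Orthogonality

/-! ### Smooth dependence of polynomials and moments on `α` -/

section WeightFamily

/-- The weights `(1 + α μ)⁻ᵐ`. -/
noncomputable def powerWeight (m : ℕ) (α μ : ℝ) : ℝ := 1 / (1 + α * μ) ^ m

lemma weightT_eq : weightT = powerWeight 5 := rfl

/-- The open set of `(α, μ)` with `|α| < 1` on which the weights are smooth. -/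
def weightDomain : Set (ℝ × ℝ) := {p | p.1 ∈ Ioo (-1 : ℝ) 1 ∧ 0 < 1 + p.1 * p.2}

lemma isOpen_weightDomain : IsOpen weightDomain :=
  (isOpen_Ioo.preimage continuous_fst).inter
    (isOpen_lt continuous_const (continuous_const.add (continuous_fst.mul continuous_snd)))

lemma prod_subset_weightDomain : Ioo (-1) 1 ×ˢ Icc (-1) 1 ⊆ weightDomain := by
  rintro ⟨α, μ⟩ ⟨hα, hμ⟩
  refine ⟨hα, ?_⟩
  have h1 : |α * μ| < 1 := by
    rw [abs_mul]
    calc |α| * |μ| ≤ |α| * 1 := by gcongr; exact abs_le.2 hμ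
      _ < 1 := by rw [mul_one]; exact abs_lt.2 hα
  have := neg_abs_le (α * μ)
  simp only
  linarith

lemma mem_weightDomain {α μ : ℝ} (hα : α ∈ Ioo (-1 : ℝ) 1) (hμ : μ ∈ Icc (-1 : ℝ) 1) :
    (α, μ) ∈ weightDomain := prod_subset_weightDomain ⟨hα, hμ⟩

lemma contDiffOn_powerWeight (m : ℕ) :
    ContDiffOn ℝ ∞ (fun p : ℝ × ℝ => powerWeight m p.1 p.2) weightDomain := by
  unfold powerWeight
  refine contDiffOn_const.div (ContDiff.contDiffOn (by fun_prop)) fun p hp => ?_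
  exact pow_ne_zero _ hp.2.ne'

lemma continuousOn_slice {K : ℝ × ℝ → ℝ} (hK : ContinuousOn K weightDomain) {α : ℝ}
    (hα : α ∈ Ioo (-1 : ℝ) 1) : ContinuousOn (fun μ => K (α, μ)) (Icc (-1) 1) :=
  hK.comp (Continuous.continuousOn (by fun_prop)) fun _ hμ => mem_weightDomain hα hμ

lemma continuousOn_powerWeight (m : ℕ) {α : ℝ} (hα : α ∈ Ioo (-1 : ℝ) 1) :
    ContinuousOn (powerWeight m α) (Icc (-1) 1) :=
  continuousOn_slice (contDiffOn_powerWeight m).continuousOn hα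

lemma powerWeight_pos (m : ℕ) {α : ℝ} (hα : α ∈ Ioo (-1 : ℝ) 1) :
    ∀ μ ∈ Icc (-1 : ℝ) 1, 0 < powerWeight m α μ := fun μ hμ => by
  have : 0 < 1 + α * μ := (mem_weightDomain hα hμ).2
  unfold powerWeight
  positivity

lemma kappa_powerWeight_pos (m k : ℕ) {α : ℝ} (hα : α ∈ Ioo (-1 : ℝ) 1) :
    0 < kappa (powerWeight m α) k k :=
  kappa_self_pos (continuousOn_powerWeight m hα) (powerWeight_pos m hα) k

lemma contDiffOn_kappa_of {m : ℕ} (j : ℕ) {k : ℕ}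
    (h : ContDiffOn ℝ ∞ (fun p : ℝ × ℝ => (orthoPoly (powerWeight m p.1) k).eval p.2)
      weightDomain) :
    ContDiffOn ℝ ∞ (fun α => kappa (powerWeight m α) j k) (Ioo (-1) 1) := by
  refine contDiffOn_integral (K := fun p => p.2 ^ j * (orthoPoly (powerWeight m p.1) k).eval p.2 *
    powerWeight m p.1 p.2) isOpen_weightDomain prod_subset_weightDomain ?_
  exact ((ContDiff.contDiffOn (by fun_prop)).mul h).mul (contDiffOn_powerWeight m)

/-- `φ_j` is rational in the moments of lower index, each smooth by differentiation under the
integral, with denominators `κ_{k,k} > 0`. -/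
lemma contDiffOn_orthoPoly (m j : ℕ) :
    ContDiffOn ℝ ∞ (fun p : ℝ × ℝ => (orthoPoly (powerWeight m p.1) j).eval p.2)
      weightDomain := by
  induction j using Nat.strong_induction_on with
  | _ j ih =>
    have e : (fun p : ℝ × ℝ => (orthoPoly (powerWeight m p.1) j).eval p.2) = fun p =>
        p.2 ^ j - ∑ k : Fin j, kappa (powerWeight m p.1) j k / kappa (powerWeight m p.1) k k *
          (orthoPoly (powerWeight m p.1) k).eval p.2 := by
      funext p
      rw [orthoPoly_eq]
      simp [Polynomial.eval_finsetSum]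
    rw [e]
    refine (ContDiff.contDiffOn (by fun_prop)).sub (ContDiffOn.sum fun k _ => ?_)
    have hmaps : MapsTo Prod.fst weightDomain (Ioo (-1 : ℝ) 1) := fun p hp => hp.1
    have h1 := fun i => (contDiffOn_kappa_of i (ih k k.2)).comp contDiffOn_fst hmaps
    exact ((h1 j).div (h1 k) fun p hp => (kappa_powerWeight_pos m k hp.1).ne').mul (ih k k.2)

lemma contDiffOn_kappa (m j k : ℕ) :
    ContDiffOn ℝ ∞ (fun α => kappa (powerWeight m α) j k) (Ioo (-1) 1) :=
  contDiffOn_kappa_of j (contDiffOn_orthoPoly m k)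

end WeightFamily

/-! ### Projection coefficients and basis functions -/

section Projection

lemma projCoeff_congr {α : ℝ} {i : ℕ} {f g : ℝ → ℝ} (h : EqOn f g (Icc (-1) 1)) :
    projCoeff α i f = projCoeff α i g := by
  unfold projCoeff
  congr 1
  refine intervalIntegral.integral_congr fun μ hμ => ?_
  rw [uIcc_of_le (by norm_num)] at hμ
  simp only [h hμ]

lemma projCoeff_integrable {f : ℝ → ℝ} (hf : ContinuousOn f (Icc (-1) 1)) (p : Polynomial ℝ) :
    IntervalIntegrable (fun μ => f μ * p.eval μ) MeasureTheory.volume (-1) 1 := by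
  refine ContinuousOn.intervalIntegrable ?_
  rw [uIcc_of_le (by norm_num)]
  exact hf.mul p.continuous.continuousOn

lemma projCoeff_const_mul (α : ℝ) (i : ℕ) (c : ℝ) (f : ℝ → ℝ) :
    projCoeff α i (fun μ => c * f μ) = c * projCoeff α i f := by
  simp only [projCoeff, mul_assoc, intervalIntegral.integral_const_mul, mul_div_assoc]

lemma projCoeff_add (α : ℝ) (i : ℕ) {f g : ℝ → ℝ} (hf : ContinuousOn f (Icc (-1) 1))
    (hg : ContinuousOn g (Icc (-1) 1)) :
    projCoeff α i (fun μ => f μ + g μ) = projCoeff α i f + projCoeff α i g := by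
  simp only [projCoeff, add_mul, ← add_div]
  rw [intervalIntegral.integral_add (projCoeff_integrable hf _) (projCoeff_integrable hg _)]

lemma projCoeff_sum (α : ℝ) (i : ℕ) {ι : Type*} (s : Finset ι) (c : ι → ℝ) {f : ι → ℝ → ℝ}
    (hf : ∀ k, ContinuousOn (f k) (Icc (-1) 1)) :
    projCoeff α i (fun μ => ∑ k ∈ s, c k * f k μ) = ∑ k ∈ s, c k * projCoeff α i (f k) := by
  simp only [← projCoeff_const_mul]
  simp only [projCoeff, Finset.sum_mul, ← Finset.sum_div]
  rw [intervalIntegral.integral_finsetSum]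
  exact fun k _ => projCoeff_integrable (f := fun μ => c k * f k μ)
    (continuousOn_const.mul (hf k)) _

lemma contDiffOn_projCoeff {K : ℝ × ℝ → ℝ} (hK : ContDiffOn ℝ ∞ K weightDomain) (i : ℕ) :
    ContDiffOn ℝ ∞ (fun α => projCoeff α i fun μ => K (α, μ)) (Ioo (-1) 1) := by
  unfold projCoeff
  rw [weightT_eq]
  refine ContDiffOn.div ?_ (contDiffOn_kappa 5 i i) fun α hα => (kappa_powerWeight_pos 5 i hα).ne'
  exact contDiffOn_integral (K := fun p => K p * (orthoPoly (powerWeight 5 p.1) i).eval p.2)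
    isOpen_weightDomain prod_subset_weightDomain (hK.mul (contDiffOn_orthoPoly 5 i))

end Projection

section Modes

/-- The basis function `φ_k^{[α]} ω^{[α]}` of the ansatz. -/
noncomputable def mode (k : ℕ) (p : ℝ × ℝ) : ℝ :=
  (orthoPoly (weight p.1) k).eval p.2 * weight p.1 p.2

/-- The `α`-derivative of the basis function `φ_k^{[α]} ω^{[α]}`. -/
noncomputable def modeDeriv (k : ℕ) (p : ℝ × ℝ) : ℝ := fderiv ℝ (mode k) p (1, 0)

/-- The function `(1 - ω^{[α]}(μ)) / α`. -/
noncomputable def weightDefect (p : ℝ × ℝ) : ℝ :=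
  (4 * p.2 + 6 * p.1 * p.2 ^ 2 + 4 * p.1 ^ 2 * p.2 ^ 3 + p.1 ^ 3 * p.2 ^ 4) * weight p.1 p.2

lemma contDiffOn_mode (k : ℕ) : ContDiffOn ℝ ∞ (mode k) weightDomain :=
  (contDiffOn_orthoPoly 4 k).mul (contDiffOn_powerWeight 4)

lemma contDiffOn_modeDeriv (k : ℕ) : ContDiffOn ℝ ∞ (modeDeriv k) weightDomain :=
  ((contDiffOn_mode k).fderiv_of_isOpen isOpen_weightDomain (m := ∞) le_rfl).clm_apply
    contDiffOn_const

lemma contDiffOn_weightDefect : ContDiffOn ℝ ∞ weightDefect weightDomain :=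
  (ContDiff.contDiffOn (by fun_prop)).mul (contDiffOn_powerWeight 4)

lemma hasDerivAt_mode (k : ℕ) {α μ : ℝ} (h : (α, μ) ∈ weightDomain) :
    HasDerivAt (fun a => mode k (a, μ)) (modeDeriv k (α, μ)) α :=
  (((contDiffOn_mode k).contDiffAt (isOpen_weightDomain.mem_nhds h)).differentiableAt
    (by simp)).hasFDerivAt.comp_hasDerivAt (f := fun a => (a, μ)) α ((hasDerivAt_id α).prodMk (hasDerivAt_const α μ))

/-- Binomial expansion of `(1 + α μ) ^ 4 - 1`, divided by `α`: constants lie in the ansatz space up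
to a multiple of `α`. -/
lemma mode_zero_add_weightDefect {α μ : ℝ} (h : (α, μ) ∈ weightDomain) :
    mode 0 (α, μ) + α * weightDefect (α, μ) = 1 := by
  have h1 : 1 + α * μ ≠ 0 := h.2.ne'
  simp only [mode, weightDefect, weight, orthoPoly_zero, Polynomial.eval_one]
  field_simp
  ring

lemma kappa_zero_zero {α : ℝ} (hα : α ∈ Ioo (-1 : ℝ) 1) :
    kappa (weight α) 0 0 = 2 - α * ∫ μ in (-1 : ℝ)..1, weightDefect (α, μ) := by
  have hint : ∀ {K : ℝ × ℝ → ℝ}, ContDiffOn ℝ ∞ K weightDomain →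
      IntervalIntegrable (fun μ => K (α, μ)) MeasureTheory.volume (-1) 1 := fun hK => by
    refine ContinuousOn.intervalIntegrable ?_
    rw [uIcc_of_le (by norm_num)]
    exact continuousOn_slice hK.continuousOn hα
  have h1 : ∫ μ in (-1 : ℝ)..1, (mode 0 (α, μ) + α * weightDefect (α, μ)) = 2 := by
    rw [intervalIntegral.integral_congr (g := fun _ => 1) fun μ hμ => ?_]
    · norm_num
    · rw [uIcc_of_le (by norm_num)] at hμ
      exact mode_zero_add_weightDefect (mem_weightDomain hα hμ)
  rw [intervalIntegral.integral_add (hint (contDiffOn_mode 0))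
    ((hint contDiffOn_weightDefect).const_mul α), intervalIntegral.integral_const_mul] at h1
  have h2 : kappa (weight α) 0 0 = ∫ μ in (-1 : ℝ)..1, mode 0 (α, μ) := by
    simp [kappa, mode]
  linarith

end Modes

/-! ### The matrix `D̃` and its value at isotropic states -/

section ProjectionMatrix

variable {N : ℕ}

lemma fin_one_ne_zero (hN : 1 ≤ N) : (1 : Fin (N + 1)) ≠ 0 := by
  rw [Ne, Fin.ext_iff, Fin.val_one', Fin.val_zero, Nat.mod_eq_of_lt (by omega)]
  exact one_ne_zero

lemma fin_val_one (hN : 1 ≤ N) : ((1 : Fin (N + 1)) : ℕ) = 1 := by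
  rw [Fin.val_one', Nat.mod_eq_of_lt (by omega)]

lemma ansatz_eq (w : Fin (N + 1) → ℝ) (μ : ℝ) :
    ansatz w μ = ∑ k : Fin (N + 1), coeff w k * mode k (w 1, μ) := by
  simp only [ansatz, mode, mul_assoc]

lemma hasFDerivAt_coeff (w : Fin (N + 1) → ℝ) (k : Fin (N + 1)) :
    HasFDerivAt (fun z : Fin (N + 1) → ℝ => coeff z k)
      (if k = 1 then 0 else ContinuousLinearMap.proj (R := ℝ) (φ := fun _ => ℝ) k) w := by
  unfold coeff
  split_ifs with h
  · exact hasFDerivAt_const _ _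
  · exact hasFDerivAt_apply k w

/-- The ansatz is linear in the coefficients, so only direction `1`, that of `α`, differentiates the
basis functions. -/
lemma fderiv_ansatz {w : Fin (N + 1) → ℝ} {μ : ℝ} (h : (w 1, μ) ∈ weightDomain)
    (j : Fin (N + 1)) :
    fderiv ℝ (fun z : Fin (N + 1) → ℝ => ansatz z μ) w (Pi.single j 1) =
      if j = 1 then ∑ k, coeff w k * modeDeriv k (w 1, μ) else mode j (w 1, μ) := by
  have h1 : ∀ k : Fin (N + 1), HasFDerivAt (fun z : Fin (N + 1) → ℝ => mode k (z 1, μ))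
      (modeDeriv k (w 1, μ) • ContinuousLinearMap.proj (R := ℝ) (φ := fun _ => ℝ) 1) w := fun k =>
    (hasDerivAt_mode k h).comp_hasFDerivAt (f := fun z : Fin (N + 1) → ℝ => z 1) w
      (hasFDerivAt_apply 1 w)
  have h2 := HasFDerivAt.fun_sum (u := Finset.univ)
    (fun k _ => (hasFDerivAt_coeff w k).fun_mul (h1 k))
  have h3 : (fun z : Fin (N + 1) → ℝ => ansatz z μ) =
      fun z => ∑ k : Fin (N + 1), coeff z k * mode k (z 1, μ) := funext fun z => ansatz_eq z μ
  rw [h3, h2.fderiv]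
  split_ifs with hj
  · subst hj
    simp only [sum_apply]
    refine Finset.sum_congr rfl fun k _ => ?_
    split_ifs with hk
    · simp
    · simp [hk]
  · simp only [sum_apply]
    rw [Finset.sum_eq_single j]
    · simp [hj, Ne.symm hj]
    · intro k _ hk
      split_ifs with hk1
      · simp [Ne.symm hj]
      · simp [Ne.symm hj, hk]
    · simp

lemma matD_apply {w : Fin (N + 1) → ℝ} (hw : w 1 ∈ Ioo (-1 : ℝ) 1) (i j : Fin (N + 1)) :
    matD w i j = if j = 1 then
      ∑ k : Fin (N + 1), coeff w k * projCoeff (w 1) i (fun μ => modeDeriv k (w 1, μ))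
      else projCoeff (w 1) i (fun μ => mode j (w 1, μ)) := by
  have h : EqOn (fun μ => fderiv ℝ (fun z : Fin (N + 1) → ℝ => ansatz z μ) w (Pi.single j 1))
      (fun μ => if j = 1 then ∑ k, coeff w k * modeDeriv k (w 1, μ) else mode j (w 1, μ))
      (Icc (-1) 1) := fun μ hμ => fderiv_ansatz (mem_weightDomain hw hμ) j
  rw [matD, Matrix.of_apply, projCoeff_congr h]
  split_ifs with hj
  · exact projCoeff_sum _ _ _ _ fun k =>
      continuousOn_slice (contDiffOn_modeDeriv k).continuousOn hw
  · rfl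

lemma contDiffOn_matD (i j : Fin (N + 1)) :
    ContDiffOn ℝ ∞ (fun w : Fin (N + 1) → ℝ => matD w i j) {w | w 1 ∈ Ioo (-1 : ℝ) 1} := by
  have h1 : ContDiff ℝ ∞ fun w : Fin (N + 1) → ℝ => w 1 := by fun_prop
  have hmaps : MapsTo (fun w : Fin (N + 1) → ℝ => w 1) {w | w 1 ∈ Ioo (-1 : ℝ) 1}
    (Ioo (-1) 1) := fun w hw => hw
  refine ContDiffOn.congr (f := fun w : Fin (N + 1) → ℝ => if j = 1 then
      ∑ k : Fin (N + 1), coeff w k * projCoeff (w 1) i (fun μ => modeDeriv k (w 1, μ))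
      else projCoeff (w 1) i (fun μ => mode j (w 1, μ))) ?_ fun w hw => matD_apply hw i j
  split_ifs with hj
  · refine ContDiffOn.sum fun k _ => ContDiffOn.mul ?_
      ((contDiffOn_projCoeff (contDiffOn_modeDeriv k) i).comp h1.contDiffOn hmaps)
    unfold coeff
    split_ifs
    · exact contDiffOn_const
    · exact ContDiff.contDiffOn (by fun_prop)
  · exact (contDiffOn_projCoeff (contDiffOn_mode j) i).comp h1.contDiffOn hmaps

lemma weight_zero : weight 0 = fun _ => 1 := by
  funext μ; simp [weight]

lemma weightT_zero : weightT 0 = fun _ => 1 := by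
  funext μ; simp [weightT]

lemma orthoPoly_one_one : orthoPoly (fun _ => 1) 1 = Polynomial.X := by
  have h : kappa (fun _ => 1) 1 0 = 0 := by simp [kappa]
  rw [orthoPoly_eq]
  simp [h]

lemma projCoeff_zero_orthoPoly (i j : ℕ) :
    projCoeff 0 i (fun μ => (orthoPoly (fun _ => 1) j).eval μ) = if i = j then 1 else 0 := by
  have hc : ContinuousOn (fun _ : ℝ => (1 : ℝ)) (Icc (-1) 1) := continuousOn_const
  have hp : ∀ μ ∈ Icc (-1 : ℝ) 1, (0 : ℝ) < (fun _ : ℝ => (1 : ℝ)) μ := fun _ _ => one_pos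
  have h1 : projCoeff 0 i (fun μ => (orthoPoly (fun _ => 1) j).eval μ) =
      ip (fun _ => 1) (orthoPoly (fun _ => 1) j) (orthoPoly (fun _ => 1) i) /
        kappa (fun _ => 1) i i := by
    simp [projCoeff, weightT_zero, ip]
  rw [h1]
  split_ifs with h
  · subst h
    rw [← kappa_self hc hp, div_self (kappa_self_pos hc hp i).ne']
  · rw [ip_orthoPoly hc hp (Ne.symm h), zero_div]

lemma projCoeff_zero_id (i : ℕ) (c : ℝ) :
    projCoeff 0 i (fun μ => c * μ) = if i = 1 then c else 0 := by
  rw [projCoeff_const_mul]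
  have := projCoeff_zero_orthoPoly i 1
  rw [orthoPoly_one_one] at this
  simp only [Polynomial.eval_X] at this
  rw [this]
  simp

lemma modeDeriv_zero_zero (μ : ℝ) : modeDeriv 0 (0, μ) = -4 * μ := by
  have h1 := hasDerivAt_mode 0 (α := 0) (μ := μ) (by simp [weightDomain])
  have h2 : HasDerivAt (fun a : ℝ => mode 0 (a, μ)) (-4 * μ) 0 := by
    have h3 : (fun a : ℝ => mode 0 (a, μ)) = fun a => ((1 + a * μ) ^ 4)⁻¹ := by
      funext a; simp [mode, weight]
    rw [h3]
    have h4 : HasDerivAt (fun a : ℝ => 1 + a * μ) μ 0 := by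
      simpa using ((hasDerivAt_id (0 : ℝ)).mul_const μ).const_add 1
    have h5 := (h4.fun_pow 4).fun_inv (by simp)
    refine h5.congr_deriv ?_
    simp
  exact h1.unique h2

lemma zero_mem_Ioo : (0 : ℝ) ∈ Ioo (-1 : ℝ) 1 := by norm_num

/-- At an isotropic state the matrix `D̃` is diagonal. -/
lemma matD_isotropic (hN : 1 ≤ N) {w : Fin (N + 1) → ℝ} (hw : ∀ k, k ≠ 0 → w k = 0) :
    matD w = Matrix.diagonal fun i => if i = 1 then -4 * w 0 else 1 := by
  have h1 : w 1 = 0 := hw 1 (fin_one_ne_zero hN)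
  have hval : ∀ i : Fin (N + 1), (i : ℕ) = 1 ↔ i = 1 := fun i => by
    rw [Fin.ext_iff, fin_val_one hN]
  ext i j
  rw [matD_apply (by rw [h1]; exact zero_mem_Ioo), h1, Matrix.diagonal_apply]
  -- At `α = 0` both weights are `1`. Column `1` reduces to `w 0` times the `α`-derivative `-4 μ` of
  -- the weight, and `μ` is the Legendre polynomial of index `1`; the other columns are Legendre
  -- polynomials.
  by_cases hj : j = 1
  · subst hj
    rw [if_pos rfl, Finset.sum_eq_single 0]
    · simp only [Fin.val_zero, modeDeriv_zero_zero, projCoeff_zero_id, hval]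
      simp [coeff, Ne.symm (fin_one_ne_zero hN)]
      split_ifs <;> ring
    · intro k _ hk
      simp [coeff, hw k hk]
    · simp
  · rw [if_neg hj]
    have : (fun μ => mode j (0, μ)) = fun μ => (orthoPoly (fun _ => 1) j).eval μ := by
      funext μ; simp [mode, weight_zero]
    rw [this, projCoeff_zero_orthoPoly]
    by_cases hij : i = j
    · subst hij
      simp [hj]
    · simp [hij, Fin.val_inj]

end ProjectionMatrix

/-! ### Smoothness of linear solves -/

section Cramer

variable {X : Type*} [NormedAddCommGroup X] [NormedSpace ℝ X] {n : ℕ}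

lemma contDiffOn_det {s : Set X} {D : X → Matrix (Fin n) (Fin n) ℝ}
    (h : ∀ i j, ContDiffOn ℝ ∞ (fun x => D x i j) s) : ContDiffOn ℝ ∞ (fun x => (D x).det) s := by
  simp only [Matrix.det_apply']
  exact ContDiffOn.sum fun σ _ => contDiffOn_const.mul (contDiffOn_prod fun i _ => h _ _)

/-- By Cramer's rule each entry is a quotient of determinants. -/
lemma contDiffOn_inv_mulVec {s : Set X} {D : X → Matrix (Fin n) (Fin n) ℝ} {b : X → Fin n → ℝ}
    (h : ∀ i j, ContDiffOn ℝ ∞ (fun x => D x i j) s) (hb : ∀ i, ContDiffOn ℝ ∞ (fun x => b x i) s)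
    (hdet : ∀ x ∈ s, (D x).det ≠ 0) (i : Fin n) :
    ContDiffOn ℝ ∞ (fun x => ((D x)⁻¹.mulVec (b x)) i) s := by
  have e : ∀ x ∈ s, ((D x)⁻¹.mulVec (b x)) i = ((D x).updateCol i (b x)).det / (D x).det := by
    intro x hx
    have h1 := congrFun (Matrix.det_smul_inv_mulVec_eq_cramer (D x) (b x)
      (isUnit_iff_ne_zero.2 (hdet x hx))) i
    rw [Matrix.cramer_apply, Pi.smul_apply, smul_eq_mul] at h1
    rw [eq_div_iff (hdet x hx), ← h1, mul_comm]
  refine ContDiffOn.congr (f := fun x => ((D x).updateCol i (b x)).det / (D x).det) ?_ e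
  refine (contDiffOn_det fun k j => ?_).div (contDiffOn_det h) hdet
  simp only [Matrix.updateCol_apply]
  split_ifs
  · exact hb k
  · exact h k j

end Cramer

/-! ### The radiation source solved for the moment variables -/

section RadiationSource

variable {N : ℕ}

/-- The vector `D̃(w)⁻¹ g((1 - ω^{[α]}) / α)`. -/
noncomputable def response (w : Fin (N + 1) → ℝ) : Fin (N + 1) → ℝ :=
  (matD w)⁻¹.mulVec fun i => projCoeff (w 1) i fun μ => weightDefect (w 1, μ)

/-- Writing `b / 2` as `b / 2 (mode 0 + α weightDefect)` turns the source into a combination of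
basis functions plus an `α`-multiple of the defect. The combination is `D̃` times its own
coefficients: the exceptional column `1` is never used, as `coeff w 1 = 0`. -/
lemma inv_matD_mulVec_source (hN : 1 ≤ N) {w : Fin (N + 1) → ℝ} (hw : w 1 ∈ Ioo (-1 : ℝ) 1)
    (hdet : (matD w).det ≠ 0) (c b : ℝ) (i : Fin (N + 1)) :
    ((matD w)⁻¹.mulVec fun i => projCoeff (w 1) i fun μ => c * (b / 2 - ansatz w μ)) i =
      c * (b / 2 * ((if i = 0 then 1 else 0) + w 1 * response w i) - coeff w i) := by
  set d : Fin (N + 1) → ℝ := fun i => projCoeff (w 1) i fun μ => weightDefect (w 1, μ)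
  have hcont : ∀ {K : ℝ × ℝ → ℝ}, ContDiffOn ℝ ∞ K weightDomain →
    ContinuousOn (fun μ => K (w 1, μ)) (Icc (-1) 1) := fun hK =>
      continuousOn_slice hK.continuousOn hw
  have hvec : (fun i : Fin (N + 1) => projCoeff (w 1) i fun μ => c * (b / 2 - ansatz w μ)) =
      (matD w).mulVec (fun j => c * (b / 2 * (if j = 0 then 1 else 0) - coeff w j)) +
        (c * (b / 2) * w 1) • d := by
    funext i
    have h1 : EqOn (fun μ => c * (b / 2 - ansatz w μ))
        (fun μ => (c * (b / 2) * mode 0 (w 1, μ) + c * (b / 2) * w 1 * weightDefect (w 1, μ)) +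
          -c * ∑ k : Fin (N + 1), coeff w k * mode k (w 1, μ)) (Icc (-1) 1) := by
      intro μ hμ
      have := mode_zero_add_weightDefect (mem_weightDomain hw hμ)
      simp only [ansatz_eq]
      linear_combination (-(c * (b / 2))) * this
    rw [projCoeff_congr h1, projCoeff_add, projCoeff_add, projCoeff_const_mul, projCoeff_const_mul,
      projCoeff_const_mul, projCoeff_sum]
    · simp only [Pi.add_apply, Pi.smul_apply, smul_eq_mul, Matrix.mulVec, dotProduct, d]
      have h2 : ∀ j : Fin (N + 1), matD w i j *
          (c * (b / 2 * (if j = 0 then 1 else 0) - coeff w j)) =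
          (if j = 0 then c * (b / 2) * projCoeff (w 1) i (fun μ => mode 0 (w 1, μ)) else 0) +
            -c * (coeff w j * projCoeff (w 1) i (fun μ => mode j (w 1, μ))) := by
        intro j
        rw [matD_apply hw]
        by_cases hj : j = 1
        · subst hj
          simp [coeff, fin_one_ne_zero hN]
        · rw [if_neg hj]
          by_cases hj0 : j = 0
          · subst hj0
            simp
            ring
          · simp [hj0]
            ring
      simp only [h2, Finset.sum_add_distrib, Finset.sum_ite_eq', Finset.mem_univ, if_true,
        ← Finset.mul_sum]
      ring
    · exact fun k => hcont (contDiffOn_mode k)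
    · exact continuousOn_const.mul (hcont (contDiffOn_mode 0))
    · exact continuousOn_const.mul (hcont contDiffOn_weightDefect)
    · exact (continuousOn_const.mul (hcont (contDiffOn_mode 0))).add
        (continuousOn_const.mul (hcont contDiffOn_weightDefect))
    · exact continuousOn_const.mul (continuousOn_finsetSum _ fun k _ =>
        continuousOn_const.mul (hcont (contDiffOn_mode k)))
  rw [hvec, Matrix.mulVec_add, Matrix.mulVec_mulVec,
    Matrix.nonsing_inv_mul _ (isUnit_iff_ne_zero.2 hdet), Matrix.one_mulVec, Matrix.mulVec_smul]
  simp only [Pi.add_apply, Pi.smul_apply, smul_eq_mul, response, d]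
  ring

lemma contDiffOn_response (i : Fin (N + 1)) :
    ContDiffOn ℝ ∞ (fun w : Fin (N + 1) → ℝ => response w i)
      {w | w 1 ∈ Ioo (-1 : ℝ) 1 ∧ (matD w).det ≠ 0} := by
  have hsub : {w : Fin (N + 1) → ℝ | w 1 ∈ Ioo (-1 : ℝ) 1 ∧ (matD w).det ≠ 0} ⊆
    {w | w 1 ∈ Ioo (-1 : ℝ) 1} := fun w hw => hw.1
  refine contDiffOn_inv_mulVec (fun i j => (contDiffOn_matD i j).mono hsub) (fun i => ?_)
    (fun w hw => hw.2) i
  exact (contDiffOn_projCoeff contDiffOn_weightDefect i).comp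
    (f := fun w : Fin (N + 1) → ℝ => w 1) (ContDiff.contDiffOn (by fun_prop)) fun w hw => hw.1

lemma det_matD_isotropic (hN : 1 ≤ N) {w : Fin (N + 1) → ℝ} (hw : ∀ k, k ≠ 0 → w k = 0)
    (h0 : w 0 ≠ 0) : (matD w).det ≠ 0 := by
  rw [matD_isotropic hN hw, Matrix.det_diagonal, Finset.prod_ne_zero_iff]
  intro i _
  split_ifs
  · simpa using h0
  · exact one_ne_zero

/-- At `α = 0` the defect is `4 μ` and column `1` of `D̃` belongs to `-4 (w 0) μ`; their ratio is
`-1 / w 0`. -/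
lemma response_isotropic (hN : 1 ≤ N) {w : Fin (N + 1) → ℝ} (hw : ∀ k, k ≠ 0 → w k = 0)
    (h0 : w 0 ≠ 0) (i : Fin (N + 1)) : response w i = if i = 1 then -1 / w 0 else 0 := by
  have hdet := det_matD_isotropic hN hw h0
  have h1 : w 1 = 0 := hw 1 (fin_one_ne_zero hN)
  have hval : ∀ i : Fin (N + 1), (i : ℕ) = 1 ↔ i = 1 := fun i => by
    rw [Fin.ext_iff, fin_val_one hN]
  have hd : (fun i : Fin (N + 1) => projCoeff (w 1) i fun μ => weightDefect (w 1, μ)) =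
      (matD w).mulVec fun i => if i = 1 then -1 / w 0 else 0 := by
    funext i
    rw [matD_isotropic hN hw, Matrix.mulVec_diagonal, h1]
    have : (fun μ => weightDefect (0, μ)) = fun μ => 4 * μ := by
      funext μ; simp [weightDefect, weight]
    rw [this, projCoeff_zero_id]
    simp only [hval]
    split_ifs
    · field_simp
    · simp
  rw [response, hd, Matrix.mulVec_mulVec, Matrix.nonsing_inv_mul _ (isUnit_iff_ne_zero.2 hdet),
    Matrix.one_mulVec]

end RadiationSource

/-! ### The temperature as a function of the fluid state -/

section Temperature

variable {M : Medium}

/-- The fluid states with a well-defined temperature. -/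
def Medium.fluidDomain (M : Medium) : Set (Fin 3 → ℝ) :=
  {u | u ∈ {u : Fin 3 → ℝ | 0 < u 0} ∧ ∃ θ > 0, M.e (u 0) θ - internalEnergy u = 0}

lemma isOpen_density_pos : IsOpen {u : Fin 3 → ℝ | 0 < u 0} :=
  isOpen_lt continuous_const (continuous_apply 0)

lemma contDiffOn_energyEq (hM : M.Admissible) :
    ContDiffOn ℝ ∞ (fun p : (Fin 3 → ℝ) × ℝ => M.e (p.1 0) p.2 - internalEnergy p.1)
      ({u : Fin 3 → ℝ | 0 < u 0} ×ˢ Ioi 0) := by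
  refine ContDiffOn.sub ?_ ?_
  · exact hM.e_smooth.comp (f := fun p : (Fin 3 → ℝ) × ℝ => (p.1 0, p.2))
      (ContDiff.contDiffOn (by fun_prop)) fun p hp => ⟨hp.1, hp.2⟩
  · unfold internalEnergy
    have h0 : ∀ p ∈ ({u : Fin 3 → ℝ | 0 < u 0} ×ˢ Ioi (0 : ℝ)), p.1 0 ≠ 0 := fun p hp =>
      (show 0 < p.1 0 from hp.1).ne'
    refine ContDiffOn.sub (ContDiffOn.div ?_ ?_ h0)
      (ContDiffOn.div_const ((ContDiffOn.div ?_ ?_ h0).pow 2) 2) <;>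
    exact ContDiff.contDiffOn (by fun_prop)

lemma deriv_energyEq_pos (hM : M.Admissible) : ∀ u ∈ {u : Fin 3 → ℝ | 0 < u 0}, ∀ θ > 0,
    0 < deriv (fun t => M.e (u 0) t - internalEnergy u) θ := fun u hu θ hθ => by
  rw [deriv_sub_const]
  exact hM.e_deriv_pos _ hu θ hθ

lemma isOpen_fluidDomain (hM : M.Admissible) : IsOpen M.fluidDomain :=
  isOpen_root isOpen_density_pos (contDiffOn_energyEq hM) (deriv_energyEq_pos hM)

lemma temp_spec {u : Fin 3 → ℝ} (h : ∃ θ > 0, M.e (u 0) θ - internalEnergy u = 0) :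
    0 < M.temp u ∧ M.e (u 0) (M.temp u) - internalEnergy u = 0 := by
  obtain ⟨θ, hθ, he⟩ := h
  have h' : ∃ θ ∈ Ioi (0 : ℝ), M.e (u 0) θ = internalEnergy u := ⟨θ, hθ, sub_eq_zero.1 he⟩
  exact ⟨Function.invFunOn_mem h', sub_eq_zero.2 (Function.invFunOn_eq h')⟩

lemma contDiffAt_temp (hM : M.Admissible) {u : Fin 3 → ℝ} (hu : u ∈ M.fluidDomain) :
    ContDiffAt ℝ ∞ M.temp u :=
  contDiffAt_root isOpen_density_pos (contDiffOn_energyEq hM) (deriv_energyEq_pos hM)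
    (fun _ _ h => temp_spec h) hu.1 hu.2

/-- The response of the temperature to an energy source. -/
lemma fderiv_temp (hM : M.Admissible) {u : Fin 3 → ℝ} (hu : u ∈ M.fluidDomain) (x : ℝ) :
    fderiv ℝ M.temp u ![0, 0, x] = x / (u 0 * deriv (M.e (u 0)) (M.temp u)) := by
  have hspec := temp_spec hu.2
  have hu0 : 0 < u 0 := hu.1
  have he := hM.e_deriv_pos _ hu0 _ hspec.1
  obtain ⟨d, hd⟩ : ∃ d : Fin 3 → ℝ, d = ![0, 0, x] := ⟨_, rfl⟩
  rw [← hd]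
  have d0 : d 0 = 0 := by simp [hd]
  have d1 : d 1 = 0 := by simp [hd]
  have d2 : d 2 = x := by simp [hd]
  set γ : ℝ → Fin 3 → ℝ := fun s => u + s • d
  have hγ0 : γ 0 = u := by simp [γ]
  have hγ : HasDerivAt γ d 0 := by
    exact (((hasDerivAt_id (0 : ℝ)).smul_const d).const_add u).congr_deriv (one_smul ℝ d)
  have hT : HasDerivAt (fun s => M.temp (γ s)) (fderiv ℝ M.temp u d) 0 := by
    have h1 : HasFDerivAt M.temp (fderiv ℝ M.temp u) (γ 0) := by
      rw [hγ0]
      exact ((contDiffAt_temp hM hu).differentiableAt (by simp)).hasFDerivAt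
    exact h1.comp_hasDerivAt 0 hγ
  have hE : HasDerivAt (fun s => M.e (u 0) (M.temp (γ s)))
      (deriv (M.e (u 0)) (M.temp u) * fderiv ℝ M.temp u d) 0 := by
    have h1 : HasDerivAt (M.e (u 0)) (deriv (M.e (u 0)) (M.temp u)) (M.temp (γ 0)) := by
      rw [hγ0]
      exact (differentiableAt_of_deriv_ne_zero he.ne').hasDerivAt
    exact h1.comp 0 hT
  have hI : HasDerivAt (fun s => u 2 / u 0 + s * (x / u 0) - (u 1 / u 0) ^ 2 / 2) (x / u 0) 0 := by
    simpa using (((hasDerivAt_id (0 : ℝ)).mul_const (x / u 0)).const_add (u 2 / u 0)).sub_const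
      ((u 1 / u 0) ^ 2 / 2)
  -- Along a line varying only `ρE`, the energy equation persists near `s = 0` because the fluid
  -- domain is open; its two sides are differentiated.
  have hev : (fun s => M.e (u 0) (M.temp (γ s))) =ᶠ[nhds 0]
      fun s => u 2 / u 0 + s * (x / u 0) - (u 1 / u 0) ^ 2 / 2 := by
    have h1 : ∀ᶠ s in nhds (0 : ℝ), γ s ∈ M.fluidDomain :=
      hγ.continuousAt.eventually_mem (by rw [hγ0]; exact (isOpen_fluidDomain hM).mem_nhds hu)
    filter_upwards [h1] with s hs
    have h2 := sub_eq_zero.1 (temp_spec hs.2).2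
    have e0 : γ s 0 = u 0 := by simp [γ, d0]
    have e1 : γ s 1 = u 1 := by simp [γ, d1]
    have e2 : γ s 2 = u 2 + s * x := by simp [γ, d2]
    rw [e0] at h2
    rw [h2, internalEnergy, e0, e1, e2]
    ring
  have h3 := hE.unique (hI.congr_of_eventuallyEq hev)
  field_simp at h3 ⊢
  linarith

end Temperature

/-! ### Inverting the change of variables at `ε = 0` -/

section TransformedTemperature

variable {M : Medium} {N : ℕ}

/-- The equation for the temperature in the transformed variables (at `ε = 0`). -/
noncomputable def Medium.tempEq (M : Medium) {N : ℕ} (p : State N × ℝ) : ℝ :=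
  p.1.1 0 * M.e (p.1.1 0) p.2 + M.b p.2 - (p.1.1 2 - p.1.2 0 - p.1.1 1 ^ 2 / (2 * p.1.1 0))

/-- The temperature in the transformed variables (at `ε = 0`). -/
noncomputable def Medium.tempT (M : Medium) {N : ℕ} (V : State N) : ℝ :=
  Function.invFunOn (fun θ => M.tempEq (V, θ)) (Ioi 0) 0

lemma isOpen_density_pos' : IsOpen {V : State N | 0 < V.1 0} :=
  isOpen_lt continuous_const ((continuous_apply 0).comp continuous_fst)

lemma contDiffOn_tempEq (hM : M.Admissible) :
    ContDiffOn ℝ ∞ (M.tempEq (N := N)) ({V : State N | 0 < V.1 0} ×ˢ Ioi 0) := by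
  unfold Medium.tempEq
  have h0 : ∀ p ∈ ({V : State N | 0 < V.1 0} ×ˢ Ioi (0 : ℝ)), 2 * p.1.1 0 ≠ 0 := fun p hp =>
    (mul_pos two_pos (show 0 < p.1.1 0 from hp.1)).ne'
  have he : ContDiffOn ℝ ∞ (fun p : State N × ℝ => M.e (p.1.1 0) p.2)
      ({V : State N | 0 < V.1 0} ×ˢ Ioi 0) :=
    hM.e_smooth.comp (f := fun p : State N × ℝ => (p.1.1 0, p.2))
      (ContDiff.contDiffOn (by fun_prop)) fun p hp => ⟨hp.1, hp.2⟩
  have hb : ContDiffOn ℝ ∞ (fun p : State N × ℝ => M.b p.2)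
      ({V : State N | 0 < V.1 0} ×ˢ Ioi 0) :=
    hM.b_smooth.comp (f := fun p : State N × ℝ => p.2) contDiffOn_snd fun p hp => hp.2
  refine ((ContDiffOn.mul ?_ he).add hb).sub (ContDiffOn.sub ?_ (ContDiffOn.div ?_ ?_ h0)) <;>
  exact ContDiff.contDiffOn (by fun_prop)

/-- Substituting `ρE = ũ₂ - κ₀₀ f₀` and `κ₀₀ f₀ = w̃₀ + b(θ)` into `ρ` times the energy equation
puts `b` beside `ρ e` with the same sign, so both are increasing in `θ`. -/
lemma deriv_tempEq_pos (hM : M.Admissible) : ∀ V ∈ {V : State N | 0 < V.1 0}, ∀ θ > 0,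
    0 < deriv (fun t => M.tempEq (V, t)) θ := fun V hV θ hθ => by
  have he := hM.e_deriv_pos _ hV θ hθ
  have hb := hM.b_deriv_pos θ hθ
  have h1 : HasDerivAt (fun t => M.tempEq (V, t)) (V.1 0 * deriv (M.e (V.1 0)) θ + deriv M.b θ) θ :=
    (((differentiableAt_of_deriv_ne_zero he.ne').hasDerivAt.const_mul (V.1 0)).fun_add
      (differentiableAt_of_deriv_ne_zero hb.ne').hasDerivAt).sub_const
      (V.1 2 - V.2 0 - V.1 1 ^ 2 / (2 * V.1 0))
  rw [h1.deriv]
  exact add_pos (mul_pos hV he) hb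

lemma tempT_spec {V : State N} (h : ∃ θ > 0, M.tempEq (V, θ) = 0) :
    0 < M.tempT V ∧ M.tempEq (V, M.tempT V) = 0 := by
  have h' : ∃ θ ∈ Ioi (0 : ℝ), (fun θ => M.tempEq (V, θ)) θ = 0 := h
  exact ⟨Function.invFunOn_mem h', Function.invFunOn_eq h'⟩

/-- An explicit description of the transformed state space at `ε = 0`. -/
def Medium.tildeDomain (M : Medium) (N : ℕ) : Set (State N) :=
  {V | V ∈ {V : State N | 0 < V.1 0} ∧ ∃ θ > 0, M.tempEq (V, θ) = 0} ∩
    {V | V.2 1 ∈ Ioo (-1 : ℝ) 1}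

lemma isOpen_tildeDomain (hM : M.Admissible) : IsOpen (M.tildeDomain N) :=
  (isOpen_root isOpen_density_pos' (contDiffOn_tempEq hM) (deriv_tempEq_pos hM)).inter
    (isOpen_Ioo.preimage ((continuous_apply 1).comp continuous_snd))

lemma contDiffOn_tempT (hM : M.Admissible) : ContDiffOn ℝ ∞ M.tempT (M.tildeDomain N) :=
  fun _ hV => (contDiffAt_root isOpen_density_pos' (contDiffOn_tempEq hM) (deriv_tempEq_pos hM)
    (fun _ _ h => tempT_spec h) hV.1.1 hV.1.2).contDiffWithinAt

lemma tempT_pos {V : State N} (hV : V ∈ M.tildeDomain N) : 0 < M.tempT V := (tempT_spec hV.1.2).1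

/-- The explicit inverse of the change of variables at `ε = 0`. -/
noncomputable def Medium.liftState (M : Medium) {N : ℕ} (V : State N) : State N :=
  (![V.1 0, V.1 1, V.1 2 - V.2 0 - M.b (M.tempT V)],
    Function.update V.2 0 ((V.2 0 + M.b (M.tempT V)) / kappa (weight (V.2 1)) 0 0))

lemma tempEq_eq (V : State N) (hV : 0 < V.1 0) : M.tempEq (V, M.tempT V) =
    V.1 0 * (M.e (V.1 0) (M.tempT V) - internalEnergy (M.liftState V).1) := by
  simp only [Medium.tempEq, internalEnergy, Medium.liftState, Matrix.cons_val]
  field_simp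
  ring

lemma liftState_root {V : State N} (hV : V ∈ M.tildeDomain N) :
    M.e (V.1 0) (M.tempT V) - internalEnergy (M.liftState V).1 = 0 := by
  have h0 : 0 < V.1 0 := hV.1.1
  have h1 := (tempT_spec hV.1.2).2
  rw [tempEq_eq V h0] at h1
  exact (mul_eq_zero.1 h1).resolve_left h0.ne'

lemma liftState_mem_fluidDomain {V : State N} (hV : V ∈ M.tildeDomain N) :
    (M.liftState V).1 ∈ M.fluidDomain :=
  ⟨hV.1.1, M.tempT V, tempT_pos hV, liftState_root hV⟩

lemma temp_liftState (hM : M.Admissible) {V : State N} (hV : V ∈ M.tildeDomain N) :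
    M.temp (M.liftState V).1 = M.tempT V := by
  have h := temp_spec (liftState_mem_fluidDomain hV).2
  refine root_unique (deriv_energyEq_pos hM (M.liftState V).1 hV.1.1) h.1 (tempT_pos hV) ?_
  exact h.2.trans (liftState_root hV).symm

lemma liftState_one (hN : 1 ≤ N) (V : State N) : (M.liftState V).2 1 = V.2 1 :=
  Function.update_of_ne (fin_one_ne_zero hN) _ _

lemma liftState_mem_G (hN : 1 ≤ N) {V : State N} (hV : V ∈ M.tildeDomain N) :
    M.liftState V ∈ M.G N := by
  refine ⟨hV.1.1, ⟨M.tempT V, tempT_pos hV, sub_eq_zero.1 (liftState_root hV)⟩, ?_⟩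
  rw [liftState_one hN]
  exact hV.2

lemma kappa_mul_liftState {V : State N} (hV : V ∈ M.tildeDomain N) :
    kappa (weight (V.2 1)) 0 0 * (M.liftState V).2 0 = V.2 0 + M.b (M.tempT V) := by
  have h1 : kappa (weight (V.2 1)) 0 0 ≠ 0 := (kappa_powerWeight_pos 4 0 hV.2).ne'
  simp only [Medium.liftState, Function.update_self]
  field_simp

lemma toTilde_liftState (hM : M.Admissible) (hN : 1 ≤ N) {V : State N}
    (hV : V ∈ M.tildeDomain N) : M.toTilde 0 (M.liftState V) = V := by
  have h1 := kappa_mul_liftState hV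
  refine Prod.ext ?_ ?_
  · funext i
    simp only [Medium.toTilde, liftState_one hN, h1]
    fin_cases i <;> simp [Medium.liftState]
  · funext i
    simp only [Medium.toTilde, liftState_one hN, h1, temp_liftState hM hV]
    by_cases hi : i = 0
    · subst hi; simp
    · simp [Medium.liftState, hi]

lemma toTilde_mem_tildeDomain (hN : 1 ≤ N) {U : State N} (hU : U ∈ M.G N) :
    M.toTilde 0 U ∈ M.tildeDomain N ∧ M.tempEq (M.toTilde 0 U, M.temp U.1) = 0 := by
  obtain ⟨h0, ⟨θ, hθ, he⟩, h1⟩ := hU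
  have hs := temp_spec ⟨θ, hθ, sub_eq_zero.2 he⟩
  have hroot : M.tempEq (M.toTilde 0 U, M.temp U.1) = 0 := by
    have h2 := sub_eq_zero.1 hs.2
    simp only [Medium.tempEq, Medium.toTilde, Matrix.cons_val, Function.update_self]
    rw [h2, internalEnergy]
    field_simp
    ring
  refine ⟨⟨⟨h0, M.temp U.1, hs.1, hroot⟩, ?_⟩, hroot⟩
  have h3 : (M.toTilde 0 U).2 1 = U.2 1 := Function.update_of_ne (fin_one_ne_zero hN) _ _
  change (M.toTilde 0 U).2 1 ∈ Ioo (-1 : ℝ) 1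
  rw [h3]
  exact h1

lemma GTilde_eq (hM : M.Admissible) (hN : 1 ≤ N) : M.GTilde N 0 = M.tildeDomain N := by
  ext V
  constructor
  · rintro ⟨U, hU, rfl⟩
    exact (toTilde_mem_tildeDomain hN hU).1
  · intro hV
    exact ⟨M.liftState V, liftState_mem_G hN hV, toTilde_liftState hM hN hV⟩

/-- Injectivity of the change of variables on `G`; it identifies the inverse chosen in `ofTilde`
with the explicit one. -/
lemma eq_liftState (hM : M.Admissible) (hN : 1 ≤ N) {U : State N} (hU : U ∈ M.G N) :
    U = M.liftState (M.toTilde 0 U) := by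
  obtain ⟨hV, hroot⟩ := toTilde_mem_tildeDomain hN hU
  obtain ⟨h0, ⟨θ, hθ, he⟩, h1⟩ := hU
  have hs := temp_spec ⟨θ, hθ, sub_eq_zero.2 he⟩
  have hT : M.tempT (M.toTilde 0 U) = M.temp U.1 :=
    root_unique (deriv_tempEq_pos hM _ hV.1.1) (tempT_pos hV) hs.1
      ((tempT_spec hV.1.2).2.trans hroot.symm)
  have h3 : (M.toTilde 0 U).2 1 = U.2 1 := Function.update_of_ne (fin_one_ne_zero hN) _ _
  have hk : kappa (weight (U.2 1)) 0 0 ≠ 0 := (kappa_powerWeight_pos 4 0 h1).ne'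
  refine Prod.ext ?_ ?_
  · funext i
    simp only [Medium.liftState, hT]
    fin_cases i
    · simp [Medium.toTilde]
    · simp [Medium.toTilde]
    · simp [Medium.toTilde]
      ring
  · funext i
    simp only [Medium.liftState, hT, h3]
    by_cases hi : i = 0
    · subst hi
      simp [Medium.toTilde, hk]
    · simp [Medium.toTilde, hi]

lemma ofTilde_eq (hM : M.Admissible) (hN : 1 ≤ N) {V : State N} (hV : V ∈ M.tildeDomain N) :
    M.ofTilde 0 V = M.liftState V := by
  have h : ∃ U ∈ M.G N, M.toTilde 0 U = V :=
    ⟨M.liftState V, liftState_mem_G hN hV, toTilde_liftState hM hN hV⟩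
  have h1 : M.ofTilde 0 V ∈ M.G N := Function.invFunOn_mem h
  have h2 : M.toTilde 0 (M.ofTilde 0 V) = V := Function.invFunOn_eq h
  rw [eq_liftState hM hN h1, h2]

end TransformedTemperature

variable {M : Medium} {N : ℕ}

lemma differentiableAt_kappa {α : ℝ} (hα : α ∈ Ioo (-1 : ℝ) 1) (j k : ℕ) :
    DifferentiableAt ℝ (fun α => kappa (weight α) j k) α :=
  ((contDiffOn_kappa 4 j k).contDiffAt (isOpen_Ioo.mem_nhds hα)).differentiableAt (by simp)

/-! ### The transformed source as damping plus multiples of `α` -/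

section TransformedSource

lemma hasFDerivAt_deviation (hM : M.Admissible) {U : State N} (hu : U.1 ∈ M.fluidDomain)
    (hα : U.2 1 ∈ Ioo (-1 : ℝ) 1) :
    HasFDerivAt (fun U : State N => kappa (weight (U.2 1)) 0 0 * U.2 0 - M.b (M.temp U.1))
      ((kappa (weight (U.2 1)) 0 0 •
          (ContinuousLinearMap.proj (R := ℝ) (φ := fun _ => ℝ) 0 ∘L .snd ℝ _ _) +
        U.2 0 • (deriv (fun α => kappa (weight α) 0 0) (U.2 1) •
          (ContinuousLinearMap.proj (R := ℝ) (φ := fun _ => ℝ) 1 ∘L .snd ℝ _ _))) -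
        deriv M.b (M.temp U.1) • (fderiv ℝ M.temp U.1 ∘L .fst ℝ _ _)) U := by
  have hp : ∀ k : Fin (N + 1), HasFDerivAt (fun U : State N => U.2 k)
      (ContinuousLinearMap.proj (R := ℝ) (φ := fun _ => ℝ) k ∘L .snd ℝ _ _) U := fun k =>
    (ContinuousLinearMap.proj (R := ℝ) (φ := fun _ => ℝ) k ∘L
      ContinuousLinearMap.snd ℝ (Fin 3 → ℝ) (Fin (N + 1) → ℝ)).hasFDerivAt
  have hk : HasFDerivAt (fun U : State N => kappa (weight (U.2 1)) 0 0) _ U :=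
    (differentiableAt_kappa hα 0 0).hasDerivAt.comp_hasFDerivAt (f := fun U : State N => U.2 1) U
      (hp 1)
  have hT : HasFDerivAt (fun U : State N => M.temp U.1) (fderiv ℝ M.temp U.1 ∘L .fst ℝ _ _) U :=
    ((contDiffAt_temp hM hu).differentiableAt (by simp)).hasFDerivAt.comp U hasFDerivAt_fst
  have hb : HasFDerivAt (fun U : State N => M.b (M.temp U.1)) _ U :=
    (differentiableAt_of_deriv_ne_zero
      (hM.b_deriv_pos _ (temp_spec hu.2).1).ne').hasDerivAt.comp_hasFDerivAt
      (f := fun U : State N => M.temp U.1) U hT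
  exact (hk.fun_mul (hp 0)).fun_sub hb

lemma differentiableAt_toTilde (hM : M.Admissible) {U : State N} (hu : U.1 ∈ M.fluidDomain)
    (hα : U.2 1 ∈ Ioo (-1 : ℝ) 1) : DifferentiableAt ℝ (M.toTilde 0 : State N → State N) U := by
  have hp : ∀ k : Fin (N + 1), DifferentiableAt ℝ (fun U : State N => U.2 k) U := fun k => by
    fun_prop
  have hk : ∀ j, DifferentiableAt ℝ (fun U : State N => kappa (weight (U.2 1)) j 0) U := fun j =>
    (differentiableAt_kappa hα j 0).comp (f := fun U : State N => U.2 1) U (hp 1)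
  unfold Medium.toTilde
  refine DifferentiableAt.prodMk (differentiableAt_pi.2 fun i => ?_)
    (differentiableAt_pi.2 fun i => ?_)
  · fin_cases i
    · simp
      fun_prop
    · simp
      fun_prop
    · have := (hk 0).mul (hp 0)
      simp
      exact DifferentiableAt.add (by fun_prop) this
  · by_cases hi : i = 0
    · subst hi
      simp only [Function.update_self]
      exact (hasFDerivAt_deviation hM hu hα).differentiableAt
    · simp only [ne_eq, hi, not_false_eq_true, Function.update_of_ne]
      exact hp i

lemma fderiv_toTilde_apply (hM : M.Admissible) {U : State N} (hu : U.1 ∈ M.fluidDomain)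
    (hα : U.2 1 ∈ Ioo (-1 : ℝ) 1) (X : State N) (i : Fin (N + 1)) :
    (fderiv ℝ (M.toTilde 0) U X).2 i = if i = 0 then
      kappa (weight (U.2 1)) 0 0 * X.2 0 +
        U.2 0 * (deriv (fun α => kappa (weight α) 0 0) (U.2 1) * X.2 1) -
        deriv M.b (M.temp U.1) * fderiv ℝ M.temp U.1 X.1
      else X.2 i := by
  set π : State N →L[ℝ] ℝ := ContinuousLinearMap.proj (R := ℝ) (φ := fun _ => ℝ) i ∘L
    ContinuousLinearMap.snd ℝ (Fin 3 → ℝ) (Fin (N + 1) → ℝ)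
  have h1 : HasFDerivAt (fun U : State N => (M.toTilde 0 U).2 i)
      (π ∘L fderiv ℝ (M.toTilde 0) U) U :=
    π.hasFDerivAt.comp U (differentiableAt_toTilde hM hu hα).hasFDerivAt
  have h2 : (fderiv ℝ (M.toTilde 0) U X).2 i = (π ∘L fderiv ℝ (M.toTilde 0) U) X := rfl
  rw [h2]
  split_ifs with hi
  · subst hi
    have h3 : (fun U : State N => (M.toTilde 0 U).2 0) =
        fun U => kappa (weight (U.2 1)) 0 0 * U.2 0 - M.b (M.temp U.1) := by
      funext U; simp [Medium.toTilde]
    rw [h3] at h1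
    rw [h1.unique (hasFDerivAt_deviation hM hu hα)]
    simp
  · have h3 : (fun U : State N => (M.toTilde 0 U).2 i) = π := by
      funext U; simp [Medium.toTilde, hi, π]
    rw [h3] at h1
    rw [h1.unique π.hasFDerivAt]
    rfl

lemma Q_zero_eq (U : State N) : M.Q 0 U =
    (![0, 0, U.1 0 * M.σa (M.temp U.1) *
        (kappa (weight (U.2 1)) 0 0 * U.2 0 - M.b (M.temp U.1))],
      (matD U.2)⁻¹.mulVec fun i => projCoeff (U.2 1) i fun μ =>
        U.1 0 * M.σa (M.temp U.1) * (M.b (M.temp U.1) / 2 - ansatz U.2 μ)) := by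
  have h : (M.scaledSource 0 U) = fun μ =>
      U.1 0 * M.σa (M.temp U.1) * (M.b (M.temp U.1) / 2 - ansatz U.2 μ) := by
    funext μ
    simp only [Medium.scaledSource]
    ring
  simp [Medium.Q, h]

/-- The states in the transformed variables at which `D̃` is invertible. -/
def Medium.regularDomain (M : Medium) (N : ℕ) : Set (State N) :=
  {V | V ∈ M.tildeDomain N ∧ (matD (M.liftState V).2).det ≠ 0}

/-- The absorption rate `ρ σ_a(θ)` in the transformed variables. -/
noncomputable def Medium.rate (M : Medium) (V : State N) : ℝ := V.1 0 * M.σa (M.tempT V)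

/-- The diagonal coefficients of the transformed source. -/
noncomputable def Medium.diagCoeff (M : Medium) (V : State N) (i : Fin (N + 1)) : ℝ :=
  -M.rate V * (1 + if i = 0 then
    deriv M.b (M.tempT V) / (V.1 0 * deriv (M.e (V.1 0)) (M.tempT V)) else 0)

/-- The coefficients of `α` in the transformed source. -/
noncomputable def Medium.alphaCoeff (M : Medium) (V : State N) (i : Fin (N + 1)) : ℝ :=
  if i = 0 then M.rate V * (M.b (M.tempT V) / 2) *
      ((M.liftState V).2 0 * deriv (fun α => kappa (weight α) 0 0) (V.2 1) *
          response (M.liftState V).2 1 -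
        (∫ μ in (-1 : ℝ)..1, weightDefect (V.2 1, μ)) +
        kappa (weight (V.2 1)) 0 0 * response (M.liftState V).2 0)
  else M.rate V * (M.b (M.tempT V) / 2 * response (M.liftState V).2 i + if i = 1 then 1 else 0)

/-- For `i ≠ 0` this is the solved radiation source; at `i = 1`, where it has no damping term,
`-rate` is added in `diagCoeff` and removed in `alphaCoeff`. Entry `0` also contains the variation
of `κ₀₀(α)` and, with factor `b'`, the heating of the fluid. -/
lemma q_eq (hM : M.Admissible) (hN : 1 ≤ N) {V : State N} (hV : V ∈ M.regularDomain N)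
    (i : Fin (N + 1)) :
    M.q V.1 V.2 0 i = M.diagCoeff V i * V.2 i + M.alphaCoeff V i * V.2 1 := by
  obtain ⟨hT, hdet⟩ := hV
  have hu := liftState_mem_fluidDomain hT
  have hα : (M.liftState V).2 1 ∈ Ioo (-1 : ℝ) 1 := by rw [liftState_one hN]; exact hT.2
  have h10 := fin_one_ne_zero hN
  have hV0 : (M.liftState V).1 0 = V.1 0 := rfl
  have hk := kappa_mul_liftState hT
  have hcoeff : ∀ k, coeff (M.liftState V).2 k =
      if k = 1 then 0 else if k = 0 then (M.liftState V).2 0 else V.2 k := by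
    intro k
    unfold coeff
    split_ifs with h1 h2
    · rfl
    · rw [h2]
    · simp [Medium.liftState, h2]
  have hrad : ∀ k, (M.Q 0 (M.liftState V)).2 k = M.rate V * (M.b (M.tempT V) / 2 *
      ((if k = 0 then 1 else 0) + V.2 1 * response (M.liftState V).2 k) -
      if k = 1 then 0 else if k = 0 then (M.liftState V).2 0 else V.2 k) := by
    intro k
    rw [Q_zero_eq, ← hcoeff, Medium.rate]
    simp only [temp_liftState hM hT, hV0]
    rw [inv_matD_mulVec_source hN hα hdet, liftState_one hN]
  have hfl : (M.Q 0 (M.liftState V)).1 = ![0, 0, M.rate V * V.2 0] := by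
    rw [Q_zero_eq]
    simp only [temp_liftState hM hT, hV0, liftState_one hN, hk, Medium.rate]
    simp
  have hρ : V.1 0 ≠ 0 := (show 0 < V.1 0 from hT.1.1).ne'
  have he : deriv (M.e (V.1 0)) (M.tempT V) ≠ 0 :=
    (hM.e_deriv_pos _ hT.1.1 _ (tempT_pos hT)).ne'
  rw [Medium.q, Medium.QTilde, Prod.mk.eta, ofTilde_eq hM hN hT, fderiv_toTilde_apply hM hu hα]
  by_cases hi : i = 0
  · subst hi
    rw [if_pos rfl, hfl, fderiv_temp hM hu, hrad, hrad, temp_liftState hM hT, hV0,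
      liftState_one hN]
    simp only [if_true, if_neg h10, if_neg (Ne.symm h10), Medium.diagCoeff, Medium.alphaCoeff]
    have hk2 := kappa_zero_zero hT.2
    have hk3 : (2 - V.2 1 * ∫ μ in (-1 : ℝ)..1, weightDefect (V.2 1, μ)) * (M.liftState V).2 0 =
      V.2 0 + M.b (M.tempT V) := by rw [← hk2]; exact hk
    have hdiv : deriv M.b (M.tempT V) *
        (M.rate V * V.2 0 / (V.1 0 * deriv (M.e (V.1 0)) (M.tempT V))) =
        M.rate V * (deriv M.b (M.tempT V) / (V.1 0 * deriv (M.e (V.1 0)) (M.tempT V))) * V.2 0 := by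
      ring
    rw [hdiv]
    -- Two uses of `κ₀₀`: `κ₀₀ = 2 - α ∫ weightDefect` rewrites the emission, `κ₀₀ f₀ = w̃₀ + b` the
    -- absorption; the two terms `rate * b` then cancel.
    linear_combination (M.rate V * (M.b (M.tempT V) / 2)) * hk2 - M.rate V * hk
  · rw [if_neg hi, hrad]
    simp only [if_neg hi, Medium.diagCoeff, Medium.alphaCoeff]
    by_cases h1 : i = 1
    · subst h1
      simp
      ring
    · simp [h1]
      ring

end TransformedSource

/-! ### Smoothness of the source coefficients -/

section Smoothness

lemma contDiffOn_liftState (hM : M.Admissible) :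
    ContDiffOn ℝ ∞ (fun V : State N => (M.liftState V).2) (M.tildeDomain N) := by
  have hb : ContDiffOn ℝ ∞ (fun V : State N => M.b (M.tempT V)) (M.tildeDomain N) :=
    hM.b_smooth.comp (contDiffOn_tempT hM) fun V hV => tempT_pos hV
  have hk : ContDiffOn ℝ ∞ (fun V : State N => kappa (weight (V.2 1)) 0 0) (M.tildeDomain N) :=
    (contDiffOn_kappa 4 0 0).comp (f := fun V : State N => V.2 1)
      (ContDiff.contDiffOn (by fun_prop)) fun V hV => hV.2
  refine contDiffOn_pi.2 fun i => ?_
  unfold Medium.liftState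
  by_cases hi : i = 0
  · subst hi
    simp only [Function.update_self]
    exact ((ContDiff.contDiffOn (by fun_prop)).add hb).div hk
      fun V hV => (kappa_powerWeight_pos 4 0 hV.2).ne'
  · simp only [ne_eq, hi, not_false_eq_true, Function.update_of_ne]
    exact ContDiff.contDiffOn (by fun_prop)

lemma isOpen_regularDomain (hM : M.Admissible) (hN : 1 ≤ N) : IsOpen (M.regularDomain N) := by
  have h1 : ContinuousOn (fun V : State N => (matD (M.liftState V).2).det) (M.tildeDomain N) :=
    ((contDiffOn_det contDiffOn_matD).comp (contDiffOn_liftState hM) fun V hV => by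
      change (M.liftState V).2 1 ∈ Ioo (-1 : ℝ) 1
      rw [liftState_one hN]
      exact hV.2).continuousOn
  exact h1.isOpen_inter_preimage (isOpen_tildeDomain hM) isOpen_compl_singleton

lemma contDiffOn_response_liftState (hM : M.Admissible) (hN : 1 ≤ N) (i : Fin (N + 1)) :
    ContDiffOn ℝ ∞ (fun V : State N => response (M.liftState V).2 i) (M.regularDomain N) :=
  (contDiffOn_response i).comp ((contDiffOn_liftState hM).mono fun _ h => h.1) fun V hV => by
    refine ⟨?_, hV.2⟩
    rw [liftState_one hN]
    exact hV.1.2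

lemma contDiffOn_rate (hM : M.Admissible) :
    ContDiffOn ℝ ∞ (M.rate : State N → ℝ) (M.tildeDomain N) :=
  ContDiffOn.mul (ContDiff.contDiffOn (by fun_prop))
    (hM.σa_smooth.comp (contDiffOn_tempT hM) fun _ hV => tempT_pos hV)

lemma contDiffOn_heatCapacity (hM : M.Admissible) :
    ContDiffOn ℝ ∞ (fun p : ℝ × ℝ => deriv (M.e p.1) p.2) (Ioi 0 ×ˢ Ioi 0) := by
  have hO : IsOpen (Ioi (0 : ℝ) ×ˢ Ioi (0 : ℝ)) := isOpen_Ioi.prod isOpen_Ioi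
  refine ((hM.e_smooth.fderiv_of_isOpen hO (m := ∞) le_rfl).clm_apply
    (contDiffOn_const (c := ((0 : ℝ), (1 : ℝ))))).congr fun p hp => ?_
  exact (((hM.e_smooth.contDiffAt (hO.mem_nhds hp)).differentiableAt
    (by simp)).hasFDerivAt.comp_hasDerivAt (f := fun t => (p.1, t)) p.2
      ((hasDerivAt_const p.2 p.1).prodMk (hasDerivAt_id p.2))).deriv

lemma contDiffOn_diagCoeff (hM : M.Admissible) (i : Fin (N + 1)) :
    ContDiffOn ℝ ∞ (fun V : State N => M.diagCoeff V i) (M.tildeDomain N) := by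
  unfold Medium.diagCoeff
  refine (contDiffOn_rate hM).neg.mul (contDiffOn_const.add ?_)
  split_ifs
  · have hb : ContDiffOn ℝ ∞ (deriv M.b) (Ioi 0) :=
      hM.b_smooth.deriv_of_isOpen isOpen_Ioi (m := ∞) le_rfl
    refine ContDiffOn.div (hb.comp (contDiffOn_tempT hM) fun V hV => tempT_pos hV)
      (ContDiffOn.mul (ContDiff.contDiffOn (by fun_prop)) ?_) fun V hV => ?_
    · exact (contDiffOn_heatCapacity hM).comp (f := fun V : State N => (V.1 0, M.tempT V))
        (ContDiffOn.prodMk (ContDiff.contDiffOn (by fun_prop)) (contDiffOn_tempT hM))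
        fun V hV => ⟨hV.1.1, tempT_pos hV⟩
    · exact (mul_pos (show 0 < V.1 0 from hV.1.1)
        (hM.e_deriv_pos _ hV.1.1 _ (tempT_pos hV))).ne'
  · exact contDiffOn_const

lemma contDiffOn_alphaCoeff (hM : M.Admissible) (hN : 1 ≤ N) (i : Fin (N + 1)) :
    ContDiffOn ℝ ∞ (fun V : State N => M.alphaCoeff V i) (M.regularDomain N) := by
  have hsub : M.regularDomain N ⊆ M.tildeDomain N := fun _ h => h.1
  have hr := (contDiffOn_rate (N := N) hM).mono hsub
  have hb : ContDiffOn ℝ ∞ (fun V : State N => M.b (M.tempT V) / 2) (M.regularDomain N) :=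
    (hM.b_smooth.comp ((contDiffOn_tempT hM).mono hsub) fun V hV => tempT_pos hV.1).div_const 2
  have hα : ∀ {f : ℝ → ℝ}, ContDiffOn ℝ ∞ f (Ioo (-1) 1) →
      ContDiffOn ℝ ∞ (fun V : State N => f (V.2 1)) (M.regularDomain N) := fun hf =>
    hf.comp (f := fun V : State N => V.2 1) (ContDiff.contDiffOn (by fun_prop))
      fun V hV => hV.1.2
  have hlift : ContDiffOn ℝ ∞ (fun V : State N => (M.liftState V).2 0) (M.regularDomain N) :=
    contDiffOn_pi.1 ((contDiffOn_liftState hM).mono hsub) 0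
  have hresp := contDiffOn_response_liftState (M := M) hM hN
  unfold Medium.alphaCoeff
  split_ifs
  · refine (hr.mul hb).mul (ContDiffOn.add (ContDiffOn.sub ((hlift.mul
      (hα (f := deriv fun α => kappa (weight α) 0 0) ?_)).mul (hresp 1))
      (hα (f := fun α => ∫ μ in (-1 : ℝ)..1, weightDefect (α, μ)) ?_)) ((hα (contDiffOn_kappa 4 0 0)).mul (hresp 0)))
    · exact (contDiffOn_kappa 4 0 0).deriv_of_isOpen isOpen_Ioo (m := ∞) le_rfl
    · exact contDiffOn_integral isOpen_weightDomain prod_subset_weightDomain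
        contDiffOn_weightDefect
  · exact hr.mul ((hb.mul (hresp i)).add contDiffOn_const)
  · exact hr.mul ((hb.mul (hresp i)).add contDiffOn_const)

end Smoothness

/-! ### Values at equilibrium -/

section Equilibrium

lemma integral_weightDefect_zero : ∫ μ in (-1 : ℝ)..1, weightDefect (0, μ) = 0 := by
  have : (fun μ => weightDefect (0, μ)) = fun μ => 4 * μ := by
    funext μ; simp [weightDefect, weight]
  rw [this, intervalIntegral.integral_const_mul, integral_id]
  norm_num

lemma deriv_kappa_zero : deriv (fun α => kappa (weight α) 0 0) 0 = 0 := by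
  have h1 : (fun α => kappa (weight α) 0 0) =ᶠ[nhds 0]
      fun α => 2 - α * ∫ μ in (-1 : ℝ)..1, weightDefect (α, μ) := by
    filter_upwards [isOpen_Ioo.mem_nhds zero_mem_Ioo] with α hα using kappa_zero_zero hα
  rw [h1.deriv_eq]
  have h2 := hasDerivAt_integral_of_contDiffOn isOpen_weightDomain prod_subset_weightDomain
    contDiffOn_weightDefect zero_mem_Ioo
  have h3 := ((hasDerivAt_id (0 : ℝ)).fun_mul h2).const_sub 2
  simp only [id] at h3
  rw [h3.deriv, integral_weightDefect_zero]
  ring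

variable {u : Fin 3 → ℝ}

lemma liftState_equilibrium (hM : M.Admissible) (hV : (u, (0 : Fin (N + 1) → ℝ)) ∈ M.tildeDomain N) :
    (∀ k, k ≠ 0 → (M.liftState (u, (0 : Fin (N + 1) → ℝ))).2 k = 0) ∧
      (M.liftState (u, (0 : Fin (N + 1) → ℝ))).2 0 =
        M.b (M.tempT (u, (0 : Fin (N + 1) → ℝ))) / 2 ∧
      0 < M.b (M.tempT (u, (0 : Fin (N + 1) → ℝ))) := by
  refine ⟨fun k hk => by simp [Medium.liftState, hk], ?_, hM.b_pos _ (tempT_pos hV)⟩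
  have := kappa_zero_zero zero_mem_Ioo
  simp [Medium.liftState, this]

/-- Positivity of `b` enters here: at equilibrium `det D̃ = -4 f₀ = -2 b`. -/
lemma mem_regularDomain_of_equilibrium (hM : M.Admissible) (hN : 1 ≤ N)
    (hV : (u, (0 : Fin (N + 1) → ℝ)) ∈ M.tildeDomain N) :
    (u, (0 : Fin (N + 1) → ℝ)) ∈ M.regularDomain N := by
  obtain ⟨h1, h2, h3⟩ := liftState_equilibrium hM hV
  exact ⟨hV, det_matD_isotropic hN h1 (by rw [h2]; positivity)⟩

/-- For `i = 1` the response `-1 / f₀ = -2 / b` gives `b / 2 * (-2 / b) + 1 = 0`. For `i = 0` the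
derivative of `κ₀₀`, the mean of the defect and the response all vanish, and for the remaining `i`
the response does. -/
lemma alphaCoeff_equilibrium (hM : M.Admissible) (hN : 1 ≤ N)
    (hV : (u, (0 : Fin (N + 1) → ℝ)) ∈ M.tildeDomain N) (i : Fin (N + 1)) :
    M.alphaCoeff (u, (0 : Fin (N + 1) → ℝ)) i = 0 := by
  obtain ⟨h1, h2, h3⟩ := liftState_equilibrium hM hV
  have h4 := response_isotropic hN h1 (by rw [h2]; positivity)
  rw [Medium.alphaCoeff, h4, h4, h4, h2]
  simp only [Pi.zero_apply, deriv_kappa_zero, integral_weightDefect_zero,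
    if_neg (Ne.symm (fin_one_ne_zero hN)), if_true]
  split_ifs
  · ring
  · field_simp
    ring
  · ring

lemma rate_pos (hM : M.Admissible) {V : State N} (hV : V ∈ M.tildeDomain N) : 0 < M.rate V :=
  mul_pos hV.1.1 (hM.σa_pos _ (tempT_pos hV))

lemma diagCoeff_le (hM : M.Admissible) {V : State N} (hV : V ∈ M.tildeDomain N)
    (i : Fin (N + 1)) : M.diagCoeff V i ≤ -M.rate V := by
  have h0 : 0 < V.1 0 := hV.1.1
  have hT := tempT_pos hV
  have hr := rate_pos hM hV
  have he := hM.e_deriv_pos _ h0 _ hT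
  have hb := hM.b_deriv_pos _ hT
  rw [Medium.diagCoeff, neg_mul, neg_le_neg_iff]
  refine le_mul_of_one_le_right hr.le (le_add_of_nonneg_right ?_)
  split_ifs <;> positivity

end Equilibrium

/-! ### Forward uniqueness -/

section Uniqueness

variable {E : Type*} [NormedAddCommGroup E] [NormedSpace ℝ E]

/-- Forward uniqueness for a vector field that is locally Lipschitz along one of the solutions. -/
lemma eq_of_locally_lipschitz {F : E → E} {f g : ℝ → E}
    (hf : ∀ t ≥ 0, HasDerivWithinAt f (F (f t)) (Ici 0) t)
    (hg : ∀ t ≥ 0, HasDerivWithinAt g (F (g t)) (Ici 0) t)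
    (hF : ∀ t ≥ 0, ∃ K, ∃ U ∈ nhds (g t), LipschitzOnWith K F U) (h0 : f 0 = g 0) {T : ℝ}
    (hT : 0 ≤ T) : f T = g T := by
  have hfc : ContinuousOn f (Ici 0) := fun t ht => (hf t ht).continuousWithinAt
  have hgc : ContinuousOn g (Ici 0) := fun t ht => (hg t ht).continuousWithinAt
  have hcl : IsClosed ({t | f t = g t} ∩ Icc 0 T) := by
    have := ((hfc.mono (Icc_subset_Ici_self : Icc (0:ℝ) T ⊆ Ici 0)).prodMk
      (hgc.mono (Icc_subset_Ici_self : Icc (0:ℝ) T ⊆ Ici 0))).preimage_isClosed_of_isClosed isClosed_Icc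
      isClosed_diagonal
    rwa [inter_comm] at this
  -- The agreement set is closed. From a point of agreement both solutions stay for a short time in
  -- one neighbourhood where `F` is Lipschitz, so agreement extends to the right.
  refine hcl.Icc_subset_of_forall_exists_gt h0 ?_ ⟨hT, le_rfl⟩
  rintro t ⟨hfg, ht⟩ y hy
  have hfg : f t = g t := hfg
  obtain ⟨K, U, hU, hK⟩ := hF t ht.1
  have hmono : Ici t ⊆ Ici 0 := Ici_subset_Ici.2 ht.1
  have h1 : ∀ᶠ s in nhdsWithin t (Ici t), f s ∈ U :=
    ((hfc t ht.1).mono hmono).eventually_mem (by rw [hfg]; exact hU)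
  have h2 : ∀ᶠ s in nhdsWithin t (Ici t), g s ∈ U :=
    ((hgc t ht.1).mono hmono).eventually_mem hU
  obtain ⟨z, hz, hzU⟩ := mem_nhdsGE_iff_exists_Icc_subset.1 (h1.and h2)
  have htz : t < min z y := lt_min hz hy
  have hsub : ∀ s ∈ Icc t (min z y), f s ∈ U ∧ g s ∈ U := fun s hs =>
    hzU ⟨hs.1, hs.2.trans (min_le_left _ _)⟩
  have hIcc : Icc t (min z y) ⊆ Ici 0 := fun s hs => ht.1.trans hs.1
  refine ⟨min z y, ?_, htz, min_le_right _ _⟩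
  refine ODE_solution_unique_of_mem_Icc_right (v := fun _ => F) (s := fun _ => U) (K := K)
    (fun _ _ => hK) (hfc.mono hIcc)
    (fun s hs => (hf s (hIcc (Ico_subset_Icc_self hs))).mono (Ici_subset_Ici.2 (ht.1.trans hs.1)))
    (fun s hs => (hsub s (Ico_subset_Icc_self hs)).1) (hgc.mono hIcc)
    (fun s hs => (hg s (hIcc (Ico_subset_Icc_self hs))).mono (Ici_subset_Ici.2 (ht.1.trans hs.1)))
    (fun s hs => (hsub s (Ico_subset_Icc_self hs)).2) hfg ⟨htz.le, le_rfl⟩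

end Uniqueness

/-! ### From uniform decay to Sobolev norms -/

section SobolevDecay

variable {n : ℕ}

lemma iteratedDeriv_apply_eq {v : ℝ × ℝ → Fin n → ℝ} (hv : ContDiff ℝ ∞ v) (j : ℕ) (τ : ℝ)
    (i : Fin n) : iteratedDeriv j (fun y => v (y, τ) i) = fun x => (dx^[j] v) (x, τ) i := by
  induction j with
  | zero => simp
  | succ j ih =>
    rw [iteratedDeriv_succ, ih, Function.iterate_succ_apply']
    funext x
    exact (hasDerivAt_pi.1 (hasDerivAt_dx (contDiff_iterate_dx hv j) x τ) i).deriv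

lemma sobolevNorm_le_of_decays {v : ℝ × ℝ → Fin n → ℝ} (hv : ContDiff ℝ ∞ v) {L γ : ℝ}
    (hL : 0 < L) (k : ℕ) (H : Decays γ k v) :
    ∃ C > 0, ∀ τ ≥ 0, sobolevNorm L k (fun x => v (x, τ)) ≤ C * Real.exp (-γ * τ) := by
  choose! C hC using H
  set S := ∑ j ∈ Finset.range (k + 1), L * (n * C j ^ 2) with hS
  have hS0 : 0 ≤ S := Finset.sum_nonneg fun j _ => by positivity
  -- `S` may vanish; adding `1` keeps the constant positive.
  refine ⟨Real.sqrt S + 1, by positivity, fun τ hτ => ?_⟩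
  set e := Real.exp (-γ * τ) with he
  have he0 : 0 < e := Real.exp_pos _
  have hle : ∑ j ∈ Finset.range (k + 1),
      ∫ x in (0 : ℝ)..L, ∑ i, (iteratedDeriv j (fun y => v (y, τ) i) x) ^ 2 ≤ S * e ^ 2 := by
    rw [hS, Finset.sum_mul]
    refine Finset.sum_le_sum fun j hj => ?_
    have hj' : j ≤ k := by simpa [Nat.lt_succ_iff] using hj
    have hb : ∀ x, ∑ i, (iteratedDeriv j (fun y => v (y, τ) i) x) ^ 2 ≤ n * C j ^ 2 * e ^ 2 := by
      intro x
      have h1 : ∀ i ∈ Finset.univ, (iteratedDeriv j (fun y => v (y, τ) i) x) ^ 2 ≤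
          (C j * e) ^ 2 := by
        intro i _
        rw [iteratedDeriv_apply_eq hv]
        refine sq_le_sq' ?_ ?_
        · have := (abs_le.1 ((norm_le_pi_norm _ i).trans (hC j hj' x τ hτ))).1
          exact this
        · exact (abs_le.1 ((norm_le_pi_norm _ i).trans (hC j hj' x τ hτ))).2
      refine (Finset.sum_le_sum h1).trans (le_of_eq ?_)
      simp
      ring
    have h2 := intervalIntegral.norm_integral_le_of_norm_le_const (a := 0) (b := L)
      (f := fun x => ∑ i, (iteratedDeriv j (fun y => v (y, τ) i) x) ^ 2)
      (C := n * C j ^ 2 * e ^ 2) fun x _ => by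
        rw [Real.norm_of_nonneg (Finset.sum_nonneg fun i _ => sq_nonneg _)]
        exact hb x
    refine (le_abs_self _).trans (h2.trans (le_of_eq ?_))
    rw [sub_zero, abs_of_pos hL]
    ring
  calc sobolevNorm L k (fun x => v (x, τ)) ≤ Real.sqrt (S * e ^ 2) := Real.sqrt_le_sqrt hle
    _ = Real.sqrt S * e := by rw [Real.sqrt_mul hS0, Real.sqrt_sq he0.le]
    _ ≤ (Real.sqrt S + 1) * e := by gcongr; linarith

end SobolevDecay

/-! ### The layer operator and its cut-off -/

section LayerOperator

variable {M : Medium} {N : ℕ}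

/-- The operator `A(V)` with `q(ũ, w̃; 0) = A(ũ, w̃) w̃`. -/
noncomputable def Medium.layerOperator (M : Medium) {N : ℕ} (V : State N) :
    (Fin (N + 1) → ℝ) →L[ℝ] (Fin (N + 1) → ℝ) :=
  ∑ i, (M.diagCoeff V i • (ContinuousLinearMap.single ℝ (fun _ => ℝ) i ∘L
      ContinuousLinearMap.proj (R := ℝ) (φ := fun _ => ℝ) i) +
    M.alphaCoeff V i • (ContinuousLinearMap.single ℝ (fun _ => ℝ) i ∘L
      ContinuousLinearMap.proj (R := ℝ) (φ := fun _ => ℝ) 1))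

lemma layerOperator_apply (V : State N) (v : Fin (N + 1) → ℝ) (i : Fin (N + 1)) :
    M.layerOperator V v i = M.diagCoeff V i * v i + M.alphaCoeff V i * v 1 := by
  simp [Medium.layerOperator, sum_apply, Pi.single_apply, Finset.sum_add_distrib]

lemma contDiffOn_layerOperator (hM : M.Admissible) (hN : 1 ≤ N) :
    ContDiffOn ℝ ∞ (M.layerOperator (N := N)) (M.regularDomain N) :=
  ContDiffOn.sum fun i _ =>
    (((contDiffOn_diagCoeff hM i).mono fun _ h => h.1).smul contDiffOn_const).add
      ((contDiffOn_alphaCoeff hM hN i).smul contDiffOn_const)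

lemma layerOperator_self (hM : M.Admissible) (hN : 1 ≤ N) {V : State N}
    (hV : V ∈ M.regularDomain N) : M.layerOperator V V.2 = M.q V.1 V.2 0 := by
  funext i
  rw [layerOperator_apply, q_eq hM hN hV]

lemma dotProduct_layerOperator_le (hM : M.Admissible) (hN : 1 ≤ N) {u : Fin 3 → ℝ}
    (hV : (u, (0 : Fin (N + 1) → ℝ)) ∈ M.tildeDomain N) (v : Fin (N + 1) → ℝ) :
    v ⬝ᵥ M.layerOperator (u, (0 : Fin (N + 1) → ℝ)) v ≤
      -M.rate (u, (0 : Fin (N + 1) → ℝ)) * (v ⬝ᵥ v) := by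
  simp only [dotProduct, Finset.mul_sum]
  refine Finset.sum_le_sum fun i _ => ?_
  rw [layerOperator_apply, alphaCoeff_equilibrium hM hN hV]
  have h1 := mul_le_mul_of_nonneg_right (diagCoeff_le hM hV i) (mul_self_nonneg (v i))
  linarith

lemma exists_uniform_radius {L : ℝ} (hL : 0 < L) {u : ℝ → Fin 3 → ℝ} (hu : Continuous u)
    (hup : Function.Periodic u L) {O : Set (State N)} (hO : IsOpen O)
    (h : ∀ x, (u x, (0 : Fin (N + 1) → ℝ)) ∈ O) :
    ∃ r > 0, ∀ x y, ‖y‖ < r → (u x, y) ∈ O := by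
  have hO' : IsOpen ((fun p : ℝ × (Fin (N + 1) → ℝ) => (u p.1, p.2)) ⁻¹' O) :=
    hO.preimage (by fun_prop)
  -- Tube lemma over one period: one radius serves all `x`.
  obtain ⟨a, b, -, hb, ha, h0b, hab⟩ := generalized_tube_lemma (isCompact_Icc (a := 0) (b := L))
    (isCompact_singleton (x := (0 : Fin (N + 1) → ℝ))) hO'
    (by rintro ⟨x, y⟩ ⟨_, rfl⟩; exact h x)
  obtain ⟨r, hr, hball⟩ := Metric.isOpen_iff.1 hb 0 (h0b rfl)
  refine ⟨r, hr, fun x y hy => ?_⟩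
  obtain ⟨x', hx', he⟩ := hup.exists_mem_Ico₀ hL x
  rw [he]
  exact hab (show (x', y) ∈ a ×ˢ b from
    ⟨ha (Ico_subset_Icc_self hx'), hball (by simpa using hy)⟩)

/-- The cut-off field operator of the layer problem. -/
lemma exists_cutoff_operator (hM : M.Admissible) (hN : 1 ≤ N) {u : ℝ → Fin 3 → ℝ}
    (hu : ContDiff ℝ ∞ u) {r : ℝ} (hr : 0 < r)
    (h : ∀ x (y : Fin (N + 1) → ℝ), ‖y‖ < r → (u x, y) ∈ M.regularDomain N) :
    ∃ χ : (Fin (N + 1) → ℝ) → ℝ, (∀ y, ‖y‖ ≤ r / 4 → χ y = 1) ∧ (∀ y, r / 2 ≤ ‖y‖ → χ y = 0) ∧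
      ContDiff ℝ ∞ fun p : ℝ × (Fin (N + 1) → ℝ) => χ p.2 • M.layerOperator (u p.1, p.2) := by
  let χ : ContDiffBump (0 : Fin (N + 1) → ℝ) := ⟨r / 4, r / 2, by linarith, by linarith⟩
  refine ⟨χ, fun y hy => χ.one_of_mem_closedBall (by simpa using hy),
    fun y hy => χ.zero_of_le_dist (by simpa using hy), ?_⟩
  refine contDiff_iff_contDiffAt.2 fun ⟨x, y⟩ => ?_
  rcases lt_or_ge ‖y‖ r with hy | hy
  · have hA : ContDiffAt ℝ ∞ (M.layerOperator (N := N)) (u x, y) :=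
      (contDiffOn_layerOperator hM hN).contDiffAt ((isOpen_regularDomain hM hN).mem_nhds (h x y hy))
    refine ContDiffAt.smul (χ.contDiff.comp contDiff_snd).contDiffAt ?_
    exact ContDiffAt.comp (x, y) (f := fun p : ℝ × (Fin (N + 1) → ℝ) => (u p.1, p.2)) hA
      ((hu.comp contDiff_fst).prodMk contDiff_snd).contDiffAt
  -- Beyond `r / 2` the cut-off vanishes, so the values of the operator outside the regular domain
  -- do not matter.
  · refine (contDiffAt_const (c := 0)).congr_of_eventuallyEq ?_
    have : ∀ᶠ p : ℝ × (Fin (N + 1) → ℝ) in nhds (x, y), r / 2 < ‖p.2‖ :=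
      (continuous_norm.comp continuous_snd).continuousAt.eventually_const_lt
        (show r / 2 < ‖y‖ by linarith)
    filter_upwards [this] with p hp
    rw [χ.zero_of_le_dist (by simpa using hp.le), zero_smul]

lemma exists_rate_lower_bound (hM : M.Admissible) {L : ℝ} (hL : 0 < L) {u : ℝ → Fin 3 → ℝ}
    (hu : Continuous u) (hup : Function.Periodic u L)
    (h : ∀ x, (u x, (0 : Fin (N + 1) → ℝ)) ∈ M.tildeDomain N) :
    ∃ lam > 0, ∀ x, lam ≤ M.rate (u x, (0 : Fin (N + 1) → ℝ)) := by
  have hc : Continuous fun x => M.rate (u x, (0 : Fin (N + 1) → ℝ)) :=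
    (contDiffOn_rate hM).continuousOn.comp_continuous (hu.prodMk continuous_const) h
  obtain ⟨x₀, -, hmin⟩ := (isCompact_Icc (a := (0 : ℝ)) (b := L)).exists_isMinOn
    (nonempty_Icc.2 hL.le) hc.continuousOn
  refine ⟨_, rate_pos hM (h x₀), fun x => ?_⟩
  obtain ⟨x', hx', he⟩ := hup.exists_mem_Ico₀ hL x
  rw [he]
  exact hmin (Ico_subset_Icc_self hx')

end LayerOperator

end EulerHMP

/-! ### The initial-layer problem -/

theorem lemma4p5 (M : EulerHMP.Medium) (hM : M.Admissible) (N : ℕ) (hN : 1 ≤ N)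
    (L : ℝ) (hL : 0 < L) (ubar : ℝ → Fin 3 → ℝ)
    (hu_smooth : ContDiff ℝ ∞ ubar) (hu_per : Function.Periodic ubar L)
    (hu_eq : ∀ x, (ubar x, (0 : Fin (N + 1) → ℝ)) ∈ M.GTilde N 0) :
    ∃ δ > 0, ∀ wbar : ℝ → Fin (N + 1) → ℝ,
      ContDiff ℝ ∞ wbar → Function.Periodic wbar L → (∀ x, ‖wbar x‖ ≤ δ) →
      ∃ I : ℝ → ℝ → Fin (N + 1) → ℝ,
        M.IsLayerSolution ubar wbar I ∧
        ContDiffOn ℝ ∞ (fun z : ℝ × ℝ => I z.1 z.2) (univ ×ˢ Ici 0) ∧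
        (∀ τ ≥ 0, Function.Periodic (fun x => I x τ) L) ∧
        (∀ J : ℝ → ℝ → Fin (N + 1) → ℝ, M.IsLayerSolution ubar wbar J →
          ∀ x, ∀ τ ≥ 0, J x τ = I x τ) ∧
        ∀ s m : ℕ, ∃ C > 0, ∃ γ > 0, ∀ τ ≥ 0,
          EulerHMP.sobolevNorm L (s + m) (fun x => I x τ) ≤ C * Real.exp (-γ * τ) := by
  rw [EulerHMP.GTilde_eq hM hN] at hu_eq
  obtain ⟨r, hr, hdom⟩ := EulerHMP.exists_uniform_radius hL hu_smooth.continuous hu_per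
    (EulerHMP.isOpen_regularDomain hM hN)
    fun x => EulerHMP.mem_regularDomain_of_equilibrium hM hN (hu_eq x)
  obtain ⟨χ, hχ1, hχ0, hA⟩ := EulerHMP.exists_cutoff_operator hM hN hu_smooth hr hdom
  obtain ⟨lam, hlam, hrate⟩ := EulerHMP.exists_rate_lower_bound hM hL hu_smooth.continuous hu_per
    hu_eq
  have hfield : ∀ x y, ‖y‖ ≤ r / 4 → (χ y • M.layerOperator (ubar x, y)) y = M.q (ubar x) y 0 := by
    intro x y hy
    rw [hχ1 y hy, one_smul]
    exact EulerHMP.layerOperator_self hM hN (hdom x y (by linarith))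
  obtain ⟨δ, hδ, hsol⟩ := EulerHMP.exists_decaying_family hA hL
    (fun x y => by simp only [hu_per x]) (r := r / 2)
    (fun x y hy => by simp only [hχ0 y hy, zero_smul]) hlam
    (fun x v => by
      simp only [hχ1 0 (by simp; positivity), one_smul]
      refine (EulerHMP.dotProduct_layerOperator_le hM hN (hu_eq x) v).trans ?_
      have h0 : 0 ≤ v ⬝ᵥ v := Finset.sum_nonneg fun i _ => mul_self_nonneg _
      exact mul_le_mul_of_nonneg_right (neg_le_neg (hrate x)) h0)
    -- Values of norm at most `r / 8` lie inside the ball of radius `r / 4` on which the cut-off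
    -- equals `1`, so the cut-off and the true field agree near every value of the solution.
    (ρ := r / 8) (by positivity)
  refine ⟨δ, hδ, fun wbar hw hwp hwδ => ?_⟩
  obtain ⟨v, hv, hv0, hvd, hvp, hvr, γ, hγ, hdecay⟩ := hsol wbar hw hwp hwδ
  have hvd' : ∀ x, ∀ τ ≥ 0,
      HasDerivWithinAt (fun t => v (x, t)) (M.q (ubar x) (v (x, τ)) 0) (Ici 0) τ := by
    intro x τ hτ
    rw [← hfield x _ ((hvr x τ hτ).trans (by linarith))]
    exact (hvd x τ).hasDerivWithinAt
  refine ⟨fun x τ => v (x, τ), fun x => ⟨hv0 x, fun τ hτ => ⟨?_, hvd' x τ hτ⟩⟩, hv.contDiffOn,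
    fun τ _ x => hvp x τ, fun J hJ x τ hτ => ?_, fun s m => ?_⟩
  · rw [EulerHMP.GTilde_eq hM hN]
    exact (hdom x _ ((hvr x τ hτ).trans_lt (by linarith))).1
  -- The competitor `J` solves the problem without cut-off and need not be small a priori; the
  -- Lipschitz bound is used only near the values of `v`.
  · refine EulerHMP.eq_of_locally_lipschitz (F := fun y => M.q (ubar x) y 0) (f := J x)
      (g := fun t => v (x, t)) (fun t ht => ((hJ x).2 t ht).2) (hvd' x) (fun t ht => ?_)
      (by rw [(hJ x).1, hv0]) hτ
    have hlt : ‖v (x, t)‖ < r / 4 := (hvr x t ht).trans_lt (by linarith)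
    have hsm : ContDiff ℝ 1 fun y => (χ y • M.layerOperator (ubar x, y)) y :=
      ((hA.comp (contDiff_const (c := x).prodMk contDiff_id)).clm_apply contDiff_id).of_le
        (by exact_mod_cast le_top)
    have hev : (fun y => M.q (ubar x) y 0) =ᶠ[nhds (v (x, t))]
        fun y => (χ y • M.layerOperator (ubar x, y)) y := by
      filter_upwards [continuous_norm.continuousAt.eventually_lt continuousAt_const hlt] with y hy
      exact (hfield x y hy.le).symm
    exact (hsm.contDiffAt.congr_of_eventuallyEq hev).exists_lipschitzOnWith
  · obtain ⟨C, hC, h⟩ := EulerHMP.sobolevNorm_le_of_decays hv hL (s + m) (hdecay (s + m))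
    exact ⟨C, hC, γ, hγ, h⟩
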